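/- Let $d\ge 3$. Let $\mathbb B^d$ be the set of nonoriented nearest-neighbour bonds $\{x,x+e_i\}$ of $\mathbb Z^d$ ($x\in\mathbb Z^d$, $1\le i\le d$). For $u:\mathbb Z^d\to\mathbb R$ set $\nabla u(\{x,x+e_i\})=u(x+e_i)-u(x)$, and for $F:\mathbb B^d\to\mathbb R$ set $\nabla^*F(x)=\sum_{i=1}^d\bigl(F(\{x-e_i,x\})-F(\{x,x+e_i\})\bigr)$. For $y\in\mathbb Z^d$ and $n\in\{1,2,\dots\}$ let $B(y,n)=y+([-n,n]\cap\mathbb Z)^d$. For a nonempty finite set $A$ and $F:A\to\mathbb R$ let $\|F\|_{\underline L^p(A)}=\bigl(\frac1{|A|}\sum_{a\in A}|F(a)|^p\bigr)^{1/p}$ for $0<p<\infty$ and $\|F\|_{\underline L^\infty(A)}=\max_{a\in A}|F(a)|$. For $\omega:\mathbb B^d\to(0,\infty)$, $p,q\in(1,\infty]$ and a finite $S\subset\mathbb Z^d$ containing both endpoints of at least one bond, set $$\Lambda^\omega(S)=\|\omega\|_{\underline L^p(S_{\mathbb B})}\,\|\omega^{-1}\|_{\underline L^q(S_{\mathbb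 B})},$$ where $S_{\mathbb B}$ is the set of bonds with both endpoints in $S$. **Theorem.** Let $d\ge3$ and let $p,q\in(1,\infty]$ satisfy $\frac1p+\frac1q<\frac2{d-1}$ (with $\frac1\infty=0$). Put $\delta=\frac1{d-1}-\frac1{2p}-\frac1{2q}$ and $p'=\frac p{p-1}$ (with $p'=1$ if $p=\infty$). Then $\delta>0$, and there is a constant $c=c(d,p,q)\in[1,\infty)$ such that for every $\omega:\mathbb B^d\to(0,\infty)$, every $u:\mathbb Z^d\to\mathbb R$ with $\nabla^*(\omega\nabla u)=0$ on $\mathbb Z^d$, every $y\in\mathbb Z^d$ and every integer $n\ge1$, $$\max_{x\in B(y,n)}|u(x)|\le c\,\Lambda^\omega(B(y,2n))^{p'\frac{\delta+1}{\delta}}\,\|u\|_{\underline L^1(B(y,2n))}.$$ -/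

import Mathlib

open scoped ENNReal

/-- The vertex set `ℤ^d`. -/
abbrev LatticePt (d : ℕ) : Type := Fin d → ℤ

/-- The set `𝔹^d` of nonoriented nearest-neighbour bonds. Every such bond is `{x, x + e_i}` for
exactly one vertex `x` and one direction `i` (proved below in `Bond.toSym2_injective` and
`Bond.range_toSym2`), and it is represented by this pair `(x, i)`. -/
abbrev Bond (d : ℕ) : Type := LatticePt d × Fin d

namespace Bond

/-- The endpoint `x` of the bond `{x, x + e_i}`. -/
def lower {d : ℕ} (b : Bond d) : LatticePt d := b.1

/-- The endpoint `x + e_i` of the bond `{x, x + e_i}`. -/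
def upper {d : ℕ} (b : Bond d) : LatticePt d := b.1 + Pi.single b.2 1

/-- The bond as an unordered pair of vertices. -/
def toSym2 {d : ℕ} (b : Bond d) : Sym2 (LatticePt d) := s(b.lower, b.upper)

theorem toSym2_injective {d : ℕ} : Function.Injective (toSym2 (d := d)) := by
  rintro ⟨x, i⟩ ⟨y, j⟩ h
  simp only [toSym2, lower, upper, Sym2.eq_iff] at h
  rcases h with ⟨rfl, h⟩ | ⟨h1, h2⟩
  · have h' := congrFun (add_left_cancel h) i
    by_cases hij : i = j
    · rw [hij]
    · simp [hij] at h'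
  · rw [h1, add_assoc] at h2
    have h3 := congrFun (left_eq_add.mp h2.symm) i
    have h4 : (0 : ℤ) ≤ (Pi.single j 1 : LatticePt d) i := by
      by_cases hij : i = j <;> simp [hij]
    simp only [Pi.add_apply, Pi.single_eq_same, Pi.zero_apply] at h3
    omega

/-- The bonds are exactly the unordered pairs of vertices at Euclidean distance `1`. -/
theorem range_toSym2 {d : ℕ} :
    Set.range (toSym2 (d := d)) = {e | ∃ x y : LatticePt d, e = s(x, y) ∧ ∑ i, (x i - y i) ^ 2 = 1} := by
  ext e
  constructor
  · rintro ⟨⟨x, i⟩, rfl⟩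
    refine ⟨x, x + Pi.single i 1, rfl, ?_⟩
    rw [Finset.sum_eq_single i]
    · simp
    · intro j _ hj
      simp [hj]
    · simp
  · rintro ⟨x, y, rfl, h⟩
    have hex : ∃ i, x i - y i ≠ 0 := by
      by_contra hcon
      push Not at hcon
      simp [hcon] at h
    obtain ⟨i, hi⟩ := hex
    rw [← Finset.add_sum_erase _ _ (Finset.mem_univ i)] at h
    have hnn : ∀ j ∈ Finset.univ.erase i, 0 ≤ (x j - y j) ^ 2 := fun j _ => sq_nonneg _
    have hs := Finset.sum_nonneg hnn
    have hpos : 0 < (x i - y i) ^ 2 := by positivity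
    have h1 : (x i - y i) ^ 2 = 1 := by omega
    have h0 : ∑ j ∈ Finset.univ.erase i, (x j - y j) ^ 2 = 0 := by omega
    have hz : ∀ j, j ≠ i → x j = y j := by
      intro j hj
      have hj' := (Finset.sum_eq_zero_iff_of_nonneg hnn).mp h0 j (by simp [hj])
      have := pow_eq_zero_iff (two_ne_zero) |>.mp hj'
      omega
    have h2 : x i - y i = 1 ∨ x i - y i = -1 := by simpa using h1
    rcases h2 with h2 | h2
    · refine ⟨(y, i), ?_⟩
      have : y + Pi.single i 1 = x := by
        ext j
        by_cases hj : j = i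
        · subst hj; simp; omega
        · simp [hj, hz j hj]
      simp only [toSym2, lower, upper, this]
      exact Sym2.eq_swap
    · refine ⟨(x, i), ?_⟩
      have : x + Pi.single i 1 = y := by
        ext j
        by_cases hj : j = i
        · subst hj; simp; omega
        · simp [hj, hz j hj]
      simp only [toSym2, lower, upper, this]

end Bond

/-- The box `B(y,n) = y + ([-n,n] ∩ ℤ)^d`. -/
noncomputable def box {d : ℕ} (y : LatticePt d) (n : ℕ) : Finset (LatticePt d) :=
  Finset.Icc (fun i => y i - (n : ℤ)) (fun i => y i + (n : ℤ))

theorem mem_box {d : ℕ} (y x : LatticePt d) (n : ℕ) :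
    x ∈ box y n ↔ ∀ i, |x i - y i| ≤ n := by
  simp only [box, Finset.mem_Icc, Pi.le_def, ← forall_and, abs_le]
  exact forall_congr' fun i => by omega

/-- The set of bonds with both endpoints in `S`. -/
def bondsIn {d : ℕ} (S : Finset (LatticePt d)) : Finset (Bond d) :=
  (S ×ˢ (Finset.univ : Finset (Fin d))).filter (fun b => Bond.upper b ∈ S)

theorem mem_bondsIn {d : ℕ} (S : Finset (LatticePt d)) (b : Bond d) :
    b ∈ bondsIn S ↔ b.lower ∈ S ∧ b.upper ∈ S := by
  simp [bondsIn, Bond.lower]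

/-- The normalized (averaged) `L^p` norm of `F` on a finite set `S`, for `p ∈ (0,∞]`:
`(|S|⁻¹ ∑_{a ∈ S} |F a|^p)^(1/p)` if `p < ∞`, and `sup_{a ∈ S} |F a|` if `p = ∞`. -/
noncomputable def avgNorm {α : Type*} (p : ℝ≥0∞) (S : Finset α) (F : α → ℝ) : ℝ :=
  if p = ∞ then ⨆ a : S, |F a|
  else ((S.card : ℝ)⁻¹ * ∑ a ∈ S, |F a| ^ p.toReal) ^ (1 / p.toReal)

/-- The discrete derivative `∇u({x, x + e_i}) = u(x + e_i) - u(x)`. -/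
def grad {d : ℕ} (u : LatticePt d → ℝ) (b : Bond d) : ℝ :=
  u b.upper - u b.lower

/-- The discrete divergence
`∇^*F(x) = ∑_i (F({x - e_i, x}) - F({x, x + e_i}))`. -/
def divStar {d : ℕ} (F : Bond d → ℝ) (x : LatticePt d) : ℝ :=
  ∑ i : Fin d, (F (x - Pi.single i 1, i) - F (x, i))

/-- `Λ^ω(S) = ‖ω‖_{L^p(S)} ‖ω⁻¹‖_{L^q(S)}`, with averaged norms over the bonds of `S`. -/
noncomputable def Lam {d : ℕ} (p q : ℝ≥0∞) (ω : Bond d → ℝ) (S : Finset (LatticePt d)) : ℝ :=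
  avgNorm p (bondsIn S) ω * avgNorm q (bondsIn S) (fun b => (ω b)⁻¹)

/-- The dual exponent `p' = p / (p - 1)` of `p ∈ (1,∞]`, with `p' = 1` for `p = ∞`. -/
noncomputable def dualExp (p : ℝ≥0∞) : ℝ :=
  if p = ∞ then 1 else p.toReal / (p.toReal - 1)

/-- `δ = 1/(d-1) - 1/(2p) - 1/(2q)`, with `1/∞ = 0`. -/
noncomputable def delta (d : ℕ) (p q : ℝ≥0∞) : ℝ :=
  1 / ((d : ℝ) - 1) - p⁻¹.toReal / 2 - q⁻¹.toReal / 2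

/-
Let `u` be `ω`-harmonic. Then `w = |u|` is a nonnegative subsolution and satisfies the Caccioppoli
inequality for every power `w ^ α`, `α ≥ 1`, with any cutoff function. The cutoff is chosen to jump
only across those hyperplanes, at least a third of all in each direction, on which both the energy
of `w ^ α` and the power sum of `ω` are comparable to their averages. The error terms then live on
hyperplanes of dimension `d - 1`, where the Sobolev inequality is better than in dimension `d`; this
yields a gain `δ` in the integrability exponent although only `1/p + 1/q < 2/(d - 1)` is assumed.
Iterating over the powers `(1 + δ) ^ k` on shrinking boxes bounds `max w` by the `L^{2p'}` average
of `w`, and interpolating this average between `L^1` and `L^∞` on a slightly larger box makes the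
bound one by the `L^1` average.
-/

section RealAnalysis

theorem sum_rpow_mul_rpow_le {κ : Type*} (S : Finset κ) {f g : κ → ℝ} {α β : ℝ}
    (hf : ∀ i ∈ S, 0 ≤ f i) (hg : ∀ i ∈ S, 0 ≤ g i) (hα : 0 ≤ α) (hβ : 0 ≤ β) (h : α + β = 1) :
    ∑ i ∈ S, f i ^ α * g i ^ β ≤ (∑ i ∈ S, f i) ^ α * (∑ i ∈ S, g i) ^ β := by
  rcases hα.eq_or_lt with rfl | hα
  · obtain rfl : β = 1 := by linarith
    simp
  rcases hβ.eq_or_lt with rfl | hβ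
  · obtain rfl : α = 1 := by linarith
    simp
  have hc : Real.HolderConjugate (1 / α) (1 / β) := by
    rw [Real.holderConjugate_iff]
    refine ⟨?_, by simpa using h⟩
    rw [lt_div_iff₀ hα]; linarith
  have := Real.inner_le_Lp_mul_Lq_of_nonneg S hc (f := fun i => f i ^ α) (g := fun i => g i ^ β)
    (fun i hi => Real.rpow_nonneg (hf i hi) _) (fun i hi => Real.rpow_nonneg (hg i hi) _)
  refine this.trans (le_of_eq ?_)
  rw [one_div_one_div, one_div_one_div]
  congr 2
  · refine Finset.sum_congr rfl fun i hi => ?_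
    rw [← Real.rpow_mul (hf i hi), mul_one_div_cancel hα.ne', Real.rpow_one]
  · refine Finset.sum_congr rfl fun i hi => ?_
    rw [← Real.rpow_mul (hg i hi), mul_one_div_cancel hβ.ne', Real.rpow_one]

theorem sum_rpow_le_card_rpow_mul {κ : Type*} (S : Finset κ) {f : κ → ℝ} {α : ℝ}
    (hf : ∀ i ∈ S, 0 ≤ f i) (hα : 0 ≤ α) (hα1 : α ≤ 1) :
    ∑ i ∈ S, f i ^ α ≤ (S.card : ℝ) ^ (1 - α) * (∑ i ∈ S, f i) ^ α := by
  simpa using sum_rpow_mul_rpow_le S (f := fun _ => 1) (fun _ _ => zero_le_one) hf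
    (sub_nonneg.2 hα1) hα (by ring)

theorem mul_rpow_sub_one_mul_sub_le {a b γ : ℝ} (ha : 0 ≤ a) (hb : 0 ≤ b) (hγ : 1 ≤ γ) :
    γ * b ^ (γ - 1) * (a - b) ≤ a ^ γ - b ^ γ := by
  rcases hγ.eq_or_lt with rfl | hγ
  · simp
  rcases hb.eq_or_lt with rfl | hb
  · rw [Real.zero_rpow (by linarith), Real.zero_rpow (by linarith)]
    simpa using Real.rpow_nonneg ha γ
  have bernoulli := one_add_mul_self_le_rpow_one_add (s := a / b - 1)
    (by have := div_nonneg ha hb.le; linarith) hγ.le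
  rw [add_sub_cancel, Real.div_rpow ha hb.le, le_div_iff₀ (Real.rpow_pos_of_pos hb _)] at bernoulli
  have hpow : b ^ γ = b ^ (γ - 1) * b := by
    rw [← Real.rpow_add_one hb.ne']; ring_nf
  rw [hpow] at bernoulli ⊢
  have : (1 + γ * (a / b - 1)) * (b ^ (γ - 1) * b)
      = b ^ (γ - 1) * b + γ * b ^ (γ - 1) * (a - b) := by
    field_simp
  linarith

theorem abs_rpow_sub_rpow_le {a b γ : ℝ} (ha : 0 ≤ a) (hb : 0 ≤ b) (hγ : 1 ≤ γ) :
    |a ^ γ - b ^ γ| ≤ γ * max a b ^ (γ - 1) * |a - b| := by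
  wlog hab : b ≤ a generalizing a b
  · rw [abs_sub_comm, abs_sub_comm a, max_comm]
    exact this hb ha (le_of_not_ge hab)
  rw [max_eq_left hab, abs_of_nonneg (sub_nonneg.2 hab),
    abs_of_nonneg (sub_nonneg.2 (Real.rpow_le_rpow hb hab (by linarith)))]
  have := mul_rpow_sub_one_mul_sub_le hb ha hγ
  linarith

theorem max_rpow_le_add_rpow {a b r : ℝ} (ha : 0 ≤ a) (hb : 0 ≤ b) :
    max a b ^ r ≤ a ^ r + b ^ r := by
  rcases max_choice a b with h | h <;> rw [h]
  · exact le_add_of_nonneg_right (Real.rpow_nonneg hb r)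
  · exact le_add_of_nonneg_left (Real.rpow_nonneg ha r)

theorem abs_rpow_sub_rpow_rpow_le {a b s t r γ θ : ℝ} (ha : 0 ≤ a) (hb : 0 ≤ b) (hs : 0 ≤ s)
    (hγ : 1 ≤ γ) (hθ : θ ≤ 1) (hr : s * (γ - 1) = r * (1 - θ)) (ht : s = t * θ) :
    |a ^ γ - b ^ γ| ^ s ≤ γ ^ s * ((a ^ r + b ^ r) ^ (1 - θ) * (|a - b| ^ t) ^ θ) := by
  have hm : 0 ≤ max a b := le_max_of_le_left ha
  calc |a ^ γ - b ^ γ| ^ s ≤ (γ * max a b ^ (γ - 1) * |a - b|) ^ s :=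
        Real.rpow_le_rpow (abs_nonneg _) (abs_rpow_sub_rpow_le ha hb hγ) hs
    _ = γ ^ s * ((max a b ^ r) ^ (1 - θ) * (|a - b| ^ t) ^ θ) := by
        rw [Real.mul_rpow (by positivity) (abs_nonneg _), Real.mul_rpow (by linarith)
          (by positivity), ← Real.rpow_mul hm, ← Real.rpow_mul hm, ← Real.rpow_mul (abs_nonneg _),
          mul_comm _ s, hr, ← ht, mul_assoc]
    _ ≤ γ ^ s * ((a ^ r + b ^ r) ^ (1 - θ) * (|a - b| ^ t) ^ θ) := by
        have := max_rpow_le_add_rpow (r := r) ha hb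
        have : 0 ≤ 1 - θ := by linarith
        gcongr

theorem le_rpow_mul_rpow_of_le_mul_rpow {Z K T m r s : ℝ} (hZ : 0 ≤ Z) (hK : 0 ≤ K) (hT : 0 ≤ T)
    (hm : 0 < m) (hr : 0 < r) (hexp : 1 / m = 1 / r + (1 - 1 / s))
    (h : Z ≤ (K * Z ^ (1 - 1 / s) * T ^ (1 / s)) ^ m) :
    Z ≤ K ^ r * T ^ (r / s) := by
  rcases hZ.eq_or_lt with rfl | hZ
  · positivity
  have hroot : Z ^ (1 / r) * Z ^ (1 - 1 / s) ≤ K * T ^ (1 / s) * Z ^ (1 - 1 / s) := by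
    rw [← Real.rpow_add hZ, ← hexp, mul_right_comm]
    refine (Real.rpow_le_rpow hZ.le h (by positivity)).trans_eq ?_
    rw [← Real.rpow_mul (by positivity), mul_one_div_cancel hm.ne', Real.rpow_one]
  have hle : Z ^ (1 / r) ≤ K * T ^ (1 / s) := le_of_mul_le_mul_right hroot (by positivity)
  calc Z = (Z ^ (1 / r)) ^ r := by
        rw [← Real.rpow_mul hZ.le, one_div_mul_cancel hr.ne', Real.rpow_one]
    _ ≤ (K * T ^ (1 / s)) ^ r := Real.rpow_le_rpow (by positivity) hle hr.le
    _ = K ^ r * T ^ (r / s) := by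
        rw [Real.mul_rpow hK (by positivity), ← Real.rpow_mul hT, one_div_mul_eq_div]

theorem abs_sub_le_sum_abs_succ_sub (φ : ℤ → ℝ) {c e : ℤ} (hce : c ≤ e) :
    |φ e - φ c| ≤ ∑ z ∈ Finset.Ico c e, |φ (z + 1) - φ z| := by
  induction e, hce using Int.leInduction with
  | base => simp
  | succ e hce ih =>
    rw [← Finset.insert_Ico_right_eq_Ico_add_one hce, Finset.sum_insert (by simp)]
    have := abs_sub_le (φ (e + 1)) (φ e) (φ c)
    linarith

theorem abs_sub_le_variation (φ : ℤ → ℝ) {a b x z : ℤ} (hx : x ∈ Finset.Icc a b)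
    (hz : z ∈ Finset.Icc a b) : |φ x - φ z| ≤ ∑ y ∈ Finset.Ico a b, |φ (y + 1) - φ y| := by
  wlog hzx : z ≤ x generalizing x z
  · rw [abs_sub_comm]
    exact this hz hx (le_of_not_ge hzx)
  rw [Finset.mem_Icc] at hx hz
  exact (abs_sub_le_sum_abs_succ_sub φ hzx).trans <|
    Finset.sum_le_sum_of_subset_of_nonneg (Finset.Ico_subset_Ico hz.1 hx.2)
      fun _ _ _ => abs_nonneg _

theorem le_variation_add_average {φ : ℤ → ℝ} {a b x : ℤ} {l : ℝ} (hφ : ∀ z, 0 ≤ φ z)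
    (hx : x ∈ Finset.Icc a b) (hl : 0 < l) (hlb : l ≤ b - a + 1) :
    φ x ≤ ∑ z ∈ Finset.Ico a b, |φ (z + 1) - φ z| + ∑ z ∈ Finset.Icc a b, φ z / l := by
  obtain ⟨z, hz, hmin⟩ := Finset.exists_min_image _ φ ⟨x, hx⟩
  have hmin_le_average : φ z ≤ ∑ y ∈ Finset.Icc a b, φ y / l := by
    have hcard : ((Finset.Icc a b).card : ℝ) = b - a + 1 := by
      have hab := Finset.mem_Icc.1 hx
      have : ((Finset.Icc a b).card : ℤ) = b + 1 - a := by
        rw [Int.card_Icc, Int.toNat_of_nonneg (by omega)]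
      rw [← Int.cast_natCast, this]
      push_cast
      ring
    rw [← Finset.sum_div, le_div_iff₀' hl]
    calc l * φ z ≤ (Finset.Icc a b).card • φ z := by
          rw [nsmul_eq_mul, hcard]
          exact mul_le_mul_of_nonneg_right hlb (hφ z)
      _ ≤ ∑ y ∈ Finset.Icc a b, φ y := Finset.card_nsmul_le_sum _ φ _ hmin
  have := (le_abs_self _).trans (abs_sub_le_variation φ hx hz)
  linarith

end RealAnalysis

section LoomisWhitney

open MeasureTheory

variable {ι : Type*} [DecidableEq ι]

theorem update_mem_Icc {a b x : ι → ℤ} (hx : x ∈ Set.Icc a b) {j : ι} {z : ℤ} :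
    Function.update x j z ∈ Set.Icc a b ↔ z ∈ Set.Icc (a j) (b j) := by
  refine ⟨fun h => ?_, fun h => ?_⟩
  · simpa using And.intro (h.1 j) (h.2 j)
  · exact ⟨le_update_iff.2 ⟨h.1, fun i _ => hx.1 i⟩, update_le_iff.2 ⟨h.2, fun i _ => hx.2 i⟩⟩

variable [Fintype ι]

theorem tsum_prod_tsum_update_rpow_le {p : ℝ} (hp : Real.HolderConjugate (Fintype.card ι) p)
    (f : (ι → ℤ) → ℝ≥0∞) :
    ∑' x, ∏ i, (∑' z, f (Function.update x i z)) ^ (1 / ((Fintype.card ι : ℝ) - 1)) ≤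
      (∑' x, f x) ^ p := by
  simpa only [lintegral_countable', Measure.pi_singleton, Measure.count_singleton,
    Finset.prod_const_one, mul_one] using
    lintegral_prod_lintegral_pow_le (fun _ : ι => (Measure.count : Measure ℤ)) hp
      (f := f) (measurable_of_countable _)

theorem sum_rpow_le_of_le_sum_line {p : ℝ} (hp : Real.HolderConjugate (Fintype.card ι) p)
    {a b : ι → ℤ} {F g : (ι → ℤ) → ℝ} (hF : ∀ x, 0 ≤ F x) (hg : ∀ x, 0 ≤ g x)
    (h : ∀ x ∈ Finset.Icc a b, ∀ j, F x ≤ ∑ z ∈ Finset.Icc (a j) (b j), g (Function.update x j z)) :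
    ∑ x ∈ Finset.Icc a b, F x ^ p ≤ (∑ x ∈ Finset.Icc a b, g x) ^ p := by
  let f : (ι → ℤ) → ℝ≥0∞ := fun x => if x ∈ Finset.Icc a b then ENNReal.ofReal (g x) else 0
  have hf_sum : ∑' x, f x = ENNReal.ofReal (∑ x ∈ Finset.Icc a b, g x) := by
    rw [ENNReal.ofReal_sum_of_nonneg fun x _ => hg x, tsum_eq_sum fun x hx => if_neg hx]
    exact Finset.sum_congr rfl fun x hx => if_pos hx
  have hline : ∀ x ∈ Finset.Icc a b, ∀ i,
      ENNReal.ofReal (F x) ≤ ∑' z, f (Function.update x i z) := by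
    intro x hx i
    refine (ENNReal.ofReal_le_ofReal (h x hx i)).trans ?_
    rw [ENNReal.ofReal_sum_of_nonneg fun z _ => hg _]
    refine le_trans (Finset.sum_le_sum fun z hz => ?_) (ENNReal.sum_le_tsum _)
    rw [← Finset.mem_coe, Finset.coe_Icc] at hx hz
    have : Function.update x i z ∈ Finset.Icc a b := by
      rwa [← Finset.mem_coe, Finset.coe_Icc, update_mem_Icc hx]
    exact (if_pos this).ge
  have hcard : 0 < (Fintype.card ι : ℝ) - 1 := sub_pos.2 hp.lt
  rw [← ENNReal.ofReal_le_ofReal_iff (Real.rpow_nonneg (Finset.sum_nonneg fun x _ => hg x) _),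
    ← ENNReal.ofReal_rpow_of_nonneg (Finset.sum_nonneg fun x _ => hg x) hp.symm.nonneg, ← hf_sum,
    ENNReal.ofReal_sum_of_nonneg fun x _ => Real.rpow_nonneg (hF x) _]
  refine le_trans ?_ (tsum_prod_tsum_update_rpow_le hp f)
  refine le_trans (Finset.sum_le_sum fun x hx => ?_) (ENNReal.sum_le_tsum _)
  calc ENNReal.ofReal (F x ^ p)
      = ∏ _i : ι, ENNReal.ofReal (F x) ^ (1 / ((Fintype.card ι : ℝ) - 1)) := by
        rw [← ENNReal.ofReal_rpow_of_nonneg (hF x) hp.symm.nonneg, Finset.prod_const,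
          Finset.card_univ, ← ENNReal.rpow_natCast, ← ENNReal.rpow_mul, hp.conjugate_eq]
        ring_nf
    _ ≤ ∏ i, (∑' z, f (Function.update x i z)) ^ (1 / ((Fintype.card ι : ℝ) - 1)) :=
        Finset.prod_le_prod' fun i _ => ENNReal.rpow_le_rpow (hline x hx i) (by positivity)

end LoomisWhitney

section FinsetSums

variable {κ τ : Type*}

theorem sum_comp_le_sum_of_injOn {T : Finset κ} {S : Finset τ} {φ : κ → τ} {F : τ → ℝ}
    (hφ : Set.InjOn φ T) (hmem : ∀ b ∈ T, φ b ∈ S) (hF : ∀ x ∈ S, 0 ≤ F x) :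
    ∑ b ∈ T, F (φ b) ≤ ∑ x ∈ S, F x := by
  classical
  rw [← Finset.sum_image hφ]
  exact Finset.sum_le_sum_of_subset_of_nonneg (Finset.image_subset_iff.2 hmem) fun x hx _ => hF x hx

theorem sum_sum_le_sum_of_fibers {G : Finset κ} {T : κ → Finset τ} {S : Finset τ} (φ : τ → κ)
    {F : τ → ℝ} (hT : ∀ r, T r ⊆ S) (hφ : ∀ r, ∀ x ∈ T r, φ x = r) (hF : ∀ x ∈ S, 0 ≤ F x) :
    ∑ r ∈ G, ∑ x ∈ T r, F x ≤ ∑ x ∈ S, F x := by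
  rw [Finset.sum_sigma']
  refine sum_comp_le_sum_of_injOn (φ := fun b : (_ : κ) × τ => b.2) ?_
    (fun b hb => hT b.1 (Finset.mem_sigma.1 hb).2) hF
  rintro ⟨r, x⟩ hx ⟨r', x'⟩ hx' rfl
  obtain rfl : r = r' :=
    (hφ r _ (Finset.mem_sigma.1 hx).2).symm.trans (hφ r' _ (Finset.mem_sigma.1 hx').2)
  rfl

end FinsetSums

section Sobolev

variable {d : ℕ}

theorem sum_bondsIn (S : Finset (LatticePt d)) (F : Bond d → ℝ) :
    ∑ b ∈ bondsIn S, F b = ∑ x ∈ S, ∑ i with Bond.upper (x, i) ∈ S, F (x, i) := by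
  simp only [bondsIn, Finset.sum_filter, Finset.sum_product]

theorem upper_prod_snd_injective : Function.Injective fun b : Bond d => (b.upper, b.2) := by
  rintro ⟨x, i⟩ ⟨y, j⟩ h
  obtain ⟨h, rfl⟩ := Prod.mk.injEq .. ▸ h
  exact Prod.ext (add_right_cancel h) rfl

theorem sum_bondsIn_lower_le (S : Finset (LatticePt d)) {F : LatticePt d → ℝ} (hF : ∀ x, 0 ≤ F x) :
    ∑ b ∈ bondsIn S, F b.lower ≤ d * ∑ x ∈ S, F x := by
  calc ∑ b ∈ bondsIn S, F b.lower ≤ ∑ b ∈ S ×ˢ (Finset.univ : Finset (Fin d)), F b.1 :=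
        Finset.sum_le_sum_of_subset_of_nonneg (Finset.filter_subset _ _) fun b _ _ => hF _
    _ = d * ∑ x ∈ S, F x := by
        simp [Finset.sum_product, Finset.mul_sum]

theorem sum_bondsIn_upper_le (S : Finset (LatticePt d)) {F : LatticePt d → ℝ} (hF : ∀ x, 0 ≤ F x) :
    ∑ b ∈ bondsIn S, F b.upper ≤ d * ∑ x ∈ S, F x := by
  calc ∑ b ∈ bondsIn S, F b.upper ≤ ∑ b ∈ S ×ˢ (Finset.univ : Finset (Fin d)), F b.1 :=
        sum_comp_le_sum_of_injOn (F := fun b : Bond d => F b.1) upper_prod_snd_injective.injOn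
          (fun b hb => Finset.mem_product.2 ⟨((mem_bondsIn S b).1 hb).2, Finset.mem_univ _⟩)
          fun b _ => hF _
    _ = d * ∑ x ∈ S, F x := by
        simp [Finset.sum_product, Finset.mul_sum]

/-- The scaled discrete `W^{1,s}` energy `∑ |∇f|^s + ∑ (f/l)^s` on the bonds and vertices of `S`.
It is used for nonnegative `f`, so there is no absolute value in the second sum. -/
noncomputable def sobEnergy (s l : ℝ) (S : Finset (LatticePt d)) (f : LatticePt d → ℝ) : ℝ :=
  ∑ b ∈ bondsIn S, |grad f b| ^ s + ∑ x ∈ S, (f x / l) ^ s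

variable {s l : ℝ} {f : LatticePt d → ℝ} {S : Finset (LatticePt d)}

theorem sum_abs_grad_rpow_nonneg : 0 ≤ ∑ b ∈ bondsIn S, |grad f b| ^ s :=
  Finset.sum_nonneg fun _ _ => by positivity

theorem sum_div_rpow_nonneg (hl : 0 ≤ l) (hf : ∀ x, 0 ≤ f x) : 0 ≤ ∑ x ∈ S, (f x / l) ^ s :=
  Finset.sum_nonneg fun x _ => Real.rpow_nonneg (div_nonneg (hf x) hl) s

theorem sobEnergy_nonneg (hl : 0 ≤ l) (hf : ∀ x, 0 ≤ f x) : 0 ≤ sobEnergy s l S f :=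
  add_nonneg sum_abs_grad_rpow_nonneg (sum_div_rpow_nonneg hl hf)

theorem sum_div_rpow_le_sobEnergy : ∑ x ∈ S, (f x / l) ^ s ≤ sobEnergy s l S f :=
  le_add_of_nonneg_left sum_abs_grad_rpow_nonneg

theorem sum_abs_grad_rpow_le_sobEnergy (hl : 0 ≤ l) (hf : ∀ x, 0 ≤ f x) :
    ∑ b ∈ bondsIn S, |grad f b| ^ s ≤ sobEnergy s l S f :=
  le_add_of_nonneg_right (sum_div_rpow_nonneg hl hf)

section Power

variable {t r γ θ : ℝ}

theorem sum_abs_grad_rpow_of_rpow_le (hl : 0 ≤ l) (hs : 0 ≤ s) (hγ : 1 ≤ γ) (hθ : 0 ≤ θ)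
    (hθ1 : θ ≤ 1) (hr : s * (γ - 1) = r * (1 - θ)) (ht : s = t * θ) (hf : ∀ x, 0 ≤ f x) :
    ∑ b ∈ bondsIn S, |grad (fun x => f x ^ γ) b| ^ s ≤
      γ ^ s * (2 * d + 1) * (∑ x ∈ S, f x ^ r) ^ (1 - θ) * sobEnergy t l S f ^ θ := by
  have hθ' : 0 ≤ 1 - θ := sub_nonneg.2 hθ1
  have hfr : ∀ x, 0 ≤ f x ^ r := fun x => Real.rpow_nonneg (hf x) r
  have hZ : 0 ≤ ∑ x ∈ S, f x ^ r := Finset.sum_nonneg fun x _ => hfr x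
  have hendpoints : ∑ b ∈ bondsIn S, (f b.upper ^ r + f b.lower ^ r) ≤
      (2 * d + 1) * ∑ x ∈ S, f x ^ r := by
    rw [Finset.sum_add_distrib]
    linarith [sum_bondsIn_upper_le S hfr, sum_bondsIn_lower_le S hfr]
  calc ∑ b ∈ bondsIn S, |grad (fun x => f x ^ γ) b| ^ s
      ≤ ∑ b ∈ bondsIn S, γ ^ s *
          ((f b.upper ^ r + f b.lower ^ r) ^ (1 - θ) * (|grad f b| ^ t) ^ θ) :=
        Finset.sum_le_sum fun b _ =>
          abs_rpow_sub_rpow_rpow_le (hf b.upper) (hf b.lower) hs hγ hθ1 hr ht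
    _ ≤ γ ^ s * ((∑ b ∈ bondsIn S, (f b.upper ^ r + f b.lower ^ r)) ^ (1 - θ) *
          (∑ b ∈ bondsIn S, |grad f b| ^ t) ^ θ) := by
        rw [← Finset.mul_sum]
        gcongr
        exact sum_rpow_mul_rpow_le _ (fun b _ => add_nonneg (hfr _) (hfr _))
          (fun b _ => by positivity) hθ' hθ (by ring)
    _ ≤ γ ^ s * (((2 * d + 1) * ∑ x ∈ S, f x ^ r) ^ (1 - θ) * sobEnergy t l S f ^ θ) := by
        have hsum : 0 ≤ ∑ b ∈ bondsIn S, (f b.upper ^ r + f b.lower ^ r) :=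
          Finset.sum_nonneg fun b _ => add_nonneg (hfr _) (hfr _)
        have hgrad := sum_abs_grad_rpow_le_sobEnergy (s := t) (S := S) hl hf
        have : 0 ≤ ∑ b ∈ bondsIn S, |grad f b| ^ t := sum_abs_grad_rpow_nonneg
        gcongr
    _ ≤ γ ^ s * ((2 * d + 1) * (∑ x ∈ S, f x ^ r) ^ (1 - θ) * sobEnergy t l S f ^ θ) := by
        have hd : (1 : ℝ) ≤ 2 * d + 1 := by norm_cast; omega
        have : (2 * d + 1 : ℝ) ^ (1 - θ) ≤ 2 * d + 1 :=
          Real.rpow_le_self_of_one_le hd (by linarith)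
        have := sobEnergy_nonneg (s := t) (S := S) hl hf
        rw [Real.mul_rpow (by positivity) hZ]
        gcongr
    _ = _ := by ring

theorem sum_rpow_div_rpow_le (hl : 0 < l) (hγ : 1 ≤ γ) (hθ : 0 ≤ θ) (hθ1 : θ ≤ 1)
    (hr : s * (γ - 1) = r * (1 - θ)) (ht : s = t * θ) (hf : ∀ x, 0 ≤ f x) :
    ∑ x ∈ S, (f x ^ γ / l) ^ s ≤ (∑ x ∈ S, f x ^ r) ^ (1 - θ) * sobEnergy t l S f ^ θ := by
  have hfr : ∀ x, 0 ≤ f x ^ r := fun x => Real.rpow_nonneg (hf x) r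
  have hfl : ∀ x, 0 ≤ f x / l := fun x => div_nonneg (hf x) hl.le
  have hsplit : ∀ x, (f x ^ γ / l) ^ s = (f x ^ r) ^ (1 - θ) * ((f x / l) ^ t) ^ θ := by
    intro x
    have hγx : f x ^ γ = f x ^ (γ - 1) * f x := by
      rw [← Real.rpow_add_one' (hf x) (by linarith), sub_add_cancel]
    rw [← Real.rpow_mul (hf x), ← Real.rpow_mul (hfl x), ← hr, ← ht, mul_comm s,
      Real.rpow_mul (hf x), ← Real.mul_rpow (Real.rpow_nonneg (hf x) _) (hfl x), hγx, mul_div_assoc]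
  calc ∑ x ∈ S, (f x ^ γ / l) ^ s
      ≤ (∑ x ∈ S, f x ^ r) ^ (1 - θ) * (∑ x ∈ S, (f x / l) ^ t) ^ θ := by
        simp only [hsplit]
        exact sum_rpow_mul_rpow_le S (fun x _ => hfr x) (fun x _ => Real.rpow_nonneg (hfl x) t)
          (sub_nonneg.2 hθ1) hθ (by ring)
    _ ≤ _ := by
        have := Finset.sum_nonneg fun x (_ : x ∈ S) => hfr x
        have := sum_div_rpow_nonneg (s := t) (S := S) hl.le hf
        have := sum_div_rpow_le_sobEnergy (s := t) (l := l) (f := f) (S := S)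
        gcongr

theorem sobEnergy_rpow_le (hl : 0 < l) (hs : 0 ≤ s) (hγ : 1 ≤ γ) (hθ : 0 ≤ θ) (hθ1 : θ ≤ 1)
    (hr : s * (γ - 1) = r * (1 - θ)) (ht : s = t * θ) (hf : ∀ x, 0 ≤ f x) :
    sobEnergy s l S (fun x => f x ^ γ) ≤
      (γ ^ s * (2 * d + 1) + 1) * (∑ x ∈ S, f x ^ r) ^ (1 - θ) * sobEnergy t l S f ^ θ := by
  rw [sobEnergy, add_mul, add_mul, one_mul]
  exact add_le_add (sum_abs_grad_rpow_of_rpow_le hl.le hs hγ hθ hθ1 hr ht hf)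
    (sum_rpow_div_rpow_le hl hγ hθ hθ1 hr ht hf)

end Power

variable {a b : LatticePt d}

theorem le_sum_line_of_nonneg (hl : 0 < l) (hab : ∀ j, l ≤ b j - a j + 1) (hf : ∀ x, 0 ≤ f x)
    {x : LatticePt d} (hx : x ∈ Finset.Icc a b) (j : Fin d) :
    f x ≤ ∑ z ∈ Finset.Icc (a j) (b j),
      (∑ i with Bond.upper (Function.update x j z, i) ∈ Finset.Icc a b,
        |grad f (Function.update x j z, i)| + f (Function.update x j z) / l) := by
  rw [← Finset.mem_coe, Finset.coe_Icc] at hx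
  have hxj : x j ∈ Finset.Icc (a j) (b j) := Finset.mem_Icc.2 ⟨hx.1 j, hx.2 j⟩
  have hline := le_variation_add_average (φ := fun z => f (Function.update x j z))
    (fun z => hf _) hxj hl (hab j)
  rw [Function.update_eq_self] at hline
  rw [Finset.sum_add_distrib]
  refine hline.trans (add_le_add_left ?_ _)
  have hupper : ∀ z, Bond.upper (Function.update x j z, j) = Function.update x j (z + 1) := by
    intro z
    ext i
    rcases eq_or_ne i j with rfl | hi <;> simp [Bond.upper, *]
  refine (Finset.sum_le_sum (g := fun z =>
    ∑ i with Bond.upper (Function.update x j z, i) ∈ Finset.Icc a b,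
      |grad f (Function.update x j z, i)|) fun z hz => ?_).trans <|
    Finset.sum_le_sum_of_subset_of_nonneg Finset.Ico_subset_Icc_self fun _ _ _ =>
      Finset.sum_nonneg fun _ _ => abs_nonneg _
  have hj : j ∈ Finset.univ.filter
      fun i => Bond.upper (Function.update x j z, i) ∈ Finset.Icc a b := by
    rw [Finset.mem_filter_univ, hupper, ← Finset.mem_coe, Finset.coe_Icc, update_mem_Icc hx]
    rw [Finset.mem_Ico] at hz
    exact ⟨by omega, by omega⟩
  refine le_trans (le_of_eq ?_) (Finset.single_le_sum (fun i _ => abs_nonneg _) hj)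
  rw [grad, hupper, Bond.lower]

theorem sum_rpow_le_sobEnergy_one_rpow {p : ℝ} (hp : Real.HolderConjugate d p) (hl : 0 < l)
    (hab : ∀ j, l ≤ b j - a j + 1) (hf : ∀ x, 0 ≤ f x) :
    ∑ x ∈ Finset.Icc a b, f x ^ p ≤ sobEnergy 1 l (Finset.Icc a b) f ^ p := by
  have hg : ∀ x, 0 ≤
      ∑ i with Bond.upper (x, i) ∈ Finset.Icc a b, |grad f (x, i)| + f x / l := fun x =>
    add_nonneg (Finset.sum_nonneg fun _ _ => abs_nonneg _) (div_nonneg (hf x) hl.le)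
  refine (sum_rpow_le_of_le_sum_line (by rwa [Fintype.card_fin]) hf hg
    fun x hx j => le_sum_line_of_nonneg hl hab hf hx j).trans_eq ?_
  simp only [sobEnergy, Real.rpow_one, sum_bondsIn, Finset.sum_add_distrib]

theorem exists_sum_rpow_le_sobEnergy (hd : 2 ≤ d) {r : ℝ} (hs : 1 ≤ s) (hsd : s < d)
    (hr : r = s * d / (d - s)) :
    ∃ C : ℝ, 0 < C ∧ ∀ (a b : LatticePt d) (l : ℝ), 0 < l → (∀ j, l ≤ b j - a j + 1) →
      ∀ f : LatticePt d → ℝ, (∀ x, 0 ≤ f x) →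
      ∑ x ∈ Finset.Icc a b, f x ^ r ≤ C * sobEnergy s l (Finset.Icc a b) f ^ (r / s) := by
  have : (2 : ℝ) ≤ d := by exact_mod_cast hd
  have hds : (d : ℝ) - s ≠ 0 := by linarith
  have hd1 : (d : ℝ) - 1 ≠ 0 := by linarith
  have hd0 : (d : ℝ) ≠ 0 := by linarith
  have hs0 : s ≠ 0 := by linarith
  set γ : ℝ := s * (d - 1) / (d - s) with hγ
  have hγ1 : 1 ≤ γ := by rw [hγ, le_div_iff₀ (by linarith)]; nlinarith
  have hr0 : 0 < r := by rw [hr]; exact div_pos (by nlinarith) (by linarith)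
  have hconj : Real.HolderConjugate d (d / (d - 1)) := .conjExponent (by linarith)
  have hp0 := hconj.symm.pos
  refine ⟨(γ ^ (1 : ℝ) * (2 * d + 1) + 1) ^ r, by positivity, fun a b l hl hab f hf => ?_⟩
  have hfγ : ∀ x, 0 ≤ f x ^ γ := fun x => Real.rpow_nonneg (hf x) γ
  refine le_rpow_mul_rpow_of_le_mul_rpow (Finset.sum_nonneg fun x _ => Real.rpow_nonneg (hf x) r)
    (by positivity) (sobEnergy_nonneg hl.le hf) hp0 hr0 (by rw [hr]; field_simp; ring) ?_
  calc ∑ x ∈ Finset.Icc a b, f x ^ r = ∑ x ∈ Finset.Icc a b, (f x ^ γ) ^ ((d : ℝ) / (d - 1)) := by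
        refine Finset.sum_congr rfl fun x _ => ?_
        rw [← Real.rpow_mul (hf x), hγ, hr]
        field_simp
    _ ≤ sobEnergy 1 l (Finset.Icc a b) (fun x => f x ^ γ) ^ ((d : ℝ) / (d - 1)) :=
        sum_rpow_le_sobEnergy_one_rpow hconj hl hab hfγ
    _ ≤ _ := by
        refine Real.rpow_le_rpow (sobEnergy_nonneg hl.le hfγ) ?_ hp0.le
        refine sobEnergy_rpow_le hl zero_le_one hγ1 (by positivity) ?_ ?_ (by field_simp) hf
        · rwa [div_le_one (by linarith)]
        · rw [hγ, hr]; field_simp; ring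

end Sobolev

section Caccioppoli

theorem rpow_two_mul_sub_one {c α : ℝ} (hc : 0 ≤ c) (hα : 1 ≤ α) :
    c ^ (2 * α - 1) = c ^ (α - 1) * c ^ α := by
  rcases hα.eq_or_lt with rfl | hα
  · norm_num
  · rw [← Real.rpow_add' hc (by linarith)]
    ring_nf

theorem sq_rpow_sub_rpow_le {a b α : ℝ} (hb : 0 ≤ b) (hab : b ≤ a) (hα : 1 ≤ α) :
    (a ^ α - b ^ α) ^ 2 ≤ α * ((a - b) * (a ^ (2 * α - 1) - b ^ (2 * α - 1))) := by
  have ha := hb.trans hab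
  rw [rpow_two_mul_sub_one ha hα, rpow_two_mul_sub_one hb hα]
  have htangent := mul_rpow_sub_one_mul_sub_le hb ha hα
  have hpow : b ^ α ≤ a ^ α := Real.rpow_le_rpow hb hab (by linarith)
  have hpow' : b ^ (α - 1) ≤ a ^ (α - 1) := Real.rpow_le_rpow hb hab (by linarith)
  have h1 : (a ^ α - b ^ α) * (a ^ α - b ^ α) ≤ α * a ^ (α - 1) * (a - b) * (a ^ α - b ^ α) :=
    mul_le_mul_of_nonneg_right (by linarith) (sub_nonneg.2 hpow)
  have h2 : 0 ≤ α * (a - b) * ((a ^ (α - 1) - b ^ (α - 1)) * b ^ α) :=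
    mul_nonneg (mul_nonneg (by linarith) (sub_nonneg.2 hab))
      (mul_nonneg (sub_nonneg.2 hpow') (Real.rpow_nonneg hb _))
  linarith

theorem mul_sub_mul_rpow_le {a b α : ℝ} (ha : 0 ≤ a) (hb : 0 ≤ b) (hα : 1 ≤ α) :
    α * ((a - b) * b ^ (2 * α - 1)) ≤ (a ^ α - b ^ α) * b ^ α := by
  rw [rpow_two_mul_sub_one hb hα]
  have := mul_le_mul_of_nonneg_right (mul_rpow_sub_one_mul_sub_le ha hb hα)
    (Real.rpow_nonneg hb α)
  linarith

theorem cutoff_error_absorbed {ξ ζ D q X : ℝ} (hξ : 0 ≤ ξ) (hζ : 0 ≤ ζ) (hD : 0 ≤ D) (hq : 0 ≤ q)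
    (hX : 0 ≤ X) (hXD : X ≤ D * q) :
    ξ ^ 2 * D ^ 2 / 2 - 3 * ((ξ - ζ) ^ 2 * ((q + D) * q)) ≤
      ξ ^ 2 * D ^ 2 + (ξ ^ 2 - ζ ^ 2) * X := by
  obtain ⟨e, he, he0⟩ : ∃ e, |ξ - ζ| = e ∧ 0 ≤ e := ⟨_, rfl, abs_nonneg _⟩
  rw [← sq_abs (ξ - ζ), he]
  have hsq : |ξ ^ 2 - ζ ^ 2| ≤ e * (2 * ξ + e) := by
    rw [sq_sub_sq, mul_comm, abs_mul, he, abs_of_nonneg (add_nonneg hξ hζ)]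
    refine mul_le_mul_of_nonneg_left ?_ he0
    have := neg_abs_le (ξ - ζ)
    linarith
  have herror : |(ξ ^ 2 - ζ ^ 2) * X| ≤ e * (2 * ξ + e) * (D * q) := by
    rw [abs_mul, abs_of_nonneg hX]
    exact mul_le_mul hsq hXD hX (by positivity)
  have := neg_abs_le ((ξ ^ 2 - ζ ^ 2) * X)
  have : 0 ≤ (ξ * D - 2 * (e * q)) ^ 2 := sq_nonneg _
  have : 0 ≤ e ^ 2 * (q * (q + 2 * D)) := by positivity
  linarith

theorem caccioppoli_pointwise {a b ξ ζ α : ℝ} (ha : 0 ≤ a) (hb : 0 ≤ b) (hξ : 0 ≤ ξ) (hζ : 0 ≤ ζ)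
    (hα : 1 ≤ α) :
    min ξ ζ ^ 2 * (a ^ α - b ^ α) ^ 2 / 2 - 3 * ((ξ - ζ) ^ 2 * (a ^ α * b ^ α)) ≤
      α * ((a - b) * (ξ ^ 2 * a ^ (2 * α - 1) - ζ ^ 2 * b ^ (2 * α - 1))) := by
  wlog hab : b ≤ a generalizing a b ξ ζ
  · have := this hb ha hζ hξ (le_of_not_ge hab)
    rw [min_comm] at this
    linarith
  have hmin : min ξ ζ ^ 2 * (a ^ α - b ^ α) ^ 2 ≤ ξ ^ 2 * (a ^ α - b ^ α) ^ 2 :=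
    mul_le_mul_of_nonneg_right (pow_le_pow_left₀ (le_min hξ hζ) (min_le_left _ _) 2) (sq_nonneg _)
  have hgood := mul_le_mul_of_nonneg_left (sq_rpow_sub_rpow_le hb hab hα) (sq_nonneg ξ)
  have hX : 0 ≤ α * ((a - b) * b ^ (2 * α - 1)) :=
    mul_nonneg (by linarith) (mul_nonneg (sub_nonneg.2 hab) (Real.rpow_nonneg hb _))
  have hcutoff := cutoff_error_absorbed hξ hζ
    (sub_nonneg.2 (Real.rpow_le_rpow hb hab (by linarith))) (Real.rpow_nonneg hb α) hX
    (mul_sub_mul_rpow_le ha hb hα)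
  rw [add_sub_cancel] at hcutoff
  linarith

variable {d : ℕ}

theorem sum_bondsIn_mul_grad {F : Bond d → ℝ} {ψ : LatticePt d → ℝ} {S : Finset (LatticePt d)}
    (hψ : ∀ x, ψ x ≠ 0 → x ∈ S ∧ ∀ j, x - Pi.single j 1 ∈ S ∧ x + Pi.single j 1 ∈ S) :
    ∑ b ∈ bondsIn S, F b * grad ψ b = ∑ x ∈ S, divStar F x * ψ x := by
  have hextend : ∑ b ∈ bondsIn S, F b * grad ψ b =
      ∑ b ∈ S ×ˢ (Finset.univ : Finset (Fin d)), F b * grad ψ b := by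
    refine Finset.sum_subset (Finset.filter_subset _ _) fun b hb hbS => ?_
    have hupper : b.upper ∉ S := fun h => hbS (Finset.mem_filter.2 ⟨hb, h⟩)
    have h1 : ψ b.upper = 0 := by_contra fun h => hupper (hψ _ h).1
    have h2 : ψ b.lower = 0 := by_contra fun h => hupper ((hψ _ h).2 b.2).2
    rw [grad, h1, h2, sub_zero, mul_zero]
  have hshift : ∀ j, ∑ x ∈ S, F (x, j) * ψ (x + Pi.single j 1) =
      ∑ x ∈ S, F (x - Pi.single j 1, j) * ψ x := by
    intro j
    rw [← finsum_eq_sum_of_support_subset, ← finsum_eq_sum_of_support_subset]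
    · refine Eq.trans (finsum_congr fun x => ?_)
        (finsum_comp_equiv (Equiv.addRight (Pi.single j 1 : LatticePt d))
          (f := fun x => F (x - Pi.single j 1, j) * ψ x))
      simp only [Equiv.coe_addRight, add_sub_cancel_right]
    · exact fun x hx => (hψ x (right_ne_zero_of_mul hx)).1
    · exact fun x hx => by simpa using ((hψ _ (right_ne_zero_of_mul hx)).2 j).1
  rw [hextend, Finset.sum_product_right]
  simp only [divStar, Finset.sum_mul, grad, Bond.upper, Bond.lower, mul_sub, sub_mul,
    Finset.sum_sub_distrib, hshift]
  congr 1 <;> exact Finset.sum_comm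

/-- Nonnegative solutions of `∇*(ω∇w) ≤ 0` on the whole lattice. -/
structure IsNonnegSubsolution (ω : Bond d → ℝ) (w : LatticePt d → ℝ) : Prop where
  nonneg : ∀ x, 0 ≤ w x
  divStar_nonpos : ∀ x, divStar (fun b => ω b * grad w b) x ≤ 0

variable {ω : Bond d → ℝ}

theorem IsNonnegSubsolution.abs_of_harmonic (hω : ∀ b, 0 ≤ ω b) {u : LatticePt d → ℝ}
    (hu : ∀ x, divStar (fun b => ω b * grad u b) x = 0) :
    IsNonnegSubsolution ω fun x => |u x| := by
  refine ⟨fun x => abs_nonneg _, fun x => ?_⟩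
  obtain ⟨s, hs, hsx⟩ : ∃ s : ℝ, |s| ≤ 1 ∧ |u x| = s * u x := by
    rcases le_total 0 (u x) with h | h
    · exact ⟨1, by simp, by simp [abs_of_nonneg h]⟩
    · exact ⟨-1, by simp, by simp [abs_of_nonpos h]⟩
  have hle : ∀ z, s * u z ≤ |u z| := fun z => by
    refine (le_abs_self _).trans ?_
    rw [abs_mul]
    exact mul_le_of_le_one_left (abs_nonneg _) hs
  calc divStar (fun b => ω b * grad (fun z => |u z|) b) x
      ≤ s * divStar (fun b => ω b * grad u b) x := by
        simp only [divStar, Finset.mul_sum]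
        refine Finset.sum_le_sum fun j _ => ?_
        simp only [grad, Bond.upper, Bond.lower, sub_add_cancel, hsx]
        have h1 := mul_le_mul_of_nonneg_left (hle (x - Pi.single j 1)) (hω (x - Pi.single j 1, j))
        have h2 := mul_le_mul_of_nonneg_left (hle (x + Pi.single j 1)) (hω (x, j))
        linarith
    _ = 0 := by rw [hu, mul_zero]

theorem caccioppoli {w : LatticePt d → ℝ} (hω : ∀ b, 0 ≤ ω b) (hw : IsNonnegSubsolution ω w)
    {α : ℝ} (hα : 1 ≤ α) {η : LatticePt d → ℝ} (hη : ∀ x, 0 ≤ η x) {S : Finset (LatticePt d)}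
    (hηS : ∀ x, η x ≠ 0 → x ∈ S ∧ ∀ j, x - Pi.single j 1 ∈ S ∧ x + Pi.single j 1 ∈ S) :
    ∑ b ∈ bondsIn S, ω b * (min (η b.upper) (η b.lower) ^ 2 * grad (fun x => w x ^ α) b ^ 2) ≤
      6 * ∑ b ∈ bondsIn S, ω b * (grad η b ^ 2 * (w b.upper ^ α * w b.lower ^ α)) := by
  have htested : ∑ b ∈ bondsIn S,
      ω b * grad w b * grad (fun x => η x ^ 2 * w x ^ (2 * α - 1)) b ≤ 0 := by
    rw [sum_bondsIn_mul_grad (F := fun b => ω b * grad w b)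
      fun x hx => hηS x fun h0 => hx (by simp [h0])]
    exact Finset.sum_nonpos fun x _ => mul_nonpos_of_nonpos_of_nonneg (hw.divStar_nonpos x)
      (mul_nonneg (sq_nonneg _) (Real.rpow_nonneg (hw.nonneg x) _))
  have hpointwise : ∀ b, ω b * (min (η b.upper) (η b.lower) ^ 2 * grad (fun x => w x ^ α) b ^ 2) ≤
      6 * (ω b * (grad η b ^ 2 * (w b.upper ^ α * w b.lower ^ α))) +
        2 * α * (ω b * grad w b * grad (fun x => η x ^ 2 * w x ^ (2 * α - 1)) b) := by
    intro b
    have := mul_le_mul_of_nonneg_left (caccioppoli_pointwise (hw.nonneg b.upper)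
      (hw.nonneg b.lower) (hη b.upper) (hη b.lower) hα) (hω b)
    simp only [grad]
    linarith
  calc _ ≤ _ := Finset.sum_le_sum fun b _ => hpointwise b
    _ ≤ _ := by
      rw [Finset.sum_add_distrib, ← Finset.mul_sum, ← Finset.mul_sum]
      have := mul_nonpos_of_nonneg_of_nonpos (by linarith : 0 ≤ 2 * α) htested
      linarith

end Caccioppoli

section Cutoff

/-- The fraction of points of `G` lying strictly below `z`; it is `0` if `G` is empty. -/
noncomputable def cutRatio (G : Finset ℤ) (z : ℤ) : ℝ :=
  ((G.filter (· < z)).card : ℝ) / G.card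

theorem cutRatio_nonneg (G : Finset ℤ) (z : ℤ) : 0 ≤ cutRatio G z := by
  unfold cutRatio; positivity

theorem cutRatio_le_one (G : Finset ℤ) (z : ℤ) : cutRatio G z ≤ 1 :=
  div_le_one_of_le₀ (by exact_mod_cast Finset.card_filter_le _ _) (by positivity)

theorem cutRatio_eq_one {G : Finset ℤ} (hG : G.Nonempty) {z : ℤ} (h : ∀ g ∈ G, g < z) :
    cutRatio G z = 1 := by
  rw [cutRatio, Finset.filter_true_of_mem h, div_self]
  exact_mod_cast hG.card_pos.ne'

theorem cutRatio_eq_zero {G : Finset ℤ} {z : ℤ} (h : ∀ g ∈ G, z ≤ g) : cutRatio G z = 0 := by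
  rw [cutRatio, Finset.filter_false_of_mem fun g hg => not_lt.2 (h g hg)]
  simp

theorem cutRatio_add_one_sub (G : Finset ℤ) (z : ℤ) :
    cutRatio G (z + 1) - cutRatio G z = if z ∈ G then (G.card : ℝ)⁻¹ else 0 := by
  have h : G.filter (· < z + 1) = G.filter (· < z) ∪ G.filter (· = z) := by
    ext g; simp only [Finset.mem_filter, Finset.mem_union, Int.lt_add_one_iff, le_iff_lt_or_eq]
    tauto
  rw [cutRatio, cutRatio, h, Finset.card_union_of_disjoint, Finset.filter_eq']
  · split_ifs <;> simp [add_div]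
  · exact Finset.disjoint_filter.2 fun g _ h1 h2 => h1.ne h2

/-- `Gm` and `Gp` are sets of positions in `[-σ, -ρ)` and in `[ρ, σ)`, at which a cutoff function
equal to `1` on `[-ρ, ρ]` and supported in `(-σ, σ)` increases and decreases, respectively. -/
structure IsJumpPair (ρ σ : ℕ) (Gm Gp : Finset ℤ) : Prop where
  neg_nonempty : Gm.Nonempty
  pos_nonempty : Gp.Nonempty
  neg_subset : Gm ⊆ Finset.Ico (-(σ : ℤ)) (-ρ)
  pos_subset : Gp ⊆ Finset.Ico (ρ : ℤ) σ

/-- The one-dimensional cutoff function that increases in equal steps at the points of `Gm` and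
decreases in equal steps at those of `Gp`. -/
noncomputable def cutProfile (Gm Gp : Finset ℤ) (z : ℤ) : ℝ := cutRatio Gm z - cutRatio Gp z

section Profile

variable {Gm Gp : Finset ℤ} {ρ σ : ℕ} {z : ℤ}

theorem IsJumpPair.neg_bounds (h : IsJumpPair ρ σ Gm Gp) {g : ℤ} (hg : g ∈ Gm) :
    -(σ : ℤ) ≤ g ∧ g < -ρ :=
  Finset.mem_Ico.1 (h.neg_subset hg)

theorem IsJumpPair.pos_bounds (h : IsJumpPair ρ σ Gm Gp) {g : ℤ} (hg : g ∈ Gp) :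
    (ρ : ℤ) ≤ g ∧ g < σ :=
  Finset.mem_Ico.1 (h.pos_subset hg)

theorem IsJumpPair.cutProfile_eq_one (h : IsJumpPair ρ σ Gm Gp) (hz : |z| ≤ ρ) :
    cutProfile Gm Gp z = 1 := by
  rw [abs_le] at hz
  rw [cutProfile, cutRatio_eq_one h.neg_nonempty, cutRatio_eq_zero, sub_zero]
  · intro g hg
    linarith [(h.pos_bounds hg).1]
  · intro g hg
    linarith [(h.neg_bounds hg).2]

theorem IsJumpPair.cutProfile_eq_zero (h : IsJumpPair ρ σ Gm Gp) (hz : (σ : ℤ) ≤ |z|) :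
    cutProfile Gm Gp z = 0 := by
  rw [cutProfile]
  rcases le_abs.1 hz with hz | hz
  · rw [cutRatio_eq_one h.neg_nonempty, cutRatio_eq_one h.pos_nonempty, sub_self]
    · intro g hg
      linarith [(h.pos_bounds hg).2]
    · intro g hg
      have := (h.neg_bounds hg).2
      omega
  · rw [cutRatio_eq_zero, cutRatio_eq_zero, sub_self]
    · intro g hg
      have := (h.pos_bounds hg).1
      omega
    · intro g hg
      linarith [(h.neg_bounds hg).1]

theorem cutProfile_le_one : cutProfile Gm Gp z ≤ 1 := by
  have := cutRatio_le_one Gm z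
  have := cutRatio_nonneg Gp z
  rw [cutProfile]
  linarith

theorem IsJumpPair.cutProfile_nonneg (h : IsJumpPair ρ σ Gm Gp) : 0 ≤ cutProfile Gm Gp z := by
  rw [cutProfile, sub_nonneg]
  rcases le_total z ρ with hz | hz
  · rw [cutRatio_eq_zero (G := Gp) fun g hg => hz.trans (h.pos_bounds hg).1]
    exact cutRatio_nonneg Gm z
  · rw [cutRatio_eq_one h.neg_nonempty]
    · exact cutRatio_le_one Gp z
    · intro g hg
      have := (h.neg_bounds hg).2
      omega

theorem sq_cutProfile_add_one_sub_le :
    (cutProfile Gm Gp (z + 1) - cutProfile Gm Gp z) ^ 2 ≤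
      2 * ((if z ∈ Gm then (Gm.card : ℝ)⁻¹ ^ 2 else 0) +
        (if z ∈ Gp then (Gp.card : ℝ)⁻¹ ^ 2 else 0)) := by
  have hjump : cutProfile Gm Gp (z + 1) - cutProfile Gm Gp z =
      (if z ∈ Gm then (Gm.card : ℝ)⁻¹ else 0) - (if z ∈ Gp then (Gp.card : ℝ)⁻¹ else 0) := by
    rw [← cutRatio_add_one_sub, ← cutRatio_add_one_sub, cutProfile, cutProfile]; ring
  have hsq : ∀ G : Finset ℤ, (if z ∈ G then (G.card : ℝ)⁻¹ ^ 2 else 0) =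
      (if z ∈ G then (G.card : ℝ)⁻¹ else 0) ^ 2 := by
    intro G; split_ifs <;> simp
  rw [hjump, hsq, hsq, sub_eq_add_neg, ← neg_sq (ite (z ∈ Gp) _ _)]
  exact add_sq_le

end Profile

variable {d : ℕ}

/-- The product cutoff on the box around `y` with the profile `cutProfile (Gm j) (Gp j)` in the
direction `j`. -/
noncomputable def boxCutoff (y : LatticePt d) (Gm Gp : Fin d → Finset ℤ) (x : LatticePt d) : ℝ :=
  ∏ j, cutProfile (Gm j) (Gp j) (x j - y j)

variable {y x : LatticePt d} {Gm Gp : Fin d → Finset ℤ} {ρ σ : ℕ}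

theorem boxCutoff_nonneg (h : ∀ j, IsJumpPair ρ σ (Gm j) (Gp j)) : 0 ≤ boxCutoff y Gm Gp x :=
  Finset.prod_nonneg fun j _ => (h j).cutProfile_nonneg

theorem boxCutoff_eq_one (h : ∀ j, IsJumpPair ρ σ (Gm j) (Gp j)) (hx : x ∈ box y ρ) :
    boxCutoff y Gm Gp x = 1 :=
  Finset.prod_eq_one fun j _ => (h j).cutProfile_eq_one ((mem_box y x ρ).1 hx j)

theorem abs_sub_lt_of_boxCutoff_ne_zero (h : ∀ j, IsJumpPair ρ σ (Gm j) (Gp j))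
    (hx : boxCutoff y Gm Gp x ≠ 0) (j : Fin d) : |x j - y j| < σ := by
  by_contra! hcon
  exact hx (Finset.prod_eq_zero (Finset.mem_univ j) ((h j).cutProfile_eq_zero hcon))

theorem mem_box_neighbors (h : ∀ i, |x i - y i| < σ) :
    x ∈ box y σ ∧ ∀ j, x - Pi.single j 1 ∈ box y σ ∧ x + Pi.single j 1 ∈ box y σ := by
  simp only [mem_box]
  refine ⟨fun i => (h i).le, fun j => ⟨fun i => ?_, fun i => ?_⟩⟩ <;>
  · have := abs_lt.1 (h i)
    rw [abs_le]
    rcases eq_or_ne i j with rfl | hi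
    · simp only [Pi.sub_apply, Pi.add_apply, Pi.single_eq_same]; omega
    · simp only [Pi.sub_apply, Pi.add_apply, Pi.single_eq_of_ne hi]; omega

theorem sq_grad_boxCutoff_le (h : ∀ j, IsJumpPair ρ σ (Gm j) (Gp j)) (b : Bond d) :
    grad (boxCutoff y Gm Gp) b ^ 2 ≤
      (cutProfile (Gm b.2) (Gp b.2) (b.lower b.2 - y b.2 + 1) -
        cutProfile (Gm b.2) (Gp b.2) (b.lower b.2 - y b.2)) ^ 2 := by
  have hfactor : ∀ x : LatticePt d, boxCutoff y Gm Gp x =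
      cutProfile (Gm b.2) (Gp b.2) (x b.2 - y b.2) *
        ∏ i ∈ Finset.univ.erase b.2, cutProfile (Gm i) (Gp i) (x i - y i) := fun x =>
    (Finset.mul_prod_erase _ _ (Finset.mem_univ b.2)).symm
  have hupper : b.upper b.2 - y b.2 = b.lower b.2 - y b.2 + 1 := by
    simp only [Bond.upper, Bond.lower, Pi.add_apply, Pi.single_eq_same]; ring
  have hother : ∏ i ∈ Finset.univ.erase b.2, cutProfile (Gm i) (Gp i) (b.upper i - y i) =
      ∏ i ∈ Finset.univ.erase b.2, cutProfile (Gm i) (Gp i) (b.lower i - y i) :=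
    Finset.prod_congr rfl fun i hi => by
      simp [Bond.upper, Bond.lower, Finset.ne_of_mem_erase hi]
  rw [grad, hfactor b.upper, hfactor b.lower, hother, hupper, ← sub_mul, mul_pow]
  refine mul_le_of_le_one_right (sq_nonneg _) (pow_le_one₀ ?_ ?_)
  · exact Finset.prod_nonneg fun i _ => (h i).cutProfile_nonneg
  · exact Finset.prod_le_one (fun i _ => (h i).cutProfile_nonneg) fun i _ => cutProfile_le_one

end Cutoff

section Slices

variable {d : ℕ}

theorem bondsIn_mono {S S' : Finset (LatticePt d)} (h : S ⊆ S') : bondsIn S ⊆ bondsIn S' := by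
  intro b hb
  rw [mem_bondsIn] at hb ⊢
  exact ⟨h hb.1, h hb.2⟩

theorem box_mono {ρ σ : ℕ} (h : ρ ≤ σ) (y : LatticePt d) : box y ρ ⊆ box y σ := by
  intro x hx
  rw [mem_box] at hx ⊢
  exact fun i => (hx i).trans (by exact_mod_cast h)

/-- The part of `S` in the hyperplane `x j = k`. -/
def slice (S : Finset (LatticePt d)) (j : Fin d) (k : ℤ) : Finset (LatticePt d) :=
  S.filter fun x => x j = k

/-- The bonds of `S` that join the hyperplanes `x j = k` and `x j = k + 1`. -/
def crossBonds (S : Finset (LatticePt d)) (j : Fin d) (k : ℤ) : Finset (Bond d) :=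
  (bondsIn S).filter fun b => b.2 = j ∧ b.lower j = k

/-- The interaction `∑ ω v(x) v(x + e_j)` over the bonds of `S` that join the hyperplanes `x j = k`
and `x j = k + 1`. -/
noncomputable def crossSum (ω : Bond d → ℝ) (v : LatticePt d → ℝ) (S : Finset (LatticePt d))
    (j : Fin d) (k : ℤ) : ℝ :=
  ∑ b ∈ crossBonds S j k, ω b * (v b.lower * v b.upper)

variable {S : Finset (LatticePt d)} {j : Fin d} {k : ℤ} {b : Bond d}

theorem lower_mem_slice (hb : b ∈ crossBonds S j k) : b.lower ∈ slice S j k := by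
  obtain ⟨hbS, -, hbk⟩ := Finset.mem_filter.1 hb
  exact Finset.mem_filter.2 ⟨((mem_bondsIn S b).1 hbS).1, hbk⟩

theorem upper_mem_slice (hb : b ∈ crossBonds S j k) : b.upper ∈ slice S j (k + 1) := by
  obtain ⟨hbS, rfl, rfl⟩ := Finset.mem_filter.1 hb
  exact Finset.mem_filter.2 ⟨((mem_bondsIn S b).1 hbS).2, by simp [Bond.upper, Bond.lower]⟩

theorem sum_sum_slice_le {F : LatticePt d → ℝ} (hF : ∀ x, 0 ≤ F x) (G : Finset ℤ) (c : ℤ) :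
    ∑ r ∈ G, ∑ x ∈ slice S j (c + r), F x ≤ ∑ x ∈ S, F x :=
  sum_sum_le_sum_of_fibers (fun x => x j - c) (fun _ => Finset.filter_subset _ _)
    (fun r _ hx => by linarith [(Finset.mem_filter.1 hx).2]) fun x _ => hF x

theorem sum_sum_crossBonds_le {F : Bond d → ℝ} (hF : ∀ b, 0 ≤ F b) (G : Finset ℤ) (c : ℤ) :
    ∑ r ∈ G, ∑ b ∈ crossBonds S j (c + r), F b ≤ ∑ b ∈ bondsIn S, F b :=
  sum_sum_le_sum_of_fibers (fun b => b.lower j - c) (fun _ => Finset.filter_subset _ _)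
    (fun r _ hb => by linarith [(Finset.mem_filter.1 hb).2.2]) fun b _ => hF b

theorem sum_sobEnergy_slice_le {s l : ℝ} {f : LatticePt d → ℝ} (hl : 0 ≤ l) (hf : ∀ x, 0 ≤ f x)
    (G : Finset ℤ) (c : ℤ) :
    ∑ r ∈ G, sobEnergy s l (slice S j (c + r)) f ≤ sobEnergy s l S f := by
  simp only [sobEnergy, Finset.sum_add_distrib]
  refine add_le_add (sum_sum_le_sum_of_fibers (fun b => b.lower j - c)
    (fun _ => bondsIn_mono (Finset.filter_subset _ _)) (fun r b hb => ?_) fun _ _ => by positivity)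
    (sum_sum_slice_le (fun x => Real.rpow_nonneg (div_nonneg (hf x) hl) s) G c)
  linarith [(Finset.mem_filter.1 ((mem_bondsIn _ b).1 hb).1).2]

theorem sum_bondsIn_ite_mul (G : Fin d → Finset ℤ) (κ : Fin d → ℝ) (y : LatticePt d)
    (F : Bond d → ℝ) :
    ∑ b ∈ bondsIn S, (if b.lower b.2 - y b.2 ∈ G b.2 then κ b.2 else 0) * F b =
      ∑ j, κ j * ∑ r ∈ G j, ∑ b ∈ crossBonds S j (y j + r), F b := by
  have hfiber : ∀ b : Bond d, (if b.lower b.2 - y b.2 ∈ G b.2 then κ b.2 else 0) * F b =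
      ∑ j, ∑ r ∈ G j, if b.2 = j ∧ b.lower j = y j + r then κ j * F b else 0 := by
    intro b
    rw [Finset.sum_eq_single b.2 (fun j _ hj => by simp [hj.symm]) (by simp)]
    simp only [true_and, ← sub_eq_iff_eq_add', Finset.sum_ite_eq, ite_mul, zero_mul]
  simp only [hfiber]
  rw [Finset.sum_comm]
  refine Finset.sum_congr rfl fun j _ => ?_
  rw [Finset.sum_comm]
  simp only [crossBonds, Finset.sum_filter, Finset.mul_sum, mul_ite, mul_zero]

end Slices

section SlabCaccioppoli

variable {d : ℕ} {ω : Bond d → ℝ} {w : LatticePt d → ℝ} {α : ℝ} {y : LatticePt d} {ρ σ : ℕ}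

/-- The Dirichlet energy `∑ ω |∇v|²` over the bonds of `S`. -/
noncomputable def bondEnergy (ω : Bond d → ℝ) (S : Finset (LatticePt d)) (v : LatticePt d → ℝ) :
    ℝ :=
  ∑ b ∈ bondsIn S, ω b * grad v b ^ 2

theorem bondEnergy_nonneg (hω : ∀ b, 0 ≤ ω b) (S : Finset (LatticePt d)) (v : LatticePt d → ℝ) :
    0 ≤ bondEnergy ω S v :=
  Finset.sum_nonneg fun b _ => mul_nonneg (hω b) (sq_nonneg _)

theorem sum_bondsIn_mul_sq_grad_boxCutoff_le {S : Finset (LatticePt d)} {F : Bond d → ℝ}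
    (hF : ∀ b, 0 ≤ F b) {Gm Gp : Fin d → Finset ℤ} (h : ∀ j, IsJumpPair ρ σ (Gm j) (Gp j)) :
    ∑ b ∈ bondsIn S, grad (boxCutoff y Gm Gp) b ^ 2 * F b ≤ 2 * ∑ j,
      (((Gm j).card : ℝ)⁻¹ ^ 2 * ∑ r ∈ Gm j, ∑ b ∈ crossBonds S j (y j + r), F b +
        ((Gp j).card : ℝ)⁻¹ ^ 2 * ∑ r ∈ Gp j, ∑ b ∈ crossBonds S j (y j + r), F b) := by
  rw [Finset.sum_add_distrib, ← sum_bondsIn_ite_mul Gm (fun j => ((Gm j).card : ℝ)⁻¹ ^ 2),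
    ← sum_bondsIn_ite_mul Gp (fun j => ((Gp j).card : ℝ)⁻¹ ^ 2), ← Finset.sum_add_distrib,
    Finset.mul_sum]
  refine Finset.sum_le_sum fun b _ => ?_
  rw [← add_mul, ← mul_assoc]
  exact mul_le_mul_of_nonneg_right
    ((sq_grad_boxCutoff_le h b).trans sq_cutProfile_add_one_sub_le) (hF b)

theorem bondEnergy_rpow_le_sum_crossSum (hω : ∀ b, 0 ≤ ω b) (hw : IsNonnegSubsolution ω w)
    (hα : 1 ≤ α) (hρσ : ρ ≤ σ) {Gm Gp : Fin d → Finset ℤ}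
    (h : ∀ j, IsJumpPair ρ σ (Gm j) (Gp j)) :
    bondEnergy ω (box y ρ) (fun x => w x ^ α) ≤ 12 * ∑ j,
      (((Gm j).card : ℝ)⁻¹ ^ 2 *
          ∑ r ∈ Gm j, crossSum ω (fun x => w x ^ α) (box y σ) j (y j + r) +
        ((Gp j).card : ℝ)⁻¹ ^ 2 *
          ∑ r ∈ Gp j, crossSum ω (fun x => w x ^ α) (box y σ) j (y j + r)) := by
  set η := boxCutoff y Gm Gp with hη
  have hη0 : ∀ x, 0 ≤ η x := fun x => boxCutoff_nonneg h
  have hsupp : ∀ x, η x ≠ 0 → x ∈ box y σ ∧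
      ∀ j, x - Pi.single j 1 ∈ box y σ ∧ x + Pi.single j 1 ∈ box y σ := fun x hx =>
    mem_box_neighbors (abs_sub_lt_of_boxCutoff_ne_zero h hx)
  have hone : ∀ x ∈ box y ρ, η x = 1 := fun x hx => boxCutoff_eq_one h hx
  have hwα : ∀ x, 0 ≤ w x ^ α := fun x => Real.rpow_nonneg (hw.nonneg x) α
  calc bondEnergy ω (box y ρ) (fun x => w x ^ α)
      = ∑ b ∈ bondsIn (box y ρ),
          ω b * (min (η b.upper) (η b.lower) ^ 2 * grad (fun x => w x ^ α) b ^ 2) := by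
        refine Finset.sum_congr rfl fun b hb => ?_
        obtain ⟨hlower, hupper⟩ := (mem_bondsIn _ b).1 hb
        rw [hone _ hlower, hone _ hupper, min_self, one_pow, one_mul]
    _ ≤ ∑ b ∈ bondsIn (box y σ),
          ω b * (min (η b.upper) (η b.lower) ^ 2 * grad (fun x => w x ^ α) b ^ 2) :=
        Finset.sum_le_sum_of_subset_of_nonneg (bondsIn_mono (box_mono hρσ y)) fun b _ _ =>
          mul_nonneg (hω b) (mul_nonneg (sq_nonneg _) (sq_nonneg _))
    _ ≤ 6 * ∑ b ∈ bondsIn (box y σ), ω b * (grad η b ^ 2 * (w b.upper ^ α * w b.lower ^ α)) :=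
        caccioppoli hω hw hα hη0 hsupp
    _ = 6 * ∑ b ∈ bondsIn (box y σ), grad η b ^ 2 * (ω b * (w b.lower ^ α * w b.upper ^ α)) := by
        congr! 2 with b
        ring
    _ ≤ _ := by
        have := sum_bondsIn_mul_sq_grad_boxCutoff_le (S := box y σ) (y := y)
          (fun b : Bond d => mul_nonneg (hω b) (mul_nonneg (hwα b.lower) (hwα b.upper))) h
        simp only [crossSum, ← hη] at this ⊢
        linarith

theorem bondEnergy_rpow_le_of_forall_slab (hω : ∀ b, 0 ≤ ω b) (hw : IsNonnegSubsolution ω w)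
    (hα : 1 ≤ α) (hρσ : ρ ≤ σ) {K : ℝ}
    (hK : ∀ j, ∀ I : Finset ℤ, (I.card : ℝ) = σ - ρ → ∃ G ⊆ I, G.Nonempty ∧
      (G.card : ℝ)⁻¹ ^ 2 *
        ∑ r ∈ G, crossSum ω (fun x => w x ^ α) (box y σ) j (y j + r) ≤ K) :
    bondEnergy ω (box y ρ) (fun x => w x ^ α) ≤ 24 * d * K := by
  have hneg : ((Finset.Ico (-(σ : ℤ)) (-ρ)).card : ℝ) = σ - ρ := by
    rw [Int.card_Ico, show (-(ρ : ℤ) - -(σ : ℤ)).toNat = σ - ρ by omega, Nat.cast_sub hρσ]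
  have hpos : ((Finset.Ico (ρ : ℤ) σ).card : ℝ) = σ - ρ := by
    rw [Int.card_Ico, show ((σ : ℤ) - ρ).toNat = σ - ρ by omega, Nat.cast_sub hρσ]
  choose Gm hGm hGm0 hGmK using fun j => hK j _ hneg
  choose Gp hGp hGp0 hGpK using fun j => hK j _ hpos
  calc _ ≤ _ := bondEnergy_rpow_le_sum_crossSum hω hw hα hρσ fun j =>
          ⟨hGm0 j, hGp0 j, hGm j, hGp j⟩
    _ ≤ 12 * ∑ _j : Fin d, (K + K) := by
        gcongr with j
        exacts [hGmK j, hGpK j]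
    _ = 24 * d * K := by
        rw [Finset.sum_const, Finset.card_univ, Fintype.card_fin, nsmul_eq_mul]
        ring

end SlabCaccioppoli

section SliceSobolev

variable {m : ℕ}

/-- The embedding of the bonds of `ℤ^m` into the hyperplane `x j = k` of `ℤ^(m + 1)`. -/
def embedBond (j : Fin (m + 1)) (k : ℤ) (b : Bond m) : Bond (m + 1) :=
  (j.insertNth k b.lower, j.succAbove b.2)

theorem upper_embedBond (j : Fin (m + 1)) (k : ℤ) (b : Bond m) :
    (embedBond j k b).upper = j.insertNth k b.upper := by
  ext i
  refine Fin.succAboveCases j ?_ (fun i => ?_) i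
  · simp [embedBond, Bond.upper, Bond.lower]
  · simp [embedBond, Bond.upper, Bond.lower, Pi.single_apply, Fin.succAbove_right_injective.eq_iff]

theorem embedBond_injective (j : Fin (m + 1)) (k : ℤ) : Function.Injective (embedBond j k) := by
  rintro ⟨x, i⟩ ⟨x', i'⟩ h
  obtain ⟨hx, hi⟩ := Prod.mk.injEq .. ▸ h
  exact Prod.ext ((Fin.insertNth_inj).1 hx).2 (Fin.succAbove_right_injective hi)

theorem insertNth_mem_slice_box {j : Fin (m + 1)} {k : ℤ} {y : LatticePt (m + 1)} {σ : ℕ}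
    (hk : |k - y j| ≤ σ) {x : LatticePt m} (hx : x ∈ box (j.removeNth y) σ) :
    (j.insertNth k x : LatticePt (m + 1)) ∈ slice (box y σ) j k := by
  rw [mem_box] at hx
  refine Finset.mem_filter.2 ⟨(mem_box _ _ _).2 fun i => ?_, by simp⟩
  refine Fin.succAboveCases j ?_ (fun i => ?_) i
  · simpa using hk
  · simpa [Fin.removeNth] using hx i

theorem sobEnergy_insertNth_le {s l : ℝ} (hl : 0 ≤ l) {f : LatticePt (m + 1) → ℝ}
    (hf : ∀ x, 0 ≤ f x) {j : Fin (m + 1)} {k : ℤ} {S : Finset (LatticePt m)}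
    {T : Finset (LatticePt (m + 1))} (hST : ∀ x ∈ S, (j.insertNth k x : LatticePt (m + 1)) ∈ T) :
    sobEnergy s l S (fun x => f (j.insertNth k x)) ≤ sobEnergy s l T f := by
  refine add_le_add ?_ (sum_comp_le_sum_of_injOn (φ := j.insertNth k)
    (F := fun x => (f x / l) ^ s) (fun x _ x' _ h => (Fin.insertNth_inj.1 h).2) hST fun x _ =>
      Real.rpow_nonneg (div_nonneg (hf x) hl) s)
  refine (Finset.sum_congr rfl fun b _ => ?_).trans_le
    (sum_comp_le_sum_of_injOn (φ := embedBond j k) (F := fun b => |grad f b| ^ s)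
      (embedBond_injective j k).injOn (fun b hb => ?_) fun b _ => by positivity)
  · rw [grad, grad, upper_embedBond]; rfl
  · rw [mem_bondsIn] at hb ⊢
    exact ⟨hST _ hb.1, upper_embedBond j k b ▸ hST _ hb.2⟩

theorem sum_slice_box_le (j : Fin (m + 1)) (k : ℤ) (y : LatticePt (m + 1)) (σ : ℕ)
    {F : LatticePt (m + 1) → ℝ} (hF : ∀ x, 0 ≤ F x) :
    ∑ x ∈ slice (box y σ) j k, F x ≤ ∑ x ∈ box (j.removeNth y) σ, F (j.insertNth k x) := by
  have hinv : ∀ x ∈ slice (box y σ) j k, j.insertNth k (j.removeNth x) = x := by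
    intro x hx
    rw [← (Finset.mem_filter.1 hx).2, Fin.insertNth_self_removeNth]
  refine (Finset.sum_congr rfl fun x hx => (congrArg F (hinv x hx)).symm).trans_le
    (sum_comp_le_sum_of_injOn (φ := j.removeNth) (F := fun x => F (j.insertNth k x))
      (fun x hx x' hx' h => by rw [← hinv x hx, ← hinv x' hx', h]) (fun x hx => ?_)
      fun x _ => hF _)
  rw [mem_box]
  exact fun i => (mem_box _ _ _).1 (Finset.mem_filter.1 hx).1 (j.succAbove i)

theorem exists_sum_slice_rpow_le_sobEnergy {d : ℕ} (hd : 3 ≤ d) {s r : ℝ} (hs : 1 ≤ s)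
    (hsd : s < (d : ℝ) - 1) (hr : r = s * ((d : ℝ) - 1) / ((d : ℝ) - 1 - s)) :
    ∃ C : ℝ, 0 < C ∧ ∀ (y : LatticePt d) (σ : ℕ) (l : ℝ), 0 < l → l ≤ 2 * σ + 1 →
      ∀ f : LatticePt d → ℝ, (∀ x, 0 ≤ f x) → ∀ (j : Fin d) (k : ℤ),
      ∑ x ∈ slice (box y σ) j k, f x ^ r ≤
        C * sobEnergy s l (slice (box y σ) j k) f ^ (r / s) := by
  obtain ⟨m, rfl⟩ : ∃ m, d = m + 1 := ⟨d - 1, by omega⟩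
  have hm : ((m + 1 : ℕ) : ℝ) - 1 = m := by push_cast; ring
  rw [hm] at hsd hr
  obtain ⟨C, hC0, hC⟩ := exists_sum_rpow_le_sobEnergy (by omega) hs hsd hr
  have hr0 : 0 < r := by rw [hr]; exact div_pos (mul_pos (by linarith) (by linarith)) (by linarith)
  refine ⟨C, hC0, fun y σ l hl hlσ f hf j k => ?_⟩
  have hE : ∀ S, 0 ≤ sobEnergy s l S f := fun S => sobEnergy_nonneg hl.le hf
  rcases (slice (box y σ) j k).eq_empty_or_nonempty with hempty | ⟨x, hx⟩
  · rw [hempty, Finset.sum_empty]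
    exact mul_nonneg hC0.le (Real.rpow_nonneg (hE _) _)
  have hk : |k - y j| ≤ σ := (Finset.mem_filter.1 hx).2 ▸ (mem_box _ _ _).1
    (Finset.mem_filter.1 hx).1 j
  calc _ ≤ ∑ x ∈ box (j.removeNth y) σ, f (j.insertNth k x) ^ r :=
        sum_slice_box_le j k y σ fun x => Real.rpow_nonneg (hf x) r
    _ ≤ C * sobEnergy s l (box (j.removeNth y) σ) (fun x => f (j.insertNth k x)) ^ (r / s) :=
        hC _ _ l hl (fun i => by push_cast; linarith) _ fun x => hf _
    _ ≤ _ := by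
        have := sobEnergy_insertNth_le (s := s) hl.le hf fun x => insertNth_mem_slice_box hk
        have := sobEnergy_nonneg (s := s) (S := box (j.removeNth y) σ) hl.le
          fun x => hf (j.insertNth k x)
        gcongr

end SliceSobolev

section GoodHyperplanes

theorem three_mul_card_filter_lt_le {I : Finset ℤ} {f : ℤ → ℝ} (hf : ∀ r, 0 ≤ f r) {B : ℝ}
    (hB : ∑ r ∈ I, f r ≤ B) : 3 * (I.filter fun r => 3 * B / I.card < f r).card ≤ I.card := by
  rcases I.eq_empty_or_nonempty with rfl | hI
  · simp
  have hcard : (0 : ℝ) < I.card := by exact_mod_cast hI.card_pos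
  by_contra! hcon
  have hne : (I.filter fun r => 3 * B / I.card < f r).Nonempty := by
    rw [← Finset.card_pos]; omega
  have hB0 : 0 ≤ B := (Finset.sum_nonneg fun r _ => hf r).trans hB
  have hlt := calc
    (I.filter fun r => 3 * B / I.card < f r).card * (3 * B / I.card)
        < ∑ r ∈ I with 3 * B / I.card < f r, f r := by
          rw [← nsmul_eq_mul, ← Finset.sum_const]
          exact Finset.sum_lt_sum_of_nonempty hne fun r hr => (Finset.mem_filter.1 hr).2
      _ ≤ B := (Finset.sum_le_sum_of_subset_of_nonneg (Finset.filter_subset _ _)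
          fun r _ _ => hf r).trans hB
  rw [mul_div_assoc', div_lt_iff₀ hcard] at hlt
  have : (I.card : ℝ) < 3 * (I.filter fun r => 3 * B / I.card < f r).card := by
    exact_mod_cast hcon
  nlinarith

theorem exists_subset_forall_le {I : Finset ℤ} (hI : I.Nonempty) {f g : ℤ → ℝ}
    (hf : ∀ r, 0 ≤ f r) (hg : ∀ r, 0 ≤ g r) {Bf Bg : ℝ} (hBf : ∑ r ∈ I, f r ≤ Bf)
    (hBg : ∑ r ∈ I, g r ≤ Bg) :
    ∃ G ⊆ I, G.Nonempty ∧ (I.card : ℝ) ≤ 3 * G.card ∧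
      ∀ r ∈ G, f r ≤ 3 * Bf / I.card ∧ g r ≤ 3 * Bg / I.card := by
  set G := I.filter fun r => f r ≤ 3 * Bf / I.card ∧ g r ≤ 3 * Bg / I.card with hG
  have hcover : I ⊆ G ∪ ((I.filter fun r => 3 * Bf / I.card < f r) ∪
      (I.filter fun r => 3 * Bg / I.card < g r)) := by
    intro r hr
    simp only [hG, Finset.mem_union, Finset.mem_filter, hr, true_and, ← not_le]
    tauto
  have hcard : I.card ≤ 3 * G.card := by
    have := (Finset.card_le_card hcover).trans ((Finset.card_union_le _ _).trans
      (Nat.add_le_add_left (Finset.card_union_le _ _) _))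
    have := three_mul_card_filter_lt_le hf hBf
    have := three_mul_card_filter_lt_le hg hBg
    omega
  refine ⟨G, Finset.filter_subset _ _, ?_, by exact_mod_cast hcard,
    fun r hr => (Finset.mem_filter.1 hr).2⟩
  rw [← Finset.card_pos] at hI ⊢
  omega

end GoodHyperplanes

section CrossSum

variable {d : ℕ} {ω a : Bond d → ℝ} {v : LatticePt d → ℝ} {S : Finset (LatticePt d)} {A P : ℝ}

theorem mul_rpow_one_div_le {x y P : ℝ} (hx : 0 ≤ x) (hy : 0 ≤ y) (hP1 : P < 1) :
    (x * y) ^ (1 / (1 - P)) ≤ x ^ (2 / (1 - P)) + y ^ (2 / (1 - P)) := by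
  have : 0 < 1 - P := by linarith
  have hmax : 0 ≤ max x y := le_max_of_le_left hx
  calc (x * y) ^ (1 / (1 - P)) ≤ (max x y ^ (2 : ℝ)) ^ (1 / (1 - P)) := by
        refine Real.rpow_le_rpow (mul_nonneg hx hy) ?_ (by positivity)
        rw [Real.rpow_two, sq]
        exact mul_le_mul (le_max_left x y) (le_max_right x y) hy hmax
    _ = max x y ^ (2 / (1 - P)) := by
        rw [← Real.rpow_mul hmax, mul_one_div]
    _ ≤ x ^ (2 / (1 - P)) + y ^ (2 / (1 - P)) := max_rpow_le_add_rpow hx hy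

theorem sum_crossBonds_rpow_le (hv : ∀ x, 0 ≤ v x) (hP1 : P < 1) (j : Fin d) (k : ℤ) :
    ∑ b ∈ crossBonds S j k, (v b.lower * v b.upper) ^ (1 / (1 - P)) ≤
      ∑ x ∈ slice S j k, v x ^ (2 / (1 - P)) +
        ∑ x ∈ slice S j (k + 1), v x ^ (2 / (1 - P)) := by
  have hvP : ∀ x, 0 ≤ v x ^ (2 / (1 - P)) := fun x => Real.rpow_nonneg (hv x) _
  refine (Finset.sum_le_sum fun b _ => mul_rpow_one_div_le (hv b.lower) (hv b.upper) hP1).trans ?_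
  rw [Finset.sum_add_distrib]
  have hdir : ∀ b ∈ crossBonds S j k, b.2 = j := fun b hb => (Finset.mem_filter.1 hb).2.1
  refine add_le_add ?_ ?_
  · refine sum_comp_le_sum_of_injOn (F := fun x => v x ^ (2 / (1 - P))) (fun b hb b' hb' h => ?_)
      (fun _ => lower_mem_slice) fun x _ => hvP x
    exact Prod.ext h ((hdir b hb).trans (hdir b' hb').symm)
  · refine sum_comp_le_sum_of_injOn (F := fun x => v x ^ (2 / (1 - P))) (fun b hb b' hb' h => ?_)
      (fun _ => upper_mem_slice) fun x _ => hvP x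
    exact upper_prod_snd_injective (Prod.ext h ((hdir b hb).trans (hdir b' hb').symm))

theorem crossSum_le (hv : ∀ x, 0 ≤ v x) (ha : ∀ b, 0 ≤ a b) (hA : 0 ≤ A) (hP : 0 ≤ P) (hP1 : P < 1)
    (hω : ∀ b ∈ bondsIn S, ω b ≤ A * a b ^ P) (j : Fin d) (k : ℤ) :
    crossSum ω v S j k ≤ A * ((∑ b ∈ crossBonds S j k, a b) ^ P *
      (∑ x ∈ slice S j k, v x ^ (2 / (1 - P)) +
        ∑ x ∈ slice S j (k + 1), v x ^ (2 / (1 - P))) ^ (1 - P)) := by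
  have hP' : 0 < 1 - P := by linarith
  have hvv : ∀ b : Bond d, 0 ≤ v b.lower * v b.upper := fun b => mul_nonneg (hv _) (hv _)
  have hvvP : ∀ b : Bond d, 0 ≤ (v b.lower * v b.upper) ^ (1 / (1 - P)) := fun b =>
    Real.rpow_nonneg (hvv b) _
  calc crossSum ω v S j k
      ≤ ∑ b ∈ crossBonds S j k,
          A * (a b ^ P * ((v b.lower * v b.upper) ^ (1 / (1 - P))) ^ (1 - P)) := by
        refine Finset.sum_le_sum fun b hb => ?_
        rw [← Real.rpow_mul (hvv b), one_div_mul_cancel hP'.ne', Real.rpow_one, ← mul_assoc A]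
        exact mul_le_mul_of_nonneg_right (hω b (Finset.mem_filter.1 hb).1) (hvv b)
    _ ≤ A * ((∑ b ∈ crossBonds S j k, a b) ^ P *
          (∑ b ∈ crossBonds S j k, (v b.lower * v b.upper) ^ (1 / (1 - P))) ^ (1 - P)) := by
        rw [← Finset.mul_sum]
        exact mul_le_mul_of_nonneg_left (sum_rpow_mul_rpow_le _ (fun b _ => ha b)
          (fun b _ => hvvP b) hP hP'.le (by ring)) hA
    _ ≤ _ := by
        have := Real.rpow_nonneg (Finset.sum_nonneg fun b (_ : b ∈ crossBonds S j k) => ha b) P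
        have := Real.rpow_le_rpow (Finset.sum_nonneg fun b _ => hvvP b)
          (sum_crossBonds_rpow_le (S := S) hv hP1 j k) hP'.le
        gcongr

theorem crossSum_le_of_sobEnergy_le {s l C M E : ℝ} (hv : ∀ x, 0 ≤ v x) (ha : ∀ b, 0 ≤ a b)
    (hA : 0 ≤ A) (hP : 0 ≤ P) (hP1 : P < 1) (hs : 0 < s) (hl : 0 ≤ l) (hC : 0 ≤ C)
    (hω : ∀ b ∈ bondsIn S, ω b ≤ A * a b ^ P) {j : Fin d} {k : ℤ}
    (hsob : ∀ k, ∑ x ∈ slice S j k, v x ^ (2 / (1 - P)) ≤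
      C * sobEnergy s l (slice S j k) v ^ (2 / (1 - P) / s))
    (hM : ∑ b ∈ crossBonds S j k, a b ≤ M)
    (hE : sobEnergy s l (slice S j k) v + sobEnergy s l (slice S j (k + 1)) v ≤ E) :
    crossSum ω v S j k ≤ A * (M ^ P * ((2 * C) ^ (1 - P) * E ^ (2 / s))) := by
  have hP' : 0 < 1 - P := by linarith
  have he : ∀ k, 0 ≤ sobEnergy s l (slice S j k) v := fun k => sobEnergy_nonneg hl hv
  have hE0 : 0 ≤ E := (add_nonneg (he k) (he (k + 1))).trans hE
  have hslice : ∀ k, sobEnergy s l (slice S j k) v ≤ E →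
      ∑ x ∈ slice S j k, v x ^ (2 / (1 - P)) ≤ C * E ^ (2 / (1 - P) / s) := fun k hk =>
    (hsob k).trans (mul_le_mul_of_nonneg_left (Real.rpow_le_rpow (he k) hk (by positivity)) hC)
  have hsum0 : ∀ k, 0 ≤ ∑ x ∈ slice S j k, v x ^ (2 / (1 - P)) := fun k =>
    Finset.sum_nonneg fun x _ => Real.rpow_nonneg (hv x) _
  have ha0 : 0 ≤ ∑ b ∈ crossBonds S j k, a b := Finset.sum_nonneg fun b _ => ha b
  have hM0 : 0 ≤ M := ha0.trans hM
  calc crossSum ω v S j k ≤ A * (M ^ P *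
        (C * E ^ (2 / (1 - P) / s) + C * E ^ (2 / (1 - P) / s)) ^ (1 - P)) := by
        refine (crossSum_le hv ha hA hP hP1 hω j k).trans ?_
        gcongr
        · exact Real.rpow_nonneg (add_nonneg (hsum0 k) (hsum0 (k + 1))) _
        · exact add_nonneg (hsum0 k) (hsum0 (k + 1))
        · exact hslice k (by linarith [he (k + 1)])
        · exact hslice (k + 1) (by linarith [he k])
    _ = A * (M ^ P * ((2 * C) ^ (1 - P) * E ^ (2 / s))) := by
        rw [← two_mul, ← mul_assoc (2 : ℝ) C, Real.mul_rpow (by positivity) (by positivity),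
          ← Real.rpow_mul hE0, show 2 / (1 - P) / s * (1 - P) = 2 / s by field_simp]

theorem exists_subset_sum_crossSum_le {s l C : ℝ} (hv : ∀ x, 0 ≤ v x) (ha : ∀ b, 0 ≤ a b)
    (hA : 0 ≤ A) (hP : 0 ≤ P) (hP1 : P < 1) (hs : 0 < s) (hl : 0 ≤ l) (hC : 0 ≤ C)
    (hω : ∀ b ∈ bondsIn S, ω b ≤ A * a b ^ P) {j : Fin d}
    (hsob : ∀ k, ∑ x ∈ slice S j k, v x ^ (2 / (1 - P)) ≤
      C * sobEnergy s l (slice S j k) v ^ (2 / (1 - P) / s)) (c : ℤ) {I : Finset ℤ}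
    (hI : I.Nonempty) :
    ∃ G ⊆ I, G.Nonempty ∧ (G.card : ℝ)⁻¹ ^ 2 * ∑ r ∈ G, crossSum ω v S j (c + r) ≤
      3 * (A * ((3 * (∑ b ∈ bondsIn S, a b) / I.card) ^ P *
        ((2 * C) ^ (1 - P) * (3 * (2 * sobEnergy s l S v) / I.card) ^ (2 / s)))) / I.card := by
  set K := A * ((3 * (∑ b ∈ bondsIn S, a b) / I.card) ^ P *
    ((2 * C) ^ (1 - P) * (3 * (2 * sobEnergy s l S v) / I.card) ^ (2 / s)))
  have henergy : ∑ r ∈ I,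
      (sobEnergy s l (slice S j (c + r)) v + sobEnergy s l (slice S j (c + r + 1)) v) ≤
      2 * sobEnergy s l S v := by
    have hnext := sum_sobEnergy_slice_le (s := s) (S := S) (j := j) hl hv I (c + 1)
    simp only [add_right_comm c 1] at hnext
    rw [Finset.sum_add_distrib, two_mul]
    exact add_le_add (sum_sobEnergy_slice_le hl hv I c) hnext
  obtain ⟨G, hGI, hG, hcard, hgood⟩ := exists_subset_forall_le hI
    (fun r => Finset.sum_nonneg fun b _ => ha b)
    (fun r => add_nonneg (sobEnergy_nonneg hl hv) (sobEnergy_nonneg hl hv))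
    (sum_sum_crossBonds_le ha I c) henergy
  have hK : ∀ r ∈ G, crossSum ω v S j (c + r) ≤ K := fun r hr =>
    crossSum_le_of_sobEnergy_le hv ha hA hP hP1 hs hl hC hω hsob (hgood r hr).1 (hgood r hr).2
  have hK0 : 0 ≤ K := by
    have := sobEnergy_nonneg (s := s) (S := S) hl hv
    have : 0 ≤ ∑ b ∈ bondsIn S, a b := Finset.sum_nonneg fun b _ => ha b
    positivity
  have hG0 : (0 : ℝ) < G.card := by exact_mod_cast hG.card_pos
  have hI0 : (0 : ℝ) < I.card := by exact_mod_cast hI.card_pos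
  refine ⟨G, hGI, hG, ?_⟩
  calc (G.card : ℝ)⁻¹ ^ 2 * ∑ r ∈ G, crossSum ω v S j (c + r)
      ≤ (G.card : ℝ)⁻¹ ^ 2 * (G.card * K) := by
        gcongr
        rw [← nsmul_eq_mul]
        exact Finset.sum_le_card_nsmul _ _ _ hK
    _ = K / G.card := by field_simp
    _ ≤ 3 * K / I.card := by
        rw [div_le_div_iff₀ hG0 hI0]
        nlinarith

theorem sum_crossSum_le (hv : ∀ x, 0 ≤ v x) (ha : ∀ b, 0 ≤ a b) (hA : 0 ≤ A) (hP : 0 ≤ P)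
    (hP1 : P < 1) (hω : ∀ b ∈ bondsIn S, ω b ≤ A * a b ^ P) (j : Fin d) (G : Finset ℤ) (c : ℤ) :
    ∑ r ∈ G, crossSum ω v S j (c + r) ≤ 2 * (A * ((∑ b ∈ bondsIn S, a b) ^ P *
      (∑ x ∈ S, v x ^ (2 / (1 - P))) ^ (1 - P))) := by
  have hP' : 0 < 1 - P := by linarith
  have hvP : ∀ x, 0 ≤ v x ^ (2 / (1 - P)) := fun x => Real.rpow_nonneg (hv x) _
  have hM : ∀ r ∈ G, 0 ≤ ∑ b ∈ crossBonds S j (c + r), a b := fun _ _ =>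
    Finset.sum_nonneg fun b _ => ha b
  have hY : ∀ r ∈ G, 0 ≤ ∑ x ∈ slice S j (c + r), v x ^ (2 / (1 - P)) +
      ∑ x ∈ slice S j (c + r + 1), v x ^ (2 / (1 - P)) := fun _ _ =>
    add_nonneg (Finset.sum_nonneg fun x _ => hvP x) (Finset.sum_nonneg fun x _ => hvP x)
  have hslices : ∑ r ∈ G, (∑ x ∈ slice S j (c + r), v x ^ (2 / (1 - P)) +
      ∑ x ∈ slice S j (c + r + 1), v x ^ (2 / (1 - P))) ≤ 2 * ∑ x ∈ S, v x ^ (2 / (1 - P)) := by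
    have hnext := sum_sum_slice_le (S := S) (j := j) hvP G (c + 1)
    simp only [add_right_comm c 1] at hnext
    rw [Finset.sum_add_distrib, two_mul]
    exact add_le_add (sum_sum_slice_le hvP G c) hnext
  have hY0 : 0 ≤ ∑ x ∈ S, v x ^ (2 / (1 - P)) := Finset.sum_nonneg fun x _ => hvP x
  have hM0 : 0 ≤ ∑ b ∈ bondsIn S, a b := Finset.sum_nonneg fun b _ => ha b
  calc _ ≤ A * ((∑ r ∈ G, ∑ b ∈ crossBonds S j (c + r), a b) ^ P *
        (∑ r ∈ G, (∑ x ∈ slice S j (c + r), v x ^ (2 / (1 - P)) +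
          ∑ x ∈ slice S j (c + r + 1), v x ^ (2 / (1 - P)))) ^ (1 - P)) := by
        refine (Finset.sum_le_sum fun r _ => crossSum_le hv ha hA hP hP1 hω j (c + r)).trans ?_
        rw [← Finset.mul_sum]
        exact mul_le_mul_of_nonneg_left (sum_rpow_mul_rpow_le _ hM hY hP hP'.le (by ring)) hA
    _ ≤ A * ((∑ b ∈ bondsIn S, a b) ^ P * (2 * ∑ x ∈ S, v x ^ (2 / (1 - P))) ^ (1 - P)) := by
        have := Finset.sum_nonneg hM
        have := Finset.sum_nonneg hY
        gcongr
        exact sum_sum_crossBonds_le ha G c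
    _ ≤ _ := by
        have htwo : (2 : ℝ) ^ (1 - P) ≤ 2 :=
          (Real.rpow_le_rpow_of_exponent_le one_le_two (by linarith)).trans_eq (Real.rpow_one 2)
        rw [Real.mul_rpow zero_le_two hY0, mul_left_comm (_ ^ P), mul_left_comm A]
        gcongr

end CrossSum

section CaccioppoliWeight

variable {d : ℕ} {ω a : Bond d → ℝ} {w : LatticePt d → ℝ} {A P : ℝ} {y : LatticePt d} {ρ σ : ℕ}

theorem exists_bondEnergy_rpow_le (hd : 3 ≤ d) {s : ℝ} (hP : 0 ≤ P) (hP1 : P < 1)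
    (hs : 1 ≤ s) (hsd : s < (d : ℝ) - 1)
    (hr : 2 / (1 - P) = s * ((d : ℝ) - 1) / ((d : ℝ) - 1 - s)) :
    ∃ C : ℝ, 0 < C ∧ ∀ ω a : Bond d → ℝ, (∀ b, 0 ≤ ω b) → (∀ b, 0 ≤ a b) →
      ∀ w, IsNonnegSubsolution ω w → ∀ α : ℝ, 1 ≤ α →
      ∀ (y : LatticePt d) (ρ σ : ℕ), ρ < σ → ∀ l A : ℝ, 0 < l → l ≤ 2 * σ + 1 → 0 ≤ A →
      (∀ b ∈ bondsIn (box y σ), ω b ≤ A * a b ^ P) →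
      bondEnergy ω (box y ρ) (fun x => w x ^ α) ≤
        C * (A * ((∑ b ∈ bondsIn (box y σ), a b) / ((σ : ℝ) - ρ)) ^ P *
          (sobEnergy s l (box y σ) (fun x => w x ^ α) / ((σ : ℝ) - ρ)) ^ (2 / s) /
            ((σ : ℝ) - ρ)) := by
  obtain ⟨C, hC0, hC⟩ := exists_sum_slice_rpow_le_sobEnergy hd hs hsd hr
  refine ⟨72 * d * (3 ^ P * ((2 * C) ^ (1 - P) * 6 ^ (2 / s))), by positivity, ?_⟩
  intro ω a hω ha w hw α hα y ρ σ hρσ l A hl hlσ hA hωA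
  have hL : (0 : ℝ) < σ - ρ := sub_pos.2 (by exact_mod_cast hρσ)
  have hv : ∀ x, 0 ≤ w x ^ α := fun x => Real.rpow_nonneg (hw.nonneg x) α
  have hM : 0 ≤ (∑ b ∈ bondsIn (box y σ), a b) / ((σ : ℝ) - ρ) :=
    div_nonneg (Finset.sum_nonneg fun b _ => ha b) hL.le
  have hT : 0 ≤ sobEnergy s l (box y σ) (fun x => w x ^ α) / ((σ : ℝ) - ρ) :=
    div_nonneg (sobEnergy_nonneg hl.le hv) hL.le
  have hslab := bondEnergy_rpow_le_of_forall_slab (y := y) hω hw hα hρσ.le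
    (K := 3 * (A * ((3 * (∑ b ∈ bondsIn (box y σ), a b) / ((σ : ℝ) - ρ)) ^ P * ((2 * C) ^ (1 - P) *
      (3 * (2 * sobEnergy s l (box y σ) (fun x => w x ^ α)) / ((σ : ℝ) - ρ)) ^ (2 / s)))) /
        ((σ : ℝ) - ρ)) fun j I hI => by
    have hI0 : I.Nonempty := Finset.card_pos.1 (by rw [← hI] at hL; exact_mod_cast hL)
    rw [← hI]
    exact exists_subset_sum_crossSum_le hv ha hA hP hP1 (by linarith) hl.le hC0.le hωA
      (hC y σ l hl hlσ _ hv j) (y j) hI0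
  rw [mul_div_assoc 3 (Finset.sum _ _), Real.mul_rpow zero_le_three hM, ← mul_assoc (3 : ℝ) 2,
    mul_div_assoc (3 * 2), Real.mul_rpow (by norm_num) hT,
    show (3 * 2 : ℝ) = 6 by norm_num] at hslab
  exact hslab.trans_eq (by ring)

theorem bondEnergy_le_of_sum_rpow (hP : 0 ≤ P) (hP1 : P < 1) (hω : ∀ b, 0 ≤ ω b)
    (ha : ∀ b, 0 ≤ a b) (hw : IsNonnegSubsolution ω w) (hρσ : ρ < σ) (hA : 0 ≤ A)
    (hωA : ∀ b ∈ bondsIn (box y σ), ω b ≤ A * a b ^ P) :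
    bondEnergy ω (box y ρ) w ≤ 48 * d * (A * ((∑ b ∈ bondsIn (box y σ), a b) ^ P *
      (∑ x ∈ box y σ, w x ^ (2 / (1 - P))) ^ (1 - P)) / ((σ : ℝ) - ρ) ^ 2) := by
  have hL : (0 : ℝ) < σ - ρ := sub_pos.2 (by exact_mod_cast hρσ)
  have hslab := bondEnergy_rpow_le_of_forall_slab (y := y) hω hw le_rfl hρσ.le
    (K := (((σ : ℝ) - ρ)⁻¹) ^ 2 * (2 * (A * ((∑ b ∈ bondsIn (box y σ), a b) ^ P *
      (∑ x ∈ box y σ, w x ^ (2 / (1 - P))) ^ (1 - P))))) fun j I hI => by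
    refine ⟨I, subset_rfl, Finset.card_pos.1 (by rw [← hI] at hL; exact_mod_cast hL), ?_⟩
    rw [hI]
    simp only [Real.rpow_one]
    exact mul_le_mul_of_nonneg_left (sum_crossSum_le hw.nonneg ha hA hP hP1 hωA j I (y j))
      (sq_nonneg _)
  simp only [Real.rpow_one] at hslab
  exact hslab.trans_eq (by rw [inv_pow]; ring)

end CaccioppoliWeight

section ScaledEnergy

variable {d : ℕ}

/-- The sum of `f` over `S` in units of the volume `n ^ d`. Unlike a genuine average it is monotone
in `S`, and for boxes of radius comparable to `n` the two differ by a bounded factor. -/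
noncomputable def scaledAvg (n : ℕ) (S : Finset (LatticePt d)) (f : LatticePt d → ℝ) : ℝ :=
  (n : ℝ) ^ (-(d : ℝ)) * ∑ x ∈ S, f x

/-- The scale invariant version `n ^ (t - d) * (∑ |∇f| ^ t + ∑ (f / n) ^ t)` of `sobEnergy`. -/
noncomputable def scaledEnergy (t : ℝ) (n : ℕ) (S : Finset (LatticePt d)) (f : LatticePt d → ℝ) :
    ℝ :=
  (n : ℝ) ^ (t - d) * sobEnergy t n S f

variable {n : ℕ} {t : ℝ} {S S' : Finset (LatticePt d)} {f : LatticePt d → ℝ}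

theorem scaledAvg_nonneg (hf : ∀ x, 0 ≤ f x) : 0 ≤ scaledAvg n S f :=
  mul_nonneg (by positivity) (Finset.sum_nonneg fun x _ => hf x)

theorem scaledAvg_mono (h : S ⊆ S') (hf : ∀ x, 0 ≤ f x) : scaledAvg n S f ≤ scaledAvg n S' f :=
  mul_le_mul_of_nonneg_left (Finset.sum_le_sum_of_subset_of_nonneg h fun x _ _ => hf x)
    (by positivity)

theorem scaledEnergy_nonneg (hf : ∀ x, 0 ≤ f x) : 0 ≤ scaledEnergy t n S f :=
  mul_nonneg (by positivity) (sobEnergy_nonneg (by positivity) hf)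

theorem sum_eq_rpow_mul_scaledAvg (hn : 1 ≤ n) :
    ∑ x ∈ S, f x = (n : ℝ) ^ (d : ℝ) * scaledAvg n S f := by
  have hN : (0 : ℝ) < n := by exact_mod_cast hn
  rw [scaledAvg, ← mul_assoc, ← Real.rpow_add hN, add_neg_cancel, Real.rpow_zero, one_mul]

theorem sobEnergy_eq_rpow_mul_scaledEnergy (hn : 1 ≤ n) :
    sobEnergy t n S f = (n : ℝ) ^ ((d : ℝ) - t) * scaledEnergy t n S f := by
  have hN : (0 : ℝ) < n := by exact_mod_cast hn
  rw [scaledEnergy, ← mul_assoc, ← Real.rpow_add hN, sub_add_sub_cancel, sub_self, Real.rpow_zero,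
    one_mul]

theorem scaledEnergy_eq (hn : 1 ≤ n) (hf : ∀ x, 0 ≤ f x) :
    scaledEnergy t n S f =
      (n : ℝ) ^ (t - d) * ∑ b ∈ bondsIn S, |grad f b| ^ t + scaledAvg n S fun x => f x ^ t := by
  have hN : (0 : ℝ) < n := by exact_mod_cast hn
  rw [scaledEnergy, sobEnergy, mul_add, scaledAvg, Finset.mul_sum S, Finset.mul_sum S]
  congr 1
  refine Finset.sum_congr rfl fun x _ => ?_
  rw [Real.div_rpow (hf x) hN.le, sub_eq_add_neg, Real.rpow_add hN]
  field_simp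

theorem scaledAvg_rpow_le_scaledEnergy (hn : 1 ≤ n) (hf : ∀ x, 0 ≤ f x) :
    (scaledAvg n S fun x => f x ^ t) ≤ scaledEnergy t n S f := by
  rw [scaledEnergy_eq hn hf]
  exact le_add_of_nonneg_left (mul_nonneg (by positivity) sum_abs_grad_rpow_nonneg)

theorem scaledEnergy_rpow_le {s r γ θ : ℝ} (hn : 1 ≤ n) (hs : 0 ≤ s) (hγ : 1 ≤ γ) (hθ : 0 ≤ θ)
    (hθ1 : θ ≤ 1) (hr : s * (γ - 1) = r * (1 - θ)) (ht : s = t * θ) (hf : ∀ x, 0 ≤ f x) :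
    (scaledEnergy s n S fun x => f x ^ γ) ≤ (γ ^ s * (2 * d + 1) + 1) *
      (scaledAvg n S fun x => f x ^ r) ^ (1 - θ) * scaledEnergy t n S f ^ θ := by
  have hN : (0 : ℝ) < n := by exact_mod_cast hn
  have hZ : 0 ≤ scaledAvg n S fun x => f x ^ r :=
    scaledAvg_nonneg fun x => Real.rpow_nonneg (hf x) _
  have hE : 0 ≤ scaledEnergy t n S f := scaledEnergy_nonneg hf
  have h := sobEnergy_rpow_le (S := S) hN hs hγ hθ hθ1 hr ht hf
  rw [sum_eq_rpow_mul_scaledAvg hn, sobEnergy_eq_rpow_mul_scaledEnergy hn (f := f),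
    Real.mul_rpow (by positivity) hZ, Real.mul_rpow (by positivity) hE, ← Real.rpow_mul hN.le,
    ← Real.rpow_mul hN.le] at h
  have hexp : (n : ℝ) ^ (s - d) * ((n : ℝ) ^ (d * (1 - θ)) * (n : ℝ) ^ ((d - t) * θ)) = 1 := by
    rw [← Real.rpow_add hN, ← Real.rpow_add hN, ht]
    ring_nf
    exact Real.rpow_zero _
  refine (mul_le_mul_of_nonneg_left h (by positivity)).trans_eq ?_
  linear_combination (γ ^ s * (2 * d + 1) + 1) * (scaledAvg n S fun x => f x ^ r) ^ (1 - θ) *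
    scaledEnergy t n S f ^ θ * hexp

variable {y : LatticePt d} {σ : ℕ}

theorem card_box_le (hn : 1 ≤ n) (hσ : σ ≤ 2 * n) (y : LatticePt d) :
    ((box y σ).card : ℝ) ≤ 5 ^ d * (n : ℝ) ^ (d : ℝ) := by
  have h : (box y σ).card ≤ (5 * n) ^ d := by
    rw [box, Pi.card_Icc]
    refine (Finset.prod_le_pow_card _ _ (5 * n) fun i _ => ?_).trans (by simp)
    rw [Int.card_Icc]
    omega
  rw [Real.rpow_natCast, ← mul_pow]
  exact_mod_cast h

theorem scaledAvg_rpow_le {q r θ : ℝ} (hn : 1 ≤ n) (hσ : σ ≤ 2 * n) (hθ : 0 ≤ θ) (hθ1 : θ ≤ 1)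
    (hq : q = r * θ) (hf : ∀ x, 0 ≤ f x) :
    (scaledAvg n (box y σ) fun x => f x ^ q) ≤
      5 ^ d * (scaledAvg n (box y σ) fun x => f x ^ r) ^ θ := by
  have hN : (0 : ℝ) < n := by exact_mod_cast hn
  have hZ : 0 ≤ scaledAvg n (box y σ) fun x => f x ^ r :=
    scaledAvg_nonneg fun x => Real.rpow_nonneg (hf x) _
  have hcard : ((box y σ).card : ℝ) ^ (1 - θ) ≤ 5 ^ d * (n : ℝ) ^ (d * (1 - θ)) := by
    refine (Real.rpow_le_rpow (by positivity) (card_box_le hn hσ y) (sub_nonneg.2 hθ1)).trans ?_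
    rw [Real.mul_rpow (by positivity) (by positivity), ← Real.rpow_mul hN.le]
    gcongr
    exact (Real.rpow_le_rpow_of_exponent_le (one_le_pow₀ (by norm_num))
      (by linarith : 1 - θ ≤ 1)).trans_eq (Real.rpow_one _)
  have hjensen := sum_rpow_le_card_rpow_mul (box y σ) (fun x _ => Real.rpow_nonneg (hf x) r) hθ hθ1
  simp only [← Real.rpow_mul (hf _), ← hq] at hjensen
  rw [sum_eq_rpow_mul_scaledAvg hn (f := fun x => f x ^ r), Real.mul_rpow (by positivity) hZ,
    ← Real.rpow_mul hN.le] at hjensen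
  have hexp : (n : ℝ) ^ (-(d : ℝ)) * ((n : ℝ) ^ (d * (1 - θ)) * (n : ℝ) ^ (d * θ)) = 1 := by
    rw [← Real.rpow_add hN, ← Real.rpow_add hN]
    ring_nf
    exact Real.rpow_zero _
  refine (mul_le_mul_of_nonneg_left (hjensen.trans (mul_le_mul_of_nonneg_right hcard
    (by positivity))) (by positivity)).trans_eq ?_
  linear_combination 5 ^ d * (scaledAvg n (box y σ) fun x => f x ^ r) ^ θ * hexp

theorem scaledAvg_le_scaledEnergy_rpow (ht : 1 ≤ t) (hn : 1 ≤ n) (hσ : σ ≤ 2 * n)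
    (hf : ∀ x, 0 ≤ f x) :
    scaledAvg n (box y σ) f ≤ 5 ^ d * scaledEnergy t n (box y σ) f ^ (1 / t) := by
  have ht0 : 0 < t := by linarith
  have h := scaledAvg_rpow_le (y := y) hn hσ (by positivity) (div_le_one_of_le₀ ht ht0.le)
    (mul_one_div_cancel ht0.ne').symm hf
  simp only [Real.rpow_one] at h
  refine h.trans ?_
  gcongr
  · exact scaledAvg_nonneg fun x => Real.rpow_nonneg (hf x) _
  · exact scaledAvg_rpow_le_scaledEnergy hn hf

theorem exists_scaledEnergy_rpow_one_add_le (d : ℕ) {δ s : ℝ} (hδ : 0 < δ) (ht : 1 ≤ t)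
    (hs : s * (1 / t + δ) = 1) :
    ∃ C : ℝ, 0 < C ∧ ∀ (y : LatticePt d) (n σ : ℕ), 1 ≤ n → σ ≤ 2 * n →
      ∀ f : LatticePt d → ℝ, (∀ x, 0 ≤ f x) →
      (scaledEnergy s n (box y σ) fun x => f x ^ (1 + δ)) ≤
        C * scaledEnergy t n (box y σ) f ^ ((1 + δ) * s / t) := by
  have : 0 < t := by linarith
  have hs0 : 0 < s := pos_of_mul_pos_left (hs ▸ one_pos) (by positivity)
  have hst : 1 - s / t = s * δ := by rw [← hs]; ring
  refine ⟨((1 + δ) ^ s * (2 * d + 1) + 1) * (5 ^ d : ℝ) ^ (s * δ), by positivity, ?_⟩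
  intro y n σ hn hσ f hf
  have hE : 0 ≤ scaledEnergy t n (box y σ) f := scaledEnergy_nonneg hf
  have h := scaledEnergy_rpow_le (S := box y σ) (t := t) (γ := 1 + δ) (θ := s / t) (r := 1) hn
    hs0.le (by linarith) (by positivity) (by nlinarith) (by rw [hst]; ring) (by field_simp) hf
  simp only [Real.rpow_one, hst] at h
  refine h.trans ?_
  have hZ := Real.rpow_le_rpow (scaledAvg_nonneg hf)
    (scaledAvg_le_scaledEnergy_rpow (y := y) ht hn hσ hf) (by positivity : 0 ≤ s * δ)
  rw [Real.mul_rpow (by positivity) (by positivity), ← Real.rpow_mul hE] at hZ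
  have hexp : (1 + δ) * s / t = 1 / t * (s * δ) + s / t := by ring
  rw [hexp, Real.rpow_add_of_nonneg hE (by positivity) (by positivity)]
  refine (mul_le_mul_of_nonneg_right (mul_le_mul_of_nonneg_left hZ (by positivity))
    (by positivity)).trans_eq (by ring)

theorem exists_scaledAvg_rpow_le_scaledEnergy (hd : 2 ≤ d) (ht : 1 ≤ t) (htd : t < d) :
    ∃ C : ℝ, 0 < C ∧ ∀ (y : LatticePt d) (n σ : ℕ), 1 ≤ n → n ≤ σ →
      ∀ f : LatticePt d → ℝ, (∀ x, 0 ≤ f x) →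
      (scaledAvg n (box y σ) fun x => f x ^ (t * d / (d - t))) ≤
        C * scaledEnergy t n (box y σ) f ^ (d / (d - t)) := by
  obtain ⟨C, hC, H⟩ := exists_sum_rpow_le_sobEnergy hd ht htd rfl
  refine ⟨C, hC, fun y n σ hn hnσ f hf => ?_⟩
  have hN : (0 : ℝ) < n := by exact_mod_cast hn
  have hE : 0 ≤ scaledEnergy t n (box y σ) f := scaledEnergy_nonneg hf
  have hnσ' : (n : ℝ) ≤ σ := by exact_mod_cast hnσ
  have h := H (fun i => y i - (σ : ℤ)) (fun i => y i + (σ : ℤ)) n hN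
    (fun j => by push_cast; linarith) f hf
  rw [← box, sobEnergy_eq_rpow_mul_scaledEnergy hn, Real.mul_rpow (by positivity) hE,
    ← Real.rpow_mul hN.le] at h
  have htd0 : (d : ℝ) - t ≠ 0 := by linarith
  have ht0 : t ≠ 0 := by linarith
  have hexp : t * d / (d - t) / t = d / (d - t) := by field_simp
  rw [hexp, mul_div_cancel₀ _ htd0] at h
  have hcancel : (n : ℝ) ^ (-(d : ℝ)) * (n : ℝ) ^ (d : ℝ) = 1 := by
    rw [← Real.rpow_add hN, neg_add_cancel, Real.rpow_zero]
  refine (mul_le_mul_of_nonneg_left h (by positivity)).trans_eq ?_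
  linear_combination C * scaledEnergy t n (box y σ) f ^ (d / (d - t)) * hcancel

theorem exists_scaledAvg_rpow_one_add_le {δ : ℝ} (hd : 2 ≤ d) (ht : 1 ≤ t) (htd : t < d)
    (hδ : 0 < δ) (hδd : (1 + δ) * (d - t) ≤ d) :
    ∃ C : ℝ, 0 < C ∧ ∀ (y : LatticePt d) (n σ : ℕ), 1 ≤ n → n ≤ σ → σ ≤ 2 * n →
      ∀ f : LatticePt d → ℝ, (∀ x, 0 ≤ f x) →
      (scaledAvg n (box y σ) fun x => (f x ^ (1 + δ)) ^ t) ≤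
        C * scaledEnergy t n (box y σ) f ^ (1 + δ) := by
  obtain ⟨C, hC, H⟩ := exists_scaledAvg_rpow_le_scaledEnergy hd ht htd
  have htd0 : 0 < (d : ℝ) - t := by linarith
  have hd0 : (0 : ℝ) < d := by linarith
  set θ : ℝ := (1 + δ) * (d - t) / d with hθ
  have hθ0 : 0 ≤ θ := by positivity
  refine ⟨5 ^ d * C ^ θ, by positivity, fun y n σ hn hnσ hσ f hf => ?_⟩
  have hE : 0 ≤ scaledEnergy t n (box y σ) f := scaledEnergy_nonneg hf
  simp only [← Real.rpow_mul (hf _)]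
  refine (scaledAvg_rpow_le (r := t * d / (d - t)) hn hσ hθ0 (div_le_one_of_le₀ hδd hd0.le)
    (by rw [hθ]; field_simp) hf).trans ?_
  have h := Real.rpow_le_rpow (scaledAvg_nonneg fun x => Real.rpow_nonneg (hf x) _)
    (H y n σ hn hnσ f hf) hθ0
  rw [Real.mul_rpow hC.le (by positivity), ← Real.rpow_mul hE,
    show d / (d - t) * θ = 1 + δ by rw [hθ]; field_simp] at h
  rw [mul_assoc]
  gcongr

end ScaledEnergy

section WeightedEnergy

variable {d : ℕ}

/-- Bounds on the weight `ω` and on `ω⁻¹` over the box of radius `2 n`: with `P = 1/p` and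
`Q = 1/q`, the constants `A` and `B` play the role of the averaged norms of `ω` in `L^p` and of
`ω⁻¹` in `L^q`, and `a`, `b` that of the normalized powers `(ω / A) ^ p` and `(ω⁻¹ / B) ^ q`, which
makes sense also for `p = ∞` or `q = ∞`. -/
structure WeightBound (P Q A B : ℝ) (y : LatticePt d) (n : ℕ) (ω a b : Bond d → ℝ) : Prop where
  one_le : 1 ≤ n
  pos : ∀ e, 0 < ω e
  a_nonneg : ∀ e, 0 ≤ a e
  b_nonneg : ∀ e, 0 ≤ b e
  A_pos : 0 < A
  B_pos : 0 < B
  one_le_mul : 1 ≤ A * B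
  le_upper : ∀ e ∈ bondsIn (box y (2 * n)), ω e ≤ A * a e ^ P
  inv_le : ∀ e ∈ bondsIn (box y (2 * n)), (ω e)⁻¹ ≤ B * b e ^ Q
  sum_a : ∑ e ∈ bondsIn (box y (2 * n)), a e ≤ d * 5 ^ d * (n : ℝ) ^ (d : ℝ)
  sum_b : ∑ e ∈ bondsIn (box y (2 * n)), b e ≤ d * 5 ^ d * (n : ℝ) ^ (d : ℝ)

variable {P Q A B t : ℝ} {y : LatticePt d} {n : ℕ} {ω a b : Bond d → ℝ}

theorem WeightBound.sum_a_le (h : WeightBound P Q A B y n ω a b) {σ : ℕ} (hσ : σ ≤ 2 * n) :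
    ∑ e ∈ bondsIn (box y σ), a e ≤ d * 5 ^ d * (n : ℝ) ^ (d : ℝ) :=
  (Finset.sum_le_sum_of_subset_of_nonneg (bondsIn_mono (box_mono hσ y))
    fun e _ _ => h.a_nonneg e).trans h.sum_a

theorem WeightBound.sum_b_le (h : WeightBound P Q A B y n ω a b) {σ : ℕ} (hσ : σ ≤ 2 * n) :
    ∑ e ∈ bondsIn (box y σ), b e ≤ d * 5 ^ d * (n : ℝ) ^ (d : ℝ) :=
  (Finset.sum_le_sum_of_subset_of_nonneg (bondsIn_mono (box_mono hσ y))
    fun e _ _ => h.b_nonneg e).trans h.sum_b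

theorem abs_rpow_le_of_inv_le {ω b g : ℝ} (hω : 0 < ω) (hb : 0 ≤ b) (hB : 0 ≤ B) (ht : 0 ≤ t)
    (h : ω⁻¹ ≤ B * b ^ Q) :
    |g| ^ t ≤ B ^ (t / 2) * (b ^ (Q * (t / 2)) * (ω * g ^ 2) ^ (t / 2)) := by
  have hg : |g| ^ t = ω⁻¹ ^ (t / 2) * (ω * g ^ 2) ^ (t / 2) := by
    rw [← Real.mul_rpow (by positivity) (by positivity), inv_mul_cancel_left₀ hω.ne', ← sq_abs,
      ← Real.rpow_natCast, ← Real.rpow_mul (abs_nonneg _), Nat.cast_two,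
      mul_div_cancel₀ t two_ne_zero]
  rw [hg, ← mul_assoc, Real.rpow_mul hb, ← Real.mul_rpow hB (by positivity)]
  gcongr

theorem sum_abs_grad_rpow_le {S : Finset (LatticePt d)} (hQ : 0 ≤ Q) (ht : 0 ≤ t)
    (hQt : Q * (t / 2) + t / 2 = 1) (hB : 0 ≤ B) (hω : ∀ e, 0 < ω e) (hb : ∀ e, 0 ≤ b e)
    (hωB : ∀ e ∈ bondsIn S, (ω e)⁻¹ ≤ B * b e ^ Q) (V : LatticePt d → ℝ) :
    ∑ e ∈ bondsIn S, |grad V e| ^ t ≤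
      B ^ (t / 2) * ((∑ e ∈ bondsIn S, b e) ^ (Q * (t / 2)) * bondEnergy ω S V ^ (t / 2)) := by
  refine (Finset.sum_le_sum fun e he =>
    abs_rpow_le_of_inv_le (hω e) (hb e) hB ht (hωB e he)).trans ?_
  rw [← Finset.mul_sum]
  gcongr
  exact sum_rpow_mul_rpow_le _ (fun e _ => hb e) (fun e _ => mul_nonneg (hω e).le (sq_nonneg _))
    (by positivity) (by positivity) hQt

theorem WeightBound.sum_abs_grad_rpow_le (h : WeightBound P Q A B y n ω a b) (hQ : 0 ≤ Q)
    (ht : 0 ≤ t) (hQt : Q * (t / 2) + t / 2 = 1) {ρ : ℕ} (hρ : ρ ≤ 2 * n) (V : LatticePt d → ℝ) :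
    (n : ℝ) ^ (t - d) * ∑ e ∈ bondsIn (box y ρ), |grad V e| ^ t ≤
      (d * 5 ^ d : ℝ) ^ (Q * (t / 2)) *
        (B * ((n : ℝ) ^ (2 - (d : ℝ)) * bondEnergy ω (box y ρ) V)) ^ (t / 2) := by
  have hN : (0 : ℝ) < n := by exact_mod_cast h.one_le
  have hB := h.B_pos.le
  have hE : 0 ≤ bondEnergy ω (box y ρ) V := bondEnergy_nonneg (fun e => (h.pos e).le) _ _
  have hholder := _root_.sum_abs_grad_rpow_le hQ ht hQt hB h.pos h.b_nonneg
    (fun e he => h.inv_le e (bondsIn_mono (box_mono hρ y) he)) V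
  have hsum := Real.rpow_le_rpow (Finset.sum_nonneg fun e _ => h.b_nonneg e) (h.sum_b_le hρ)
    (by positivity : 0 ≤ Q * (t / 2))
  rw [Real.mul_rpow (by positivity) (by positivity), ← Real.rpow_mul hN.le] at hsum
  have hexp : (n : ℝ) ^ (t - d) * (n : ℝ) ^ (d * (Q * (t / 2))) =
      (n : ℝ) ^ ((2 - d) * (t / 2)) := by
    rw [← Real.rpow_add hN, eq_sub_of_add_eq hQt]
    ring_nf
  rw [Real.mul_rpow hB (by positivity), Real.mul_rpow (by positivity) hE, ← Real.rpow_mul hN.le,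
    ← hexp]
  refine (mul_le_mul_of_nonneg_left (hholder.trans (mul_le_mul_of_nonneg_left
    (mul_le_mul_of_nonneg_right hsum (by positivity)) (by positivity))) (by positivity)).trans_eq ?_
  ring

theorem WeightBound.scaledEnergy_le_of_bondEnergy_le (h : WeightBound P Q A B y n ω a b)
    (hQ : 0 ≤ Q) (ht : 0 < t) (hQt : Q * (t / 2) + t / 2 = 1) {ρ : ℕ} (hρ : ρ ≤ 2 * n)
    {V : LatticePt d → ℝ} (hV : ∀ x, 0 ≤ V x) {C₁ C₂ R k Y : ℝ} (hC₁ : 0 ≤ C₁) (hC₂ : 0 ≤ C₂)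
    (hR : 1 ≤ R) (hk : 0 ≤ k) (hY : 0 ≤ Y)
    (hE : (n : ℝ) ^ (2 - (d : ℝ)) * bondEnergy ω (box y ρ) V ≤ C₁ * (A * R ^ k * Y ^ (2 / t)))
    (hZ : (scaledAvg n (box y ρ) fun x => V x ^ t) ≤ C₂ * Y) :
    scaledEnergy t n (box y ρ) V ≤ ((d * 5 ^ d : ℝ) ^ (Q * (t / 2)) * C₁ ^ (t / 2) + C₂) *
      ((A * B) ^ (t / 2) * R ^ (k * (t / 2)) * Y) := by
  have hA := h.A_pos
  have hB := h.B_pos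
  have hR0 : 0 < R := by linarith
  have hEB : (B * ((n : ℝ) ^ (2 - (d : ℝ)) * bondEnergy ω (box y ρ) V)) ^ (t / 2) ≤
      C₁ ^ (t / 2) * ((A * B) ^ (t / 2) * R ^ (k * (t / 2)) * Y) := by
    have := bondEnergy_nonneg (fun e => (h.pos e).le) (box y ρ) V
    calc _ ≤ (C₁ * (A * B * R ^ k * Y ^ (2 / t))) ^ (t / 2) :=
          Real.rpow_le_rpow (by positivity)
            ((mul_le_mul_of_nonneg_left hE hB.le).trans_eq (by ring)) (by positivity)
      _ = _ := by
          rw [Real.mul_rpow hC₁ (by positivity), Real.mul_rpow (by positivity) (by positivity),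
            Real.mul_rpow (by positivity) (by positivity), ← Real.rpow_mul hR0.le,
            ← Real.rpow_mul hY, div_mul_div_cancel₀ ht.ne', div_self two_ne_zero, Real.rpow_one]
  have hone : 1 ≤ (A * B) ^ (t / 2) * R ^ (k * (t / 2)) := one_le_mul_of_one_le_of_one_le
    (Real.one_le_rpow h.one_le_mul (by positivity)) (Real.one_le_rpow hR (by positivity))
  rw [scaledEnergy_eq h.one_le hV, add_mul, mul_assoc (_ ^ _) (C₁ ^ _)]
  refine add_le_add ((h.sum_abs_grad_rpow_le hQ ht.le hQt hρ V).trans (by gcongr)) (hZ.trans ?_)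
  gcongr
  exact le_mul_of_one_le_left hY hone

end WeightedEnergy

section IterationStep

theorem one_le_div_sub {n ρ σ : ℕ} (hnρ : n ≤ ρ) (hρσ : ρ < σ) (hσ : σ ≤ 2 * n) :
    1 ≤ (n : ℝ) / (σ - ρ) := by
  rw [one_le_div (sub_pos.2 (by exact_mod_cast hρσ)), sub_le_iff_le_add]
  exact_mod_cast (by omega : σ ≤ n + ρ)

/-- The exponents of the iteration, with `P = 1/p` and `Q = 1/q`: the weight lets one control
gradients in `L^t`, and the Sobolev inequality on the `(d - 1)`-dimensional hyperplanes maps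
gradients in `L^s` to the exponent `2 p'`. -/
structure IterExponents (d : ℕ) (P Q δ t s : ℝ) : Prop where
  three_le : 3 ≤ d
  P_nonneg : 0 ≤ P
  Q_nonneg : 0 ≤ Q
  δ_pos : 0 < δ
  δ_eq : δ = 1 / ((d : ℝ) - 1) - P / 2 - Q / 2
  t_eq : t = 2 / (1 + Q)
  s_eq : s = 2 / (1 + Q + 2 * δ)

namespace IterExponents

variable {d : ℕ} {P Q δ t s : ℝ}

theorem three_le_cast (h : IterExponents d P Q δ t s) : (3 : ℝ) ≤ d := by exact_mod_cast h.three_le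

theorem add_lt_one (h : IterExponents d P Q δ t s) : P + Q < 1 := by
  have h2 : 1 / ((d : ℝ) - 1) ≤ 1 / 2 :=
    one_div_le_one_div_of_le (by norm_num) (by linarith [h.three_le_cast])
  linarith [h.δ_pos, h.δ_eq]

theorem P_lt_one (h : IterExponents d P Q δ t s) : P < 1 := by
  linarith [h.add_lt_one, h.Q_nonneg]

theorem one_le_t (h : IterExponents d P Q δ t s) : 1 ≤ t := by
  have := h.Q_nonneg
  rw [h.t_eq, le_div_iff₀ (by linarith)]
  linarith [h.add_lt_one, h.P_nonneg]

theorem t_pos (h : IterExponents d P Q δ t s) : 0 < t :=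
  one_pos.trans_le h.one_le_t

theorem t_le_two (h : IterExponents d P Q δ t s) : t ≤ 2 := by
  have := h.Q_nonneg
  rw [h.t_eq, div_le_iff₀ (by linarith)]
  linarith

theorem mul_half_t_add (h : IterExponents d P Q δ t s) : Q * (t / 2) + t / 2 = 1 := by
  have := h.Q_nonneg
  rw [h.t_eq]
  field_simp
  ring

theorem s_pos (h : IterExponents d P Q δ t s) : 0 < s := by
  have := h.Q_nonneg
  have := h.δ_pos
  rw [h.s_eq]
  positivity

theorem two_div_s (h : IterExponents d P Q δ t s) : 2 / s = 1 - P + 2 / ((d : ℝ) - 1) := by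
  have := h.Q_nonneg
  have := h.δ_pos
  rw [h.s_eq, div_div_cancel₀ two_ne_zero]
  linear_combination 2 * h.δ_eq

theorem s_mul (h : IterExponents d P Q δ t s) : s * (1 / t + δ) = 1 := by
  have := h.Q_nonneg
  have := h.δ_pos
  rw [h.t_eq, h.s_eq]
  field_simp

theorem one_le_s (h : IterExponents d P Q δ t s) : 1 ≤ s := by
  have h2 : 2 / ((d : ℝ) - 1) ≤ 2 / 2 :=
    div_le_div_of_nonneg_left (by norm_num) (by norm_num) (by linarith [h.three_le_cast])
  have h1 : 2 / s ≤ 2 := by linarith [h.two_div_s, h.P_nonneg]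
  rw [div_le_iff₀ h.s_pos] at h1
  linarith

theorem s_lt (h : IterExponents d P Q δ t s) : s < (d : ℝ) - 1 := by
  have h1 : 2 / ((d : ℝ) - 1) < 2 / s := by linarith [h.two_div_s, h.P_lt_one]
  exact (div_lt_div_iff_of_pos_left two_pos (by linarith [h.three_le_cast]) h.s_pos).1 h1

theorem conj_exponent (h : IterExponents d P Q δ t s) :
    2 / (1 - P) = s * ((d : ℝ) - 1) / ((d : ℝ) - 1 - s) := by
  have hd := h.three_le_cast
  have hs := h.s_pos.ne'
  have hd1 : (d : ℝ) - 1 ≠ 0 := by linarith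
  have hds : (d : ℝ) - 1 - s ≠ 0 := by linarith [h.s_lt]
  have h7 : 1 - P = 2 * ((d : ℝ) - 1 - s) / (s * ((d : ℝ) - 1)) := by
    rw [eq_sub_of_add_eq h.two_div_s.symm]
    field_simp
  rw [h7]
  field_simp

theorem one_add_mul_le (h : IterExponents d P Q δ t s) : (1 + δ) * ((d : ℝ) - t) ≤ d := by
  have hd : 0 < (d : ℝ) - 1 := by linarith [h.three_le_cast]
  have hδ : δ ≤ 1 / ((d : ℝ) - 1) := by linarith [h.δ_eq, h.P_nonneg, h.Q_nonneg]
  rw [le_div_iff₀ hd] at hδ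
  nlinarith [h.one_le_t, h.δ_pos]

theorem rpow_mul_caccioppoli_eq (h : IterExponents d P Q δ t s) {N L E : ℝ} (hN : 0 < N)
    (hL : 0 < L) (hE : 0 ≤ E) :
    N ^ (2 - (d : ℝ)) * ((N ^ (d : ℝ) / L) ^ P * (N ^ (d - s) * E / L) ^ (2 / s) / L) =
      (N / L) ^ (2 + 2 / ((d : ℝ) - 1)) * E ^ (2 / s) := by
  have hd : (d : ℝ) - 1 ≠ 0 := by linarith [h.three_le_cast]
  have hs := h.s_pos.ne'
  have hRexp : 2 + 2 / ((d : ℝ) - 1) = P + 2 / s + 1 := by rw [h.two_div_s]; ring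
  have hNexp : 2 - (d : ℝ) + d * P + (d - s) * (2 / s) = P + 2 / s + 1 := by
    have : (d - s) * (2 / s) = d * (2 / s) - 2 := by field_simp
    rw [this, h.two_div_s]
    field_simp
    ring
  calc _ = N ^ (2 - (d : ℝ)) * N ^ (d * P) * N ^ ((d - s) * (2 / s)) / (L ^ P * L ^ (2 / s) * L) *
        E ^ (2 / s) := by
        rw [Real.div_rpow (by positivity) hL.le, Real.div_rpow (by positivity) hL.le,
          Real.mul_rpow (by positivity) hE, ← Real.rpow_mul hN.le, ← Real.rpow_mul hN.le]
        field_simp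
    _ = _ := by
        rw [← Real.rpow_add hN, ← Real.rpow_add hN, ← Real.rpow_add hL, ← Real.rpow_add_one hL.ne',
          hNexp, hRexp, Real.div_rpow hN.le hL.le]

theorem exists_scaled_bondEnergy_rpow_le (h : IterExponents d P Q δ t s) :
    ∃ C : ℝ, 0 < C ∧ ∀ {A B : ℝ} {y : LatticePt d} {n : ℕ} {ω a b : Bond d → ℝ},
      WeightBound P Q A B y n ω a b → ∀ w, IsNonnegSubsolution ω w → ∀ α : ℝ, 1 ≤ α →
      ∀ ρ σ : ℕ, n ≤ ρ → ρ < σ → σ ≤ 2 * n →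
      (n : ℝ) ^ (2 - (d : ℝ)) * bondEnergy ω (box y ρ) (fun x => w x ^ α) ≤
        C * (A * ((n : ℝ) / (σ - ρ)) ^ (2 + 2 / ((d : ℝ) - 1)) *
          scaledEnergy s n (box y σ) (fun x => w x ^ α) ^ (2 / s)) := by
  obtain ⟨C, hC, H⟩ := exists_bondEnergy_rpow_le h.three_le h.P_nonneg h.P_lt_one h.one_le_s h.s_lt
    h.conj_exponent
  refine ⟨C * (d * 5 ^ d : ℝ) ^ P, mul_pos hC (Real.rpow_pos_of_pos
    (mul_pos (by linarith [h.three_le_cast]) (by positivity)) _), ?_⟩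
  intro A B y n ω a b hW w hw α hα ρ σ hnρ hρσ hσ
  have hN : (0 : ℝ) < n := by exact_mod_cast hW.one_le
  have hA := hW.A_pos.le
  have hP := h.P_nonneg
  have := h.s_pos
  have hv : ∀ x, 0 ≤ w x ^ α := fun x => Real.rpow_nonneg (hw.nonneg x) _
  have hE : 0 ≤ scaledEnergy s n (box y σ) (fun x => w x ^ α) := scaledEnergy_nonneg hv
  have hL : 0 < (σ : ℝ) - ρ := sub_pos.2 (by exact_mod_cast hρσ)
  have hnσ : (n : ℝ) ≤ 2 * σ + 1 := by exact_mod_cast (by omega : n ≤ 2 * σ + 1)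
  have hcacc := H ω a (fun e => (hW.pos e).le) hW.a_nonneg w hw α hα y ρ σ hρσ n A hN hnσ hA
    fun e he => hW.le_upper e (bondsIn_mono (box_mono hσ y) he)
  rw [sobEnergy_eq_rpow_mul_scaledEnergy hW.one_le] at hcacc
  generalize scaledEnergy s n (box y σ) (fun x => w x ^ α) = E at hE hcacc ⊢
  generalize (σ : ℝ) - ρ = L at hL hcacc ⊢
  have hsum : ((∑ e ∈ bondsIn (box y σ), a e) / L) ^ P ≤
      (d * 5 ^ d : ℝ) ^ P * ((n : ℝ) ^ (d : ℝ) / L) ^ P := by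
    rw [← Real.mul_rpow (by positivity) (by positivity), ← mul_div_assoc]
    have := Finset.sum_nonneg fun e (_ : e ∈ bondsIn (box y σ)) => hW.a_nonneg e
    gcongr
    exact hW.sum_a_le hσ
  calc _ ≤ (n : ℝ) ^ (2 - (d : ℝ)) * (C * (A * ((d * 5 ^ d : ℝ) ^ P * ((n : ℝ) ^ (d : ℝ) / L) ^ P) *
        ((n : ℝ) ^ (d - s) * E / L) ^ (2 / s) / L)) := by
        refine mul_le_mul_of_nonneg_left (hcacc.trans ?_) (by positivity)
        gcongr
    _ = C * (d * 5 ^ d : ℝ) ^ P * (A * ((n : ℝ) ^ (2 - (d : ℝ)) * (((n : ℝ) ^ (d : ℝ) / L) ^ P *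
        ((n : ℝ) ^ (d - s) * E / L) ^ (2 / s) / L))) := by ring
    _ = _ := by rw [h.rpow_mul_caccioppoli_eq hN hL hE]; ring

theorem exists_scaled_bondEnergy_rpow_one_add_le (h : IterExponents d P Q δ t s) :
    ∃ C : ℝ, 0 < C ∧ ∀ {A B : ℝ} {y : LatticePt d} {n : ℕ} {ω a b : Bond d → ℝ},
      WeightBound P Q A B y n ω a b → ∀ w, IsNonnegSubsolution ω w → ∀ α : ℝ, 1 ≤ α →
      ∀ ρ σ : ℕ, n ≤ ρ → ρ < σ → σ ≤ 2 * n →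
      (n : ℝ) ^ (2 - (d : ℝ)) * bondEnergy ω (box y ρ) (fun x => (w x ^ α) ^ (1 + δ)) ≤
        C * (A * ((n : ℝ) / (σ - ρ)) ^ (2 + 2 / ((d : ℝ) - 1)) *
          (scaledEnergy t n (box y σ) (fun x => w x ^ α) ^ (1 + δ)) ^ (2 / t)) := by
  have hδ := h.δ_pos
  have hs := h.s_pos
  obtain ⟨C₁, hC₁, H₁⟩ := h.exists_scaled_bondEnergy_rpow_le
  obtain ⟨C₂, hC₂, H₂⟩ := exists_scaledEnergy_rpow_one_add_le d hδ h.one_le_t h.s_mul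
  refine ⟨C₁ * C₂ ^ (2 / s), by positivity, ?_⟩
  intro A B y n ω a b hW w hw α hα ρ σ hnρ hρσ hσ
  have hv : ∀ x, 0 ≤ w x ^ α := fun x => Real.rpow_nonneg (hw.nonneg x) _
  have hE : 0 ≤ scaledEnergy t n (box y σ) (fun x => w x ^ α) := scaledEnergy_nonneg hv
  have hA := hW.A_pos
  have hR := one_pos.trans_le (one_le_div_sub hnρ hρσ hσ)
  have hcacc := H₁ hW w hw (α * (1 + δ)) (by nlinarith) ρ σ hnρ hρσ hσ
  simp only [Real.rpow_mul (hw.nonneg _) α] at hcacc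
  have hgain := Real.rpow_le_rpow (scaledEnergy_nonneg fun x => Real.rpow_nonneg (hv x) _)
    (H₂ y n σ hW.one_le hσ _ hv) (by positivity : 0 ≤ 2 / s)
  rw [Real.mul_rpow hC₂.le (by positivity), ← Real.rpow_mul hE,
    show (1 + δ) * s / t * (2 / s) = (1 + δ) * (2 / t) by field_simp] at hgain
  rw [← Real.rpow_mul hE]
  refine (hcacc.trans (mul_le_mul_of_nonneg_left (mul_le_mul_of_nonneg_left hgain
    (by positivity)) hC₁.le)).trans_eq (by ring)

theorem exists_scaledEnergy_step (h : IterExponents d P Q δ t s) :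
    ∃ C : ℝ, 0 < C ∧ ∀ {A B : ℝ} {y : LatticePt d} {n : ℕ} {ω a b : Bond d → ℝ},
      WeightBound P Q A B y n ω a b → ∀ w, IsNonnegSubsolution ω w → ∀ α : ℝ, 1 ≤ α →
      ∀ ρ σ : ℕ, n ≤ ρ → ρ < σ → σ ≤ 2 * n →
      (scaledEnergy t n (box y ρ) fun x => (w x ^ α) ^ (1 + δ)) ≤
        C * ((A * B) ^ (t / 2) * ((n : ℝ) / (σ - ρ)) ^ ((2 + 2 / ((d : ℝ) - 1)) * (t / 2)) *
          scaledEnergy t n (box y σ) (fun x => w x ^ α) ^ (1 + δ)) := by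
  have hd := h.three_le_cast
  have hd1 : 0 ≤ (d : ℝ) - 1 := by linarith
  obtain ⟨C₁, hC₁, H₁⟩ := h.exists_scaled_bondEnergy_rpow_one_add_le
  obtain ⟨C₂, hC₂, H₂⟩ := exists_scaledAvg_rpow_one_add_le (by linarith [h.three_le]) h.one_le_t
    (by linarith [h.t_le_two]) h.δ_pos h.one_add_mul_le
  refine ⟨(d * 5 ^ d : ℝ) ^ (Q * (t / 2)) * C₁ ^ (t / 2) + C₂, by positivity, ?_⟩
  intro A B y n ω a b hW w hw α hα ρ σ hnρ hρσ hσ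
  have hv : ∀ x, 0 ≤ w x ^ α := fun x => Real.rpow_nonneg (hw.nonneg x) _
  have hv' : ∀ x, 0 ≤ (w x ^ α) ^ (1 + δ) := fun x => Real.rpow_nonneg (hv x) _
  exact hW.scaledEnergy_le_of_bondEnergy_le h.Q_nonneg h.t_pos h.mul_half_t_add (hρσ.le.trans hσ)
    hv' hC₁.le hC₂.le (one_le_div_sub hnρ hρσ hσ) (by positivity)
    (Real.rpow_nonneg (scaledEnergy_nonneg hv) _) (H₁ hW w hw α hα ρ σ hnρ hρσ hσ)
    ((scaledAvg_mono (box_mono hρσ.le y) fun x => Real.rpow_nonneg (hv' x) _).trans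
      (H₂ y n σ hW.one_le (hnρ.trans hρσ.le) hσ _ hv))

theorem scaled_bondEnergy_le (h : IterExponents d P Q δ t s) {A B : ℝ} {y : LatticePt d} {n : ℕ}
    {ω a b : Bond d → ℝ} (hW : WeightBound P Q A B y n ω a b) {w : LatticePt d → ℝ}
    (hw : IsNonnegSubsolution ω w) {ρ σ : ℕ} (hρσ : ρ < σ) (hσ : σ ≤ 2 * n) :
    (n : ℝ) ^ (2 - (d : ℝ)) * bondEnergy ω (box y ρ) w ≤
      48 * d * (d * 5 ^ d : ℝ) ^ P * (A * ((n : ℝ) / (σ - ρ)) ^ (2 : ℝ) *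
        (scaledAvg n (box y σ) fun x => w x ^ (2 / (1 - P))) ^ (1 - P)) := by
  have hN : (0 : ℝ) < n := by exact_mod_cast hW.one_le
  have hP := h.P_nonneg
  have hA := hW.A_pos
  have hZ : 0 ≤ scaledAvg n (box y σ) fun x => w x ^ (2 / (1 - P)) :=
    scaledAvg_nonneg fun x => Real.rpow_nonneg (hw.nonneg x) _
  have hcacc := bondEnergy_le_of_sum_rpow hP h.P_lt_one (fun e => (hW.pos e).le) hW.a_nonneg hw hρσ
    hA.le fun e he => hW.le_upper e (bondsIn_mono (box_mono hσ y) he)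
  rw [sum_eq_rpow_mul_scaledAvg hW.one_le (S := box y σ), Real.mul_rpow (by positivity) hZ] at hcacc
  have hsum := Real.rpow_le_rpow (Finset.sum_nonneg fun e _ => hW.a_nonneg e) (hW.sum_a_le hσ) hP
  rw [Real.mul_rpow (by positivity) (by positivity)] at hsum
  have hvol : ((n : ℝ) ^ (d : ℝ)) ^ P * ((n : ℝ) ^ (d : ℝ)) ^ (1 - P) * (n : ℝ) ^ (2 - (d : ℝ)) =
      (n : ℝ) ^ 2 := by
    rw [← Real.rpow_add (by positivity), add_sub_cancel, Real.rpow_one, ← Real.rpow_add hN,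
      add_sub_cancel, Real.rpow_two]
  refine (mul_le_mul_of_nonneg_left (hcacc.trans (mul_le_mul_of_nonneg_left
    (div_le_div_of_nonneg_right (mul_le_mul_of_nonneg_left (mul_le_mul_of_nonneg_right hsum
    (by positivity)) hA.le) (by positivity)) (by positivity))) (by positivity)).trans_eq ?_
  rw [Real.rpow_two, div_pow, ← hvol]
  ring

theorem exists_scaledEnergy_start (h : IterExponents d P Q δ t s) :
    ∃ C : ℝ, 0 < C ∧ ∀ {A B : ℝ} {y : LatticePt d} {n : ℕ} {ω a b : Bond d → ℝ},
      WeightBound P Q A B y n ω a b → ∀ w, IsNonnegSubsolution ω w →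
      ∀ ρ σ : ℕ, n ≤ ρ → ρ < σ → σ ≤ 2 * n →
      scaledEnergy t n (box y ρ) w ≤
        C * ((A * B) ^ (t / 2) * ((n : ℝ) / (σ - ρ)) ^ (2 * (t / 2)) *
          (scaledAvg n (box y σ) fun x => w x ^ (2 / (1 - P))) ^ ((1 - P) * (t / 2))) := by
  have ht := h.t_pos
  have hP : 0 < 1 - P := sub_pos.2 h.P_lt_one
  refine ⟨(d * 5 ^ d : ℝ) ^ (Q * (t / 2)) * (48 * d * (d * 5 ^ d : ℝ) ^ P) ^ (t / 2) + 5 ^ d,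
    by positivity, ?_⟩
  intro A B y n ω a b hW w hw ρ σ hnρ hρσ hσ
  have hZ : 0 ≤ scaledAvg n (box y σ) fun x => w x ^ (2 / (1 - P)) :=
    scaledAvg_nonneg fun x => Real.rpow_nonneg (hw.nonneg x) _
  refine hW.scaledEnergy_le_of_bondEnergy_le h.Q_nonneg ht h.mul_half_t_add (hρσ.le.trans hσ)
    hw.nonneg (by positivity) (by positivity) (one_le_div_sub hnρ hρσ hσ) zero_le_two
    (by positivity) ?_ ?_
  · rw [← Real.rpow_mul hZ, mul_assoc (1 - P), div_mul_div_cancel₀ two_ne_zero, div_self ht.ne',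
      mul_one]
    exact h.scaled_bondEnergy_le hW hw hρσ hσ
  · refine (scaledAvg_mono (box_mono hρσ.le y) fun x => Real.rpow_nonneg (hw.nonneg x) _).trans
      (scaledAvg_rpow_le hW.one_le hσ (by positivity) ?_ (by field_simp) hw.nonneg)
    nlinarith [h.P_nonneg, h.t_le_two]

end IterExponents

end IterationStep

section Iteration

theorem iterate_superlinear {E : ℕ → ℝ} {D b δ : ℝ} (hE : ∀ k, 0 ≤ E k) (hD : 0 < D) (hb : 0 < b)
    (hδ : 0 < δ) {K : ℕ} (step : ∀ k < K, E (k + 1) ≤ D * b ^ (k : ℝ) * E k ^ (1 + δ)) :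
    ∀ k ≤ K, D ^ (1 / δ) * b ^ (k / δ + 1 / δ ^ 2) * E k ≤
      (D ^ (1 / δ) * b ^ (1 / δ ^ 2) * E 0) ^ ((1 + δ) ^ k) := by
  intro k
  induction k with
  | zero => simp
  | succ k ih =>
    intro hk
    have hE0 : 0 ≤ D ^ (1 / δ) * b ^ (1 / δ ^ 2) * E 0 := mul_nonneg (by positivity) (hE 0)
    have ih' := Real.rpow_le_rpow (mul_nonneg (by positivity) (hE k)) (ih (by omega))
      (by linarith : 0 ≤ 1 + δ)
    rw [← Real.rpow_mul hE0, ← pow_succ, Real.mul_rpow (by positivity) (hE k),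
      Real.mul_rpow (by positivity) (by positivity), ← Real.rpow_mul hD.le,
      ← Real.rpow_mul hb.le] at ih'
    have hDpow : D ^ (1 / δ * (1 + δ)) = D ^ (1 / δ) * D := by
      rw [← Real.rpow_add_one hD.ne', mul_add, mul_one, one_div_mul_cancel hδ.ne']
    have hbpow : b ^ ((k / δ + 1 / δ ^ 2) * (1 + δ)) =
        b ^ (((k + 1 : ℕ) : ℝ) / δ + 1 / δ ^ 2) * b ^ (k : ℝ) := by
      rw [← Real.rpow_add hb]
      congr 1
      push_cast
      field_simp
      ring
    rw [hDpow, hbpow] at ih'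
    refine ((mul_le_mul_of_nonneg_left (step k (by omega)) (by positivity)).trans_eq ?_).trans ih'
    ring

theorem le_of_iterate_superlinear {E : ℕ → ℝ} {D b δ G Y : ℝ} (hE : ∀ k, 0 ≤ E k) (hD : 1 ≤ D)
    (hb : 1 ≤ b) (hδ : 0 < δ) (hG : 1 ≤ G) (hY : 0 ≤ Y) {K : ℕ}
    (step : ∀ k < K, E (k + 1) ≤ D * b ^ (k : ℝ) * E k ^ (1 + δ))
    (hlast : Y ^ ((1 + δ) ^ K) ≤ G * b ^ (K / δ) * E K) :
    Y ≤ G * (D ^ (1 / δ) * b ^ (1 / δ ^ 2) * E 0) := by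
  have hE0 : 0 ≤ D ^ (1 / δ) * b ^ (1 / δ ^ 2) * E 0 := mul_nonneg (by positivity) (hE 0)
  have hχ : 1 ≤ (1 + δ) ^ K := one_le_pow₀ (by linarith)
  have hEK := hE K
  have hcoef : b ^ (K / δ) ≤ D ^ (1 / δ) * b ^ (K / δ + 1 / δ ^ 2) := by
    rw [← one_mul (b ^ (K / δ))]
    refine mul_le_mul (Real.one_le_rpow hD (by positivity))
      (Real.rpow_le_rpow_of_exponent_le hb ?_) (by positivity) (by positivity)
    exact le_add_of_nonneg_right (by positivity)
  refine (Real.rpow_le_rpow_iff hY (by positivity) (by positivity : 0 < (1 + δ) ^ K)).1 ?_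
  calc Y ^ ((1 + δ) ^ K) ≤ G * (b ^ (K / δ) * E K) := by rwa [← mul_assoc]
    _ ≤ G * (D ^ (1 / δ) * b ^ (K / δ + 1 / δ ^ 2) * E K) := by gcongr
    _ ≤ G ^ ((1 + δ) ^ K) * (D ^ (1 / δ) * b ^ (1 / δ ^ 2) * E 0) ^ ((1 + δ) ^ K) :=
        mul_le_mul (Real.self_le_rpow_of_one_le hG hχ)
          (iterate_superlinear hE (by linarith) (by linarith) hδ step K le_rfl)
          (by positivity) (by positivity)
    _ = _ := (Real.mul_rpow (by positivity) hE0).symm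

theorem div_two_pow_succ_lt {L j : ℕ} (h : 2 ^ j ≤ L) : L / 2 ^ (j + 1) < L / 2 ^ j := by
  rw [pow_succ, ← Nat.div_div_eq_div_mul]
  exact Nat.div_lt_self (Nat.div_pos h (by positivity)) one_lt_two

theorem div_dyadic_gap_le {N : ℝ} (hN : 0 ≤ N) (ρ : ℕ) {L j : ℕ} (h : 2 ^ j ≤ L) :
    N / (((ρ + L / 2 ^ j : ℕ) : ℝ) - ((ρ + L / 2 ^ (j + 1) : ℕ) : ℝ)) ≤ 4 * 2 ^ j * (N / L) := by
  have hL : (0 : ℝ) < L := by exact_mod_cast (by positivity : 0 < 2 ^ j).trans_le h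
  have hhalf : ((L / 2 ^ (j + 1) : ℕ) : ℝ) ≤ ((L / 2 ^ j : ℕ) : ℝ) / 2 := by
    rw [pow_succ, ← Nat.div_div_eq_div_mul]
    exact_mod_cast Nat.cast_div_le (α := ℝ)
  have hquot : (L : ℝ) ≤ 2 ^ j * (2 * ((L / 2 ^ j : ℕ) : ℝ)) := by
    have hlt := Nat.lt_mul_div_succ L (by positivity : 0 < 2 ^ j)
    have hone : 1 ≤ L / 2 ^ j := Nat.div_pos h (by positivity)
    exact_mod_cast hlt.le.trans (Nat.mul_le_mul_left (2 ^ j) (by omega))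
  have hgap : L / (4 * 2 ^ j) ≤
      ((ρ + L / 2 ^ j : ℕ) : ℝ) - ((ρ + L / 2 ^ (j + 1) : ℕ) : ℝ) := by
    rw [div_le_iff₀ (by positivity), Nat.cast_add, Nat.cast_add]
    nlinarith [(by positivity : (0 : ℝ) < 2 ^ j)]
  exact (div_le_div_of_nonneg_left hN (by positivity) hgap).trans_eq (by field_simp)

theorem le_of_le_mul_rpow_one_sub {M K T l : ℝ} (hM : 0 ≤ M) (hK : 0 ≤ K) (hT : 0 ≤ T) (hl : 0 < l)
    (h : M ≤ K * (T ^ l * M ^ (1 - l))) : M ≤ K ^ (1 / l) * T := by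
  have := le_rpow_mul_rpow_of_le_mul_rpow (r := 1 / l) (s := 1 / l) hM hK hT one_pos
    (by positivity) (by ring) (by rwa [one_div_one_div, Real.rpow_one, mul_assoc, mul_comm (M ^ _)])
  rwa [div_self (by positivity), Real.rpow_one] at this

theorem mul_rpow_le_of_half_gap {N S M D κ l x z g : ℝ} {k : ℕ} (hN : 0 ≤ N) (hS : 0 ≤ S)
    (hM : 0 ≤ M) (hD : 0 ≤ D) (hκ : 0 ≤ κ) (hl : 0 < l) (hl1 : l ≤ 1) (hz : 0 ≤ z) (hg : 0 < g)
    (hk : g ≤ 3 * k) (hx : x ≤ D * (N / k) ^ κ * (S ^ l * z ^ (1 - l)))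
    (hzM : z * (g / 2) ^ (κ / l) ≤ M) :
    x * g ^ (κ / l) ≤ 3 ^ κ * 2 ^ (κ / l) * D * ((N ^ (κ / l) * S) ^ l * M ^ (1 - l)) := by
  have hl1' : 0 ≤ 1 - l := sub_nonneg.2 hl1
  have hk0 : (0 : ℝ) < k := by linarith
  have hratio : N / k ≤ 3 * N / g := by
    rw [div_le_div_iff₀ hk0 hg]
    nlinarith
  have hz' : z ≤ M * (2 ^ (κ / l) / g ^ (κ / l)) := by
    rw [Real.div_rpow hg.le zero_le_two, ← mul_div_assoc, div_le_iff₀ (by positivity)] at hzM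
    rwa [← mul_div_assoc, le_div_iff₀ (by positivity)]
  have htwo : ((2 : ℝ) ^ (κ / l)) ^ (1 - l) ≤ 2 ^ (κ / l) := by
    rw [← Real.rpow_mul zero_le_two]
    refine Real.rpow_le_rpow_of_exponent_le one_le_two ?_
    exact mul_le_of_le_one_right (by positivity) (by linarith)
  have hg_pow : g ^ κ * (g ^ (κ / l)) ^ (1 - l) = g ^ (κ / l) := by
    rw [← Real.rpow_mul hg.le, ← Real.rpow_add hg]
    congr 1
    field_simp
    ring
  calc x * g ^ (κ / l) ≤ D * (3 * N / g) ^ κ *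
        (S ^ l * (M * (2 ^ (κ / l) / g ^ (κ / l))) ^ (1 - l)) * g ^ (κ / l) := by
        gcongr
        exact hx.trans (by gcongr)
    _ = D * 3 ^ κ * N ^ κ * S ^ l * M ^ (1 - l) * (2 ^ (κ / l)) ^ (1 - l) *
        (g ^ (κ / l) / (g ^ κ * (g ^ (κ / l)) ^ (1 - l))) := by
        rw [Real.div_rpow (by positivity) hg.le, Real.mul_rpow (by norm_num) hN,
          Real.mul_rpow hM (by positivity), Real.div_rpow (by positivity) (by positivity)]
        field_simp
    _ ≤ D * 3 ^ κ * N ^ κ * S ^ l * M ^ (1 - l) * 2 ^ (κ / l) * 1 := by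
        rw [hg_pow, div_self (by positivity)]
        gcongr
    _ = _ := by
        rw [Real.mul_rpow (by positivity) hS, ← Real.rpow_mul hN, div_mul_cancel₀ κ hl.ne']
        ring

theorem le_of_interpolation {m : ℕ → ℝ} {n : ℕ} {D S κ l : ℝ} (hn : 1 ≤ n) (hm : ∀ ρ, 0 ≤ m ρ)
    (hD : 1 ≤ D) (hS : 0 ≤ S) (hκ : 0 ≤ κ) (hl : 0 < l) (hl1 : l ≤ 1)
    (hlast : m (2 * n) ≤ (n : ℝ) ^ (κ / l) * S)
    (step : ∀ ρ σ : ℕ, n ≤ ρ → ρ < σ → σ ≤ 2 * n →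
      m ρ ≤ D * ((n : ℝ) / (σ - ρ)) ^ κ * (S ^ l * m σ ^ (1 - l))) :
    m n ≤ (3 ^ κ * 2 ^ (κ / l) * D) ^ (1 / l) * S := by
  have hN : (0 : ℝ) < n := by exact_mod_cast hn
  have hK : 1 ≤ 3 ^ κ * 2 ^ (κ / l) * D := one_le_mul_of_one_le_of_one_le
    (one_le_mul_of_one_le_of_one_le (Real.one_le_rpow (by norm_num) hκ)
      (Real.one_le_rpow one_le_two (by positivity))) hD
  -- At a maximal `ρ` the hypothesis, with `σ` half way between `ρ` and `2 n + 1`, bounds the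
  -- maximum in terms of a smaller power of itself.
  obtain ⟨ρ, hρ, hmax⟩ := (Finset.Icc n (2 * n)).exists_max_image
    (fun ρ => m ρ * ((2 * n + 1 - ρ : ℕ) : ℝ) ^ (κ / l)) ⟨n, by simp; omega⟩
  rw [Finset.mem_Icc] at hρ
  suffices hM : m ρ * ((2 * n + 1 - ρ : ℕ) : ℝ) ^ (κ / l) ≤
      (3 ^ κ * 2 ^ (κ / l) * D) ^ (1 / l) * ((n : ℝ) ^ (κ / l) * S) by
    refine le_of_mul_le_mul_right ?_ (by positivity : 0 < (n : ℝ) ^ (κ / l))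
    refine le_trans ?_ (((hmax n (by simp; omega)).trans hM).trans_eq (by ring))
    have hnn : (n : ℝ) ≤ (2 * n + 1 - n : ℕ) := by exact_mod_cast (by omega)
    have := hm n
    gcongr
  rcases hρ.2.eq_or_lt with rfl | hρn
  · rw [Nat.add_sub_cancel_left, Nat.cast_one, Real.one_rpow, mul_one]
    exact hlast.trans (le_mul_of_one_le_left (by positivity) (Real.one_le_rpow hK (by positivity)))
  · obtain ⟨g, hg⟩ : ∃ g, 2 * n + 1 = ρ + g := ⟨2 * n + 1 - ρ, by omega⟩
    have hσ := hmax (ρ + g / 2) (Finset.mem_Icc.2 (by omega))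
    have hstep := step ρ (ρ + g / 2) hρ.1 (by omega) (by omega)
    rw [Nat.cast_add, add_sub_cancel_left] at hstep
    rw [hg, Nat.add_sub_cancel_left] at hσ ⊢
    have hhalf : (g : ℝ) / 2 ≤ (ρ + g - (ρ + g / 2) : ℕ) := by
      rw [div_le_iff₀ two_pos]
      exact_mod_cast (by omega)
    have hM0 : 0 ≤ m ρ * (g : ℝ) ^ (κ / l) := mul_nonneg (hm ρ) (by positivity)
    refine le_of_le_mul_rpow_one_sub hM0 (by linarith) (by positivity) hl
      (mul_rpow_le_of_half_gap hN.le hS hM0 (by linarith) hκ hl hl1 (hm _)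
        (by exact_mod_cast (by omega)) (by exact_mod_cast (by omega)) hstep (le_trans ?_ hσ))
    have := hm (ρ + g / 2)
    gcongr

end Iteration

section LocalBoundedness

/-- The `k`-th energy of the Moser iteration on the dyadically shrinking boxes: the power of `w` is
`(1 + δ) ^ k`, and the radius decreases to `ρ`. -/
noncomputable def moserEnergy {d : ℕ} (t δ : ℝ) (n : ℕ) (y : LatticePt d) (ρ L : ℕ)
    (w : LatticePt d → ℝ) (k : ℕ) : ℝ :=
  scaledEnergy t n (box y (ρ + L / 2 ^ (k + 1))) fun x => w x ^ (1 + δ) ^ k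

variable {d : ℕ} {t δ : ℝ} {n : ℕ} {y : LatticePt d} {ρ L : ℕ} {w : LatticePt d → ℝ}

theorem moserEnergy_nonneg (hw : ∀ x, 0 ≤ w x) (k : ℕ) : 0 ≤ moserEnergy t δ n y ρ L w k :=
  scaledEnergy_nonneg fun x => Real.rpow_nonneg (hw x) _

theorem rpow_rpow_le_moserEnergy_log (hn : 1 ≤ n) (hw : ∀ x, 0 ≤ w x) {x : LatticePt d}
    (hx : x ∈ box y ρ) :
    (w x ^ t) ^ (1 + δ) ^ Nat.log 2 L ≤
      (n : ℝ) ^ (d : ℝ) * moserEnergy t δ n y ρ L w (Nat.log 2 L) := by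
  have hradius : ρ + L / 2 ^ (Nat.log 2 L + 1) = ρ := by
    rw [Nat.div_eq_of_lt (Nat.lt_pow_succ_log_self one_lt_two L), add_zero]
  have hpow : ∀ z, 0 ≤ (w z ^ (1 + δ) ^ Nat.log 2 L) ^ t :=
    fun z => Real.rpow_nonneg (Real.rpow_nonneg (hw z) _) _
  rw [← Real.rpow_mul (hw x), mul_comm t, Real.rpow_mul (hw x), moserEnergy, hradius]
  refine (Finset.single_le_sum (fun z _ => hpow z) hx).trans ?_
  rw [sum_eq_rpow_mul_scaledAvg hn (S := box y ρ)]
  exact mul_le_mul_of_nonneg_left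
    (scaledAvg_rpow_le_scaledEnergy hn fun z => Real.rpow_nonneg (hw z) _) (by positivity)

theorem rpow_le_two_mul_pow_mul_rpow {b : ℝ} (hδ : 0 < δ) (hL : 1 ≤ L) (hb : 2 ^ (d * δ) ≤ b) :
    (n : ℝ) ^ (d : ℝ) ≤ (2 * ((n : ℝ) / L)) ^ d * b ^ (Nat.log 2 L / δ) := by
  have hlog : (L : ℝ) ≤ 2 ^ (Nat.log 2 L + 1) := by
    exact_mod_cast (Nat.lt_pow_succ_log_self one_lt_two L).le
  have hn : (n : ℝ) ≤ 2 * ((n : ℝ) / L) * 2 ^ Nat.log 2 L := by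
    calc (n : ℝ) = (n : ℝ) / L * L := by field_simp
      _ ≤ (n : ℝ) / L * 2 ^ (Nat.log 2 L + 1) := by gcongr
      _ = _ := by ring
  have hbpow : ((2 : ℝ) ^ Nat.log 2 L) ^ d ≤ b ^ (Nat.log 2 L / δ) := by
    calc ((2 : ℝ) ^ Nat.log 2 L) ^ d = ((2 : ℝ) ^ (d * δ)) ^ (Nat.log 2 L / δ) := by
          rw [← Real.rpow_mul zero_le_two, mul_assoc, mul_div_cancel₀ _ hδ.ne', ← Nat.cast_mul,
            Real.rpow_natCast, ← pow_mul, mul_comm]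
      _ ≤ _ := by gcongr
  rw [Real.rpow_natCast]
  calc (n : ℝ) ^ d ≤ (2 * ((n : ℝ) / L) * 2 ^ Nat.log 2 L) ^ d := by gcongr
    _ ≤ _ := by rw [mul_pow]; gcongr

theorem rpow_le_of_dyadic_gap {R R' κ κ' : ℝ} {k : ℕ} (hR : 0 ≤ R) (hR' : 1 ≤ R')
    (h : R' ≤ 4 * 2 ^ (k + 1) * R) (hκ : κ' ≤ κ) (hκ0 : 0 ≤ κ) :
    R' ^ κ' ≤ 8 ^ κ * R ^ κ * (2 ^ κ) ^ (k : ℝ) := by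
  calc R' ^ κ' ≤ R' ^ κ := Real.rpow_le_rpow_of_exponent_le hR' hκ
    _ ≤ (8 * R * 2 ^ k) ^ κ := Real.rpow_le_rpow (by linarith) (h.trans_eq (by ring)) hκ0
    _ = _ := by
        rw [Real.mul_rpow (by positivity) (by positivity), Real.mul_rpow (by norm_num) hR,
          ← Real.rpow_natCast 2 k, ← Real.rpow_mul zero_le_two, ← Real.rpow_mul zero_le_two,
          mul_comm κ]

theorem le_rpow_mul_of_rpow_le_mul_rpow {x M X : ℝ} (ht : 0 < t) (hx : 0 ≤ x) (hM : 0 ≤ M)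
    (hX : 0 ≤ X) (h : x ^ t ≤ M * X ^ t) : x ≤ M ^ (1 / t) * X := by
  have := Real.rpow_le_rpow (by positivity) h (by positivity : 0 ≤ 1 / t)
  rwa [Real.mul_rpow hM (by positivity), ← Real.rpow_mul hx, ← Real.rpow_mul hX,
    mul_one_div_cancel ht.ne', Real.rpow_one, Real.rpow_one] at this

theorem moser_product_eq {R C₀ C₁ Λ Z κ P : ℝ} (hR : 0 < R) (hC₁ : 0 ≤ C₁) (hΛ : 0 < Λ)
    (hZ : 0 ≤ Z) (ht : t ≠ 0) (hδ : δ ≠ 0) :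
    (2 * R) ^ d * ((C₁ * (Λ ^ (t / 2) * R ^ κ)) ^ (1 / δ) * (2 ^ κ) ^ (1 / δ ^ 2) *
        (C₀ * (Λ ^ (t / 2) * R ^ t * Z ^ ((1 - P) * (t / 2))))) =
      2 ^ d * C₁ ^ (1 / δ) * (2 ^ κ) ^ (1 / δ ^ 2) * C₀ *
        (Λ ^ ((1 + δ) / (2 * δ)) * R ^ ((d + κ / δ + t) / t) * Z ^ ((1 - P) / 2)) ^ t := by
  have hΛpow : Λ ^ ((1 + δ) / (2 * δ) * t) = Λ ^ (t / 2 * (1 / δ)) * Λ ^ (t / 2) := by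
    rw [← Real.rpow_add hΛ]
    congr 1
    field_simp
  have hRpow : R ^ (d + κ / δ + t) = R ^ d * R ^ (κ * (1 / δ)) * R ^ t := by
    rw [Real.rpow_add hR, Real.rpow_add hR, Real.rpow_natCast, mul_one_div]
  rw [Real.mul_rpow hC₁ (by positivity), Real.mul_rpow (by positivity) (by positivity),
    Real.mul_rpow (by positivity) (by positivity), Real.mul_rpow (by positivity) (by positivity),
    ← Real.rpow_mul hΛ.le, ← Real.rpow_mul hΛ.le, ← Real.rpow_mul hR.le, ← Real.rpow_mul hR.le,
    ← Real.rpow_mul hZ, div_mul_cancel₀ _ ht, hΛpow, hRpow, mul_pow,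
    div_mul_eq_mul_div (1 - P), mul_div_assoc (1 - P)]
  ring

namespace IterExponents

variable {P Q s : ℝ}

theorem exists_moserEnergy_succ_le (h : IterExponents d P Q δ t s) :
    ∃ C κ : ℝ, 1 ≤ C ∧ d * δ ≤ κ ∧ ∀ {A B : ℝ} {y : LatticePt d} {n : ℕ} {ω a b : Bond d → ℝ},
      WeightBound P Q A B y n ω a b → ∀ w, IsNonnegSubsolution ω w →
      ∀ ρ L : ℕ, n ≤ ρ → ρ + L ≤ 2 * n → ∀ k, 2 ^ (k + 1) ≤ L →
      moserEnergy t δ n y ρ L w (k + 1) ≤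
        C * ((A * B) ^ (t / 2) * ((n : ℝ) / L) ^ κ) * (2 ^ κ) ^ (k : ℝ) *
          moserEnergy t δ n y ρ L w k ^ (1 + δ) := by
  obtain ⟨C, hC, H⟩ := h.exists_scaledEnergy_step
  have hδ := h.δ_pos
  have ht := h.t_pos
  have hd : 0 < (d : ℝ) - 1 := by linarith [h.three_le_cast]
  set κ₁ : ℝ := (2 + 2 / ((d : ℝ) - 1)) * (t / 2)
  have hκ₁ : 0 ≤ κ₁ := by positivity
  have hdδ : 0 ≤ d * δ := by positivity
  refine ⟨max 1 (C * 8 ^ (κ₁ + d * δ)), κ₁ + d * δ, le_max_left _ _, by linarith, ?_⟩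
  intro A B y n ω a b hW w hw ρ L hnρ hL k hk
  set κ : ℝ := κ₁ + d * δ
  have hκ : 0 ≤ κ := add_nonneg hκ₁ hdδ
  have hAB : 0 ≤ A * B := by linarith [hW.one_le_mul]
  have hlt : ρ + L / 2 ^ (k + 1 + 1) < ρ + L / 2 ^ (k + 1) :=
    Nat.add_lt_add_left (div_two_pow_succ_lt hk) ρ
  have hle : ρ + L / 2 ^ (k + 1) ≤ 2 * n :=
    (Nat.add_le_add_left (Nat.div_le_self _ _) ρ).trans hL
  have hnρ' : n ≤ ρ + L / 2 ^ (k + 1 + 1) := hnρ.trans (Nat.le_add_right _ _)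
  have hstep := H hW w hw ((1 + δ) ^ k) (one_le_pow₀ (by linarith)) _ _ hnρ' hlt hle
  simp only [← Real.rpow_mul (hw.nonneg _), ← pow_succ] at hstep
  have hgap_one := one_le_div_sub hnρ' hlt hle
  have hgap := div_dyadic_gap_le (Nat.cast_nonneg (α := ℝ) n) ρ hk
  have hE := moserEnergy_nonneg (t := t) (δ := δ) (n := n) (y := y) (ρ := ρ) (L := L) hw.nonneg k
  refine hstep.trans ?_
  rw [← moserEnergy]
  generalize (n : ℝ) / (((ρ + L / 2 ^ (k + 1) : ℕ) : ℝ) - _) = R' at hgap_one hgap ⊢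
  generalize moserEnergy t δ n y ρ L w k = E at hE ⊢
  have hpow := rpow_le_of_dyadic_gap (by positivity) hgap_one hgap (le_add_of_nonneg_right hdδ) hκ
  calc _ ≤ C * ((A * B) ^ (t / 2) * (8 ^ κ * ((n : ℝ) / L) ^ κ * (2 ^ κ) ^ (k : ℝ)) *
        E ^ (1 + δ)) := by gcongr
    _ = C * 8 ^ κ * ((A * B) ^ (t / 2) * ((n : ℝ) / L) ^ κ) * (2 ^ κ) ^ (k : ℝ) *
        E ^ (1 + δ) := by ring
    _ ≤ _ := by gcongr; exact le_max_right _ _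

theorem exists_moserEnergy_zero_le (h : IterExponents d P Q δ t s) :
    ∃ C : ℝ, 0 < C ∧ ∀ {A B : ℝ} {y : LatticePt d} {n : ℕ} {ω a b : Bond d → ℝ},
      WeightBound P Q A B y n ω a b → ∀ w, IsNonnegSubsolution ω w →
      ∀ ρ L : ℕ, n ≤ ρ → 1 ≤ L → ρ + L ≤ 2 * n →
      moserEnergy t δ n y ρ L w 0 ≤ C * ((A * B) ^ (t / 2) * ((n : ℝ) / L) ^ t *
        (scaledAvg n (box y (ρ + L)) fun x => w x ^ (2 / (1 - P))) ^ ((1 - P) * (t / 2))) := by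
  obtain ⟨C, hC, H⟩ := h.exists_scaledEnergy_start
  have ht := h.t_pos
  refine ⟨C * 4 ^ t, by positivity, ?_⟩
  intro A B y n ω a b hW w hw ρ L hnρ hL hLn
  have hAB : 0 ≤ A * B := by linarith [hW.one_le_mul]
  have hZ : 0 ≤ scaledAvg n (box y (ρ + L)) fun x => w x ^ (2 / (1 - P)) :=
    scaledAvg_nonneg fun x => Real.rpow_nonneg (hw.nonneg x) _
  have hlt : ρ + L / 2 ^ (0 + 1) < ρ + L / 2 ^ 0 :=
    Nat.add_lt_add_left (div_two_pow_succ_lt (by simpa)) ρ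
  have hle : ρ + L / 2 ^ 0 ≤ 2 * n := by simpa
  have hnρ' : n ≤ ρ + L / 2 ^ (0 + 1) := hnρ.trans (Nat.le_add_right _ _)
  have hstart := H hW w hw _ _ hnρ' hlt hle
  have hgap_one := one_le_div_sub hnρ' hlt hle
  have hgap := div_dyadic_gap_le (Nat.cast_nonneg (α := ℝ) n) ρ (L := L) (j := 0) (by simpa)
  generalize (n : ℝ) / (((ρ + L / 2 ^ 0 : ℕ) : ℝ) - _) = R' at hgap_one hgap hstart
  simp only [moserEnergy, pow_zero, Real.rpow_one]
  simp only [pow_zero, Nat.div_one, mul_one] at hgap hstart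
  have hpow : R' ^ (2 * (t / 2)) ≤ 4 ^ t * ((n : ℝ) / L) ^ t := by
    rw [mul_div_cancel₀ t two_ne_zero, ← Real.mul_rpow (by norm_num) (by positivity)]
    gcongr
  refine hstart.trans ((mul_le_mul_of_nonneg_left (mul_le_mul_of_nonneg_right
    (mul_le_mul_of_nonneg_left hpow (by positivity)) (by positivity)) hC.le).trans_eq (by ring))

theorem exists_le_scaledAvg_rpow (h : IterExponents d P Q δ t s) :
    ∃ C κ : ℝ, 0 ≤ κ ∧ ∀ {A B : ℝ} {y : LatticePt d} {n : ℕ} {ω a b : Bond d → ℝ},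
      WeightBound P Q A B y n ω a b → ∀ w, IsNonnegSubsolution ω w →
      ∀ ρ L : ℕ, n ≤ ρ → 1 ≤ L → ρ + L ≤ 2 * n → ∀ x ∈ box y ρ,
      w x ≤ C * ((A * B) ^ ((1 + δ) / (2 * δ)) * ((n : ℝ) / L) ^ κ *
        (scaledAvg n (box y (ρ + L)) fun x => w x ^ (2 / (1 - P))) ^ ((1 - P) / 2)) := by
  obtain ⟨C₁, κ, hC₁, hκ, H₁⟩ := h.exists_moserEnergy_succ_le
  obtain ⟨C₀, hC₀, H₀⟩ := h.exists_moserEnergy_zero_le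
  have ht := h.t_pos
  have hδ := h.δ_pos
  have hκ0 : 0 ≤ κ := le_trans (by positivity) hκ
  have hb : (1 : ℝ) ≤ 2 ^ κ := Real.one_le_rpow one_le_two hκ0
  set M : ℝ := 2 ^ d * C₁ ^ (1 / δ) * (2 ^ κ) ^ (1 / δ ^ 2) * C₀ with hM
  refine ⟨M ^ (1 / t), (d + κ / δ + t) / t, by positivity, ?_⟩
  intro A B y n ω a b hW w hw ρ L hnρ hL hLn x hx
  have hΛ := hW.one_le_mul
  have hZ : 0 ≤ scaledAvg n (box y (ρ + L)) fun x => w x ^ (2 / (1 - P)) :=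
    scaledAvg_nonneg fun x => Real.rpow_nonneg (hw.nonneg x) _
  have hR : 1 ≤ (n : ℝ) / L := (one_le_div (by positivity)).2 (by exact_mod_cast (by omega))
  have hE := moserEnergy_nonneg (t := t) (δ := δ) (n := n) (y := y) (ρ := ρ) (L := L) hw.nonneg
  have hlast := (rpow_rpow_le_moserEnergy_log hW.one_le hw.nonneg hx).trans
    (mul_le_mul_of_nonneg_right (rpow_le_two_mul_pow_mul_rpow (d := d) (n := n) hδ hL
      (Real.rpow_le_rpow_of_exponent_le one_le_two hκ)) (hE (Nat.log 2 L)))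
  have hmoser := le_of_iterate_superlinear hE (one_le_mul_of_one_le_of_one_le hC₁
      (one_le_mul_of_one_le_of_one_le (Real.one_le_rpow hΛ (by positivity))
        (Real.one_le_rpow hR hκ0))) hb hδ (one_le_pow₀ (by linarith))
    (Real.rpow_nonneg (hw.nonneg x) t) (fun k hk => H₁ hW w hw ρ L hnρ hLn k
      (Nat.pow_le_of_le_log (by omega) hk)) hlast
  have hstart := H₀ hW w hw ρ L hnρ hL hLn
  generalize A * B = Λ at *
  generalize (n : ℝ) / L = R at *
  generalize scaledAvg n (box y (ρ + L)) (fun x => w x ^ (2 / (1 - P))) = Z at *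
  refine le_rpow_mul_of_rpow_le_mul_rpow ht (hw.nonneg x) (by positivity) (by positivity) ?_
  rw [hM, ← moser_product_eq (by linarith) (by linarith) (by linarith) hZ ht.ne' hδ.ne']
  refine hmoser.trans ?_
  gcongr

end IterExponents

end LocalBoundedness

section MeanValue

variable {d : ℕ}

theorem self_mem_box (y : LatticePt d) (n : ℕ) : y ∈ box y n :=
  (mem_box _ _ _).2 fun i => by simp

theorem scaledAvg_rpow_le_mul {n : ℕ} {S S' : Finset (LatticePt d)} {w : LatticePt d → ℝ}
    {l K : ℝ} (hS : S ⊆ S') (hw : ∀ x, 0 ≤ w x) (hl : 0 < l) (hl1 : l ≤ 1) (hK : 0 ≤ K)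
    (hwK : ∀ x ∈ S, w x ≤ K) :
    (scaledAvg n S fun x => w x ^ (1 / l)) ^ l ≤ scaledAvg n S' w ^ l * K ^ (1 - l) := by
  have hexp : 0 ≤ 1 / l - 1 := sub_nonneg.2 ((one_le_div hl).2 hl1)
  have havg : (scaledAvg n S fun x => w x ^ (1 / l)) ≤ scaledAvg n S' w * K ^ (1 / l - 1) := by
    refine le_trans ?_ (mul_le_mul_of_nonneg_right (scaledAvg_mono hS hw) (by positivity))
    rw [scaledAvg, scaledAvg, mul_assoc, Finset.sum_mul]
    refine mul_le_mul_of_nonneg_left (Finset.sum_le_sum fun x hx => ?_) (by positivity)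
    calc w x ^ (1 / l) = w x * w x ^ (1 / l - 1) := by
          conv_lhs => rw [← add_sub_cancel 1 (1 / l)]
          rw [Real.rpow_add_of_nonneg (hw x) zero_le_one hexp, Real.rpow_one]
      _ ≤ w x * K ^ (1 / l - 1) :=
          mul_le_mul_of_nonneg_left (Real.rpow_le_rpow (hw x) (hwK x hx) hexp) (hw x)
  refine (Real.rpow_le_rpow (scaledAvg_nonneg fun x => Real.rpow_nonneg (hw x) _) havg
    hl.le).trans_eq ?_
  rw [Real.mul_rpow (scaledAvg_nonneg hw) (by positivity), ← Real.rpow_mul hK, sub_mul,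
    one_div_mul_cancel hl.ne', one_mul]

namespace IterExponents

variable {P Q δ t s : ℝ}

theorem exists_sup_box_le (h : IterExponents d P Q δ t s) :
    ∃ C κ : ℝ, 1 ≤ C ∧ d ≤ κ ∧ ∀ {A B : ℝ} {y : LatticePt d} {n : ℕ} {ω a b : Bond d → ℝ},
      WeightBound P Q A B y n ω a b → ∀ w, IsNonnegSubsolution ω w →
      ∀ ρ σ : ℕ, n ≤ ρ → ρ < σ → σ ≤ 2 * n →
      (box y ρ).sup' ⟨y, self_mem_box y ρ⟩ w ≤
        C * (A * B) ^ ((1 + δ) / (2 * δ)) * ((n : ℝ) / (σ - ρ)) ^ κ *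
          (scaledAvg n (box y (2 * n)) w ^ ((1 - P) / 2) *
            (box y σ).sup' ⟨y, self_mem_box y σ⟩ w ^ (1 - (1 - P) / 2)) := by
  obtain ⟨C, κ, hκ, H⟩ := h.exists_le_scaledAvg_rpow
  have hP : 0 < (1 - P) / 2 := half_pos (sub_pos.2 h.P_lt_one)
  have hP1 : (1 - P) / 2 ≤ 1 := by linarith [h.P_nonneg]
  refine ⟨max 1 C, κ + d, le_max_left _ _, by linarith, ?_⟩
  intro A B y n ω a b hW w hw ρ σ hnρ hρσ hσ
  refine Finset.sup'_le _ _ fun x hx => ?_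
  have hbound := H hW w hw ρ (σ - ρ) hnρ (by omega) (by omega) x hx
  rw [Nat.add_sub_cancel' hρσ.le, Nat.cast_sub hρσ.le, ← one_div_div (1 - P)] at hbound
  have hsup : 0 ≤ (box y σ).sup' ⟨y, self_mem_box y σ⟩ w :=
    (hw.nonneg y).trans (Finset.le_sup' w (self_mem_box y σ))
  have hinterp := scaledAvg_rpow_le_mul (n := n) (box_mono hσ y) hw.nonneg hP hP1 hsup
    fun z hz => Finset.le_sup' w hz
  have hR := one_le_div_sub hnρ hρσ hσ
  have hΛ : 0 ≤ (A * B) ^ ((1 + δ) / (2 * δ)) :=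
    Real.rpow_nonneg (zero_le_one.trans hW.one_le_mul) _
  have hRpow : ((n : ℝ) / (σ - ρ)) ^ κ ≤ ((n : ℝ) / (σ - ρ)) ^ (κ + d) :=
    Real.rpow_le_rpow_of_exponent_le hR (by linarith [Nat.cast_nonneg (α := ℝ) d])
  have hZ : 0 ≤ (scaledAvg n (box y σ) fun x => w x ^ (1 / ((1 - P) / 2))) ^ ((1 - P) / 2) :=
    Real.rpow_nonneg (scaledAvg_nonneg fun x => Real.rpow_nonneg (hw.nonneg x) _) _
  rw [mul_assoc, mul_assoc, ← mul_assoc (_ ^ _)]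
  refine hbound.trans ?_
  gcongr
  exact le_max_right _ _

theorem exists_le_scaledAvg (h : IterExponents d P Q δ t s) :
    ∃ C : ℝ, 1 ≤ C ∧ ∀ {A B : ℝ} {y : LatticePt d} {n : ℕ} {ω a b : Bond d → ℝ},
      WeightBound P Q A B y n ω a b → ∀ w, IsNonnegSubsolution ω w → ∀ x ∈ box y n,
      w x ≤ C * (A * B) ^ (1 / (1 - P) * ((δ + 1) / δ)) * scaledAvg n (box y (2 * n)) w := by
  obtain ⟨C, κ, hC, hκ, H⟩ := h.exists_sup_box_le
  have hδ := h.δ_pos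
  have hκ0 : 0 ≤ κ := (Nat.cast_nonneg d).trans hκ
  have hP0 : 1 - P ≠ 0 := (sub_pos.2 h.P_lt_one).ne'
  have hP : 0 < (1 - P) / 2 := half_pos (sub_pos.2 h.P_lt_one)
  have hP1 : (1 - P) / 2 ≤ 1 := by linarith [h.P_nonneg]
  set l := (1 - P) / 2 with hl
  refine ⟨(3 ^ κ * 2 ^ (κ / l) * C) ^ (1 / l), Real.one_le_rpow (one_le_mul_of_one_le_of_one_le
    (one_le_mul_of_one_le_of_one_le (Real.one_le_rpow (by norm_num) hκ0)
      (Real.one_le_rpow one_le_two (by positivity))) hC) (by positivity), ?_⟩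
  intro A B y n ω a b hW w hw x hx
  have hΛ := hW.one_le_mul
  have hN : (1 : ℝ) ≤ n := by exact_mod_cast hW.one_le
  have hS : 0 ≤ scaledAvg n (box y (2 * n)) w := scaledAvg_nonneg hw.nonneg
  have hlast : (box y (2 * n)).sup' ⟨y, self_mem_box y (2 * n)⟩ w ≤
      (n : ℝ) ^ (κ / l) * scaledAvg n (box y (2 * n)) w := by
    refine Finset.sup'_le _ _ fun z hz =>
      (Finset.single_le_sum (fun z _ => hw.nonneg z) hz).trans ?_
    rw [sum_eq_rpow_mul_scaledAvg hW.one_le]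
    refine mul_le_mul_of_nonneg_right (Real.rpow_le_rpow_of_exponent_le hN ?_) hS
    exact hκ.trans (le_div_self hκ0 hP hP1)
  refine (Finset.le_sup' w hx).trans ((le_of_interpolation hW.one_le
    (fun ρ => (hw.nonneg y).trans (Finset.le_sup' w (self_mem_box y ρ)))
    (one_le_mul_of_one_le_of_one_le hC (Real.one_le_rpow hΛ (by positivity))) hS hκ0 hP hP1 hlast
    (H hW w hw)).trans_eq ?_)
  have hexp : (1 + δ) / (2 * δ) * (1 / l) = 1 / (1 - P) * ((δ + 1) / δ) := by
    rw [hl]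
    field_simp
    ring
  rw [← mul_assoc, Real.mul_rpow (by positivity) (by positivity), ← Real.rpow_mul (by linarith),
    hexp]

end IterExponents

end MeanValue

section AveragedNorms

variable {d : ℕ}

theorem exists_le_avgNorm_mul_rpow {α : Type*} {p : ℝ≥0∞} (hp : p ≠ 0) {S : Finset α}
    (hS : S.Nonempty) {F : α → ℝ} (hF : ∀ e, 0 < F e) :
    0 < avgNorm p S F ∧ ∃ a : α → ℝ, (∀ e, 0 ≤ a e) ∧ ∑ e ∈ S, a e = S.card ∧
      ∀ e ∈ S, F e ≤ avgNorm p S F * a e ^ p⁻¹.toReal := by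
  by_cases hpt : p = ∞
  · have hle : ∀ e ∈ S, F e ≤ avgNorm p S F := by
      intro e he
      rw [avgNorm, if_pos hpt]
      exact (le_abs_self _).trans
        (le_ciSup (f := fun a : S => |F a|) (Set.finite_range _).bddAbove ⟨e, he⟩)
    obtain ⟨e₀, he₀⟩ := hS
    exact ⟨(hF e₀).trans_le (hle e₀ he₀), fun _ => 1, fun _ => zero_le_one, by simp,
      by simpa using hle⟩
  · have hp0 : 0 < p.toReal := ENNReal.toReal_pos hp hpt
    have hcard : (S.card : ℝ) ≠ 0 := by exact_mod_cast hS.card_pos.ne'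
    have hFp : ∀ e, 0 < |F e| ^ p.toReal := fun e => Real.rpow_pos_of_pos (abs_pos.2 (hF e).ne') _
    set m : ℝ := (S.card : ℝ)⁻¹ * ∑ e ∈ S, |F e| ^ p.toReal with hm
    have hm0 : 0 < m := mul_pos (by positivity) (Finset.sum_pos (fun e _ => hFp e) hS)
    have hnorm : avgNorm p S F = m ^ (1 / p.toReal) := by rw [avgNorm, if_neg hpt]
    rw [hnorm]
    refine ⟨by positivity, fun e => |F e| ^ p.toReal / m, fun e => (div_pos (hFp e) hm0).le,
      ?_, fun e _ => ?_⟩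
    · rw [← Finset.sum_div, div_eq_iff hm0.ne', hm, mul_inv_cancel_left₀ hcard]
    · rw [ENNReal.toReal_inv, Real.div_rpow (hFp e).le hm0.le, ← Real.rpow_mul (abs_nonneg _),
        mul_inv_cancel₀ hp0.ne', Real.rpow_one, one_div, mul_div_cancel₀ _ (by positivity)]
      exact le_abs_self _

theorem one_le_mul_of_le_mul_rpow {α : Type*} {S : Finset α} (hS : S.Nonempty) {P Q A B : ℝ}
    {ω a b : α → ℝ} (hP : 0 ≤ P) (hQ : 0 ≤ Q) (hPQ : P + Q ≤ 1) (hω : ∀ e, 0 < ω e)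
    (hA : 0 ≤ A) (hB : 0 ≤ B) (ha : ∀ e, 0 ≤ a e) (hb : ∀ e, 0 ≤ b e)
    (hsum_a : ∑ e ∈ S, a e = S.card) (hsum_b : ∑ e ∈ S, b e = S.card)
    (hωA : ∀ e ∈ S, ω e ≤ A * a e ^ P) (hωB : ∀ e ∈ S, (ω e)⁻¹ ≤ B * b e ^ Q) : 1 ≤ A * B := by
  have hcard : (0 : ℝ) < S.card := by exact_mod_cast hS.card_pos
  have hpoint : ∀ e ∈ S, 1 ≤ A * B * (P * a e + Q * b e + (1 - P - Q) * 1) := by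
    intro e he
    have hprod := mul_le_mul (hωA e he) (hωB e he) (inv_pos.2 (hω e)).le
      (mul_nonneg hA (Real.rpow_nonneg (ha e) _))
    have hamgm := Real.geom_mean_le_arith_mean3_weighted hP hQ (by linarith : 0 ≤ 1 - P - Q)
      (ha e) (hb e) zero_le_one (by ring)
    rw [mul_inv_cancel₀ (hω e).ne', mul_mul_mul_comm] at hprod
    rw [Real.one_rpow, mul_one] at hamgm
    exact hprod.trans (mul_le_mul_of_nonneg_left hamgm (mul_nonneg hA hB))
  have hsum := Finset.sum_le_sum hpoint
  simp only [← Finset.mul_sum, Finset.sum_add_distrib, hsum_a, hsum_b, Finset.sum_const,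
    nsmul_eq_mul, mul_one] at hsum
  exact le_of_mul_le_mul_right (by linarith) hcard

theorem card_bondsIn_le (S : Finset (LatticePt d)) : (bondsIn S).card ≤ d * S.card := by
  refine (Finset.card_filter_le _ _).trans_eq ?_
  rw [Finset.card_product, Finset.card_univ, Fintype.card_fin, mul_comm]

theorem bondsIn_box_nonempty (hd : 0 < d) (y : LatticePt d) {n : ℕ} (hn : 1 ≤ n) :
    (bondsIn (box y n)).Nonempty := by
  refine ⟨(y, ⟨0, hd⟩), (mem_bondsIn _ _).2 ⟨self_mem_box y n, (mem_box _ _ _).2 fun i => ?_⟩⟩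
  rw [Bond.upper, Pi.add_apply, add_sub_cancel_left, Pi.single_apply]
  split_ifs
  · simp only [abs_one]
    omega
  · simp

theorem exists_weightBound (hd : 0 < d) {p q : ℝ≥0∞} (hp : p ≠ 0) (hq : q ≠ 0)
    (hpq : p⁻¹.toReal + q⁻¹.toReal ≤ 1) {ω : Bond d → ℝ} (hω : ∀ b, 0 < ω b) (y : LatticePt d)
    {n : ℕ} (hn : 1 ≤ n) :
    ∃ a b, WeightBound p⁻¹.toReal q⁻¹.toReal (avgNorm p (bondsIn (box y (2 * n))) ω)
      (avgNorm q (bondsIn (box y (2 * n))) fun b => (ω b)⁻¹) y n ω a b := by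
  have hne : (bondsIn (box y (2 * n))).Nonempty := bondsIn_box_nonempty hd y (by omega)
  obtain ⟨hA, a, ha, hsum_a, hωA⟩ := exists_le_avgNorm_mul_rpow hp hne hω
  obtain ⟨hB, b, hb, hsum_b, hωB⟩ := exists_le_avgNorm_mul_rpow hq hne
    (F := fun b => (ω b)⁻¹) fun e => inv_pos.2 (hω e)
  have hcard : ((bondsIn (box y (2 * n))).card : ℝ) ≤ d * 5 ^ d * (n : ℝ) ^ (d : ℝ) := by
    refine (Nat.cast_le.2 (card_bondsIn_le _)).trans ?_
    rw [Nat.cast_mul, mul_assoc]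
    exact mul_le_mul_of_nonneg_left (card_box_le hn le_rfl y) (by positivity)
  exact ⟨a, b, hn, hω, ha, hb, hA, hB,
    one_le_mul_of_le_mul_rpow hne ENNReal.toReal_nonneg ENNReal.toReal_nonneg hpq hω hA.le hB.le
      ha hb hsum_a hsum_b hωA hωB,
    hωA, hωB, hsum_a.trans_le hcard, hsum_b.trans_le hcard⟩

theorem scaledAvg_box_le_avgNorm_one {n σ : ℕ} (hn : 1 ≤ n) (hσ : σ ≤ 2 * n) (y : LatticePt d)
    {w : LatticePt d → ℝ} (hw : ∀ x, 0 ≤ w x) :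
    scaledAvg n (box y σ) w ≤ 5 ^ d * avgNorm 1 (box y σ) w := by
  have hcard : (0 : ℝ) < (box y σ).card := by
    exact_mod_cast Finset.card_pos.2 ⟨y, self_mem_box y σ⟩
  simp only [avgNorm, ENNReal.one_ne_top, if_false, ENNReal.toReal_one, Real.rpow_one, div_one,
    abs_of_nonneg (hw _)]
  rw [scaledAvg, ← mul_assoc]
  refine mul_le_mul_of_nonneg_right ?_ (Finset.sum_nonneg fun x _ => hw x)
  rw [Real.rpow_neg (by positivity), ← div_eq_mul_inv, le_div_iff₀ hcard,
    inv_mul_le_iff₀ (by positivity), mul_comm]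
  exact card_box_le hn hσ y

theorem avgNorm_abs {α : Type*} (p : ℝ≥0∞) (S : Finset α) (F : α → ℝ) :
    avgNorm p S (fun a => |F a|) = avgNorm p S F := by
  simp only [avgNorm, abs_abs]

theorem dualExp_eq {p : ℝ≥0∞} (hp : 1 < p) : dualExp p = 1 / (1 - p⁻¹.toReal) := by
  by_cases hpt : p = ∞
  · simp [dualExp, hpt]
  · have hp1 : 1 < p.toReal := by
      rwa [← ENNReal.toReal_one, ENNReal.toReal_lt_toReal ENNReal.one_ne_top hpt]
    have hp0 : p.toReal - 1 ≠ 0 := by linarith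
    rw [dualExp, if_neg hpt, ENNReal.toReal_inv]
    field_simp

end AveragedNorms

theorem delta_pos {d : ℕ} {p q : ℝ≥0∞} (hpq : p⁻¹.toReal + q⁻¹.toReal < 2 / ((d : ℝ) - 1)) :
    0 < delta d p q := by
  rw [delta]
  linarith [(by ring : 2 / ((d : ℝ) - 1) = 2 * (1 / ((d : ℝ) - 1)))]

theorem iterExponents_delta {d : ℕ} (hd : 3 ≤ d) {p q : ℝ≥0∞}
    (hpq : p⁻¹.toReal + q⁻¹.toReal < 2 / ((d : ℝ) - 1)) :
    IterExponents d p⁻¹.toReal q⁻¹.toReal (delta d p q) (2 / (1 + q⁻¹.toReal))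
      (2 / (1 + q⁻¹.toReal + 2 * delta d p q)) :=
  ⟨hd, ENNReal.toReal_nonneg, ENNReal.toReal_nonneg, delta_pos hpq, rfl, rfl, rfl⟩

theorem theorem1p4_general {d : ℕ} (hd : 3 ≤ d) {p q : ℝ≥0∞} (hp : 1 < p) (hq : 1 < q)
    (hpq : p⁻¹.toReal + q⁻¹.toReal < 2 / ((d : ℝ) - 1)) :
    ∃ c : ℝ, 1 ≤ c ∧ ∀ ω : Bond d → ℝ, (∀ b, 0 < ω b) → ∀ w, IsNonnegSubsolution ω w →
      ∀ (y : LatticePt d) (n : ℕ), 1 ≤ n → ∀ x ∈ box y n,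
        w x ≤ c * Lam p q ω (box y (2 * n)) ^ (dualExp p * ((delta d p q + 1) / delta d p q)) *
          avgNorm 1 (box y (2 * n)) w := by
  have hexp := iterExponents_delta hd hpq
  obtain ⟨C, hC, H⟩ := hexp.exists_le_scaledAvg
  refine ⟨C * 5 ^ d, one_le_mul_of_one_le_of_one_le hC (one_le_pow₀ (by norm_num)), ?_⟩
  intro ω hω w hw y n hn x hx
  obtain ⟨a, b, hW⟩ := exists_weightBound (by omega) (zero_lt_one.trans hp).ne'
    (zero_lt_one.trans hq).ne' hexp.add_lt_one.le hω y hn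
  have hΛ : 0 ≤ Lam p q ω (box y (2 * n)) := zero_le_one.trans hW.one_le_mul
  calc w x ≤ C * Lam p q ω (box y (2 * n)) ^ (dualExp p * ((delta d p q + 1) / delta d p q)) *
        scaledAvg n (box y (2 * n)) w := by rw [dualExp_eq hp]; exact H hW w hw x hx
    _ ≤ C * Lam p q ω (box y (2 * n)) ^ (dualExp p * ((delta d p q + 1) / delta d p q)) *
        (5 ^ d * avgNorm 1 (box y (2 * n)) w) :=
        mul_le_mul_of_nonneg_left (scaledAvg_box_le_avgNorm_one hn le_rfl y hw.nonneg)
          (by positivity)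
    _ = _ := by ring

theorem theorem1p4 (d : ℕ) (hd : 3 ≤ d) (p q : ℝ≥0∞) (hp : 1 < p) (hq : 1 < q)
    (hpq : p⁻¹.toReal + q⁻¹.toReal < 2 / ((d : ℝ) - 1)) :
    0 < delta d p q ∧
    ∃ c : ℝ, 1 ≤ c ∧
      ∀ ω : Bond d → ℝ, (∀ b, 0 < ω b) →
      ∀ u : LatticePt d → ℝ, (∀ x, divStar (fun b => ω b * grad u b) x = 0) →
      ∀ (y : LatticePt d) (n : ℕ), 1 ≤ n →
      ∀ x ∈ box y n,
        |u x| ≤ c * Lam p q ω (box y (2 * n)) ^ (dualExp p * ((delta d p q + 1) / delta d p q)) *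
          avgNorm 1 (box y (2 * n)) u := by
  obtain ⟨c, hc, H⟩ := theorem1p4_general hd hp hq hpq
  refine ⟨delta_pos hpq, c, hc, fun ω hω u hu y n hn x hx => ?_⟩
  rw [← avgNorm_abs]
  exact H ω hω _ (.abs_of_harmonic (fun b => (hω b).le) hu) y n hn x hx
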